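/- **Definitions.** A *$^*$-graph* in variables $(x_j)_{j\in J}$ is a finite directed multigraph (loops allowed) whose edges are labelled by symbols $x_j$ or $x_j^*$. A *$^*$-test graph* is a connected $^*$-graph, a *$^*$-graph monomial* is a connected $^*$-graph with two marked vertices in and out, and an *$n^*$-graph monomial* ($n\ge1$) is a connected $^*$-graph with an $n$-tuple of marked vertices; all are considered up to isomorphism. The adjoint reverses edges and exchanges $x_j$ and $x_j^*$ (and, for $^*$-graph monomials, in and out). A *$^*$-probability space* is a unital $^*$-algebra $\mathcal A$ over $\mathbb C$ with a linear form $\Phi$ such that $\Phi(1)=1$, $\Phi(ab)=\Phi(ba)$ and $\Phi(a^*a)\ge0$. A *space of traffics* is a $^*$-probability space with evaluations $t(\mathbf a)\in\mathcal A$ of $^*$-graph monomials $t$ and $\tau[T(\mathbf a)]\in\mathbb C$ of $^*$-test graphs $T$ at families $\mathbf a=(a_j)_{j\in J}$ in $\mathcal A$, such that: evaluation is compatible with substitution of $^*$-graph monomials for the edges (an edge labelled $x_j^\varepsilon$ is replaced by $t_j^\varepsilon$, in being glued to its source and out to its target) and with renaming of variables; it is linear in a variable that labels exactly one edge, with label $x_j$;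 a directed path labelled $x_{j_1}^{\varepsilon_1},\dots,x_{j_L}^{\varepsilon_L}$ from in to out evaluates to $a_{j_1}^{\varepsilon_1}\cdots a_{j_L}^{\varepsilon_L}$; evaluating $x_j$ at $1$ amounts to contracting the edges labelled $x_j$ or $x_j^*$; $t^*(\mathbf a)=t(\mathbf a)^*$; $\Phi(t(\mathbf a))=\tau[\tilde T(\mathbf a)]$, where $\tilde T$ is obtained from $t$ by identifying in and out; and $\sum_{i,k}\overline{c_i}c_k\,\tau[T(t_i^*,t_k)(\mathbf a)]\ge0$ for all $n\ge 1$, complex numbers $c_i$ and $n^*$-graph monomials $t_i$, where $T(t,t')$ is obtained by merging the $i$-th marked vertices of $t$ and $t'$ for each $i$. The *injective trace* $\tau^0$ is defined by $\tau[T(\mathbf a)]=\sum_{\pi}\tau^0[T^\pi(\mathbf a)]$ for all $T$, where $\pi$ runs over the partitions of the vertex set of $T$ and $T^\pi$ is $T$ with the vertices in each block identified. Traffics $a,b$ are *identically distributed* if $\tau[T(a)]=\tau[T(b)]$ for all $^*$-test graphs $T$ in one variable. Traffics $(a_n)_{n\ge1}$ are *traffic-free* if, for each $^*$-test graph $T$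 in $(x_n)_{n\ge1}$ with at least one edge, with $T_1,\dots,T_K$ the maximal connected subgraphs with at least one edge whose edges are all labelled by the same index $n$: $\tau^0[T(\mathbf a)]=\prod_k\tau^0[T_k(\mathbf a)]$ if $\bar T$ is a tree, and $\tau^0[T(\mathbf a)]=0$ otherwise. Here $\bar T$ is the bipartite graph on $\{T_1,\dots,T_K\}$ and the vertices of $T$ belonging to at least two of the $T_k$, a vertex being joined to the $T_k$ that contain it. **Theorem.** Let $(a_n)_{n\ge1}$ be self-adjoint, identically distributed, traffic-free elements of a space of traffics with tracial state $\Phi$ and traffic state $\tau$, such that $\Phi(a_n)=0$ and $\Phi(a_n^2)=1$. Let $p=\tau^0[T_1(a_n)]$, where $T_1$ has one vertex and two loops labelled $x$, and let $T_2$ have two vertices and two edges labelled $x$, one in each direction. Then $p$ does not depend on $n$, $p\in[0,1]$, $\tau^0[T_2(a_n)]=1-p$, and $$m_n=\frac{a_1+\dots+a_n}{\sqrt n}$$ converges in $^*$-distribution, as $n\to\infty$, to $m=\sqrt p\,d+\sqrt{1-p}\,s$, where $d$ and $s$ are $^*$-free self-adjoint elements of a $^*$-probability space with state $\Psi$, $d$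 is standard Gaussian, i.e. $\Psi(d^k)=\int_{\mathbb R}t^k\frac{e^{-t^2/2}}{\sqrt{2\pi}}\,dt$, and $s$ is standard semicircular, i.e. $\Psi(s^k)=\int_{-2}^2t^k\frac{\sqrt{4-t^2}}{2\pi}\,dt$, for all $k\ge0$. That is, $\Phi(P(m_n))\to\Psi(P(m))$ for each non commutative $^*$-polynomial $P$ in one variable. Such a space and such $d,s$ exist, and the convergence holds for every choice of them. -/

import Mathlib

open scoped ComplexOrder

noncomputable section

namespace Traffic

universe u

/-! ### Graphs labelled by indeterminates -/

/-- A finite `*`-graph in the variables `(x_j)_{j ∈ J}`: a finite directed multigraph (loops and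
multiple edges allowed) whose edge `e` goes from `src e` to `tgt e` and carries the label
`x_{var e}` if `star e = false` and `x_{var e}^*` if `star e = true`. -/
structure StarGraph (J : Type) where
  V : Type
  E : Type
  finV : Finite V
  finE : Finite E
  src : E → V
  tgt : E → V
  var : E → J
  star : E → Bool

namespace StarGraph

variable {J K : Type}

instance (T : StarGraph J) : Finite T.V := T.finV
instance (T : StarGraph J) : Finite T.E := T.finE

/-- Two vertices are linked if an undirected path joins them. -/
def Linked (T : StarGraph J) : T.V → T.V → Prop :=
  Relation.EqvGen fun v w => ∃ e, T.src e = v ∧ T.tgt e = w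

/-- Connected graphs (in particular nonempty). -/
def Connected (T : StarGraph J) : Prop :=
  Nonempty T.V ∧ ∀ v w, T.Linked v w

/-- Reversal of all edges, exchanging the labels `x_j` and `x_j^*`. -/
def adjoint (T : StarGraph J) : StarGraph J where
  V := T.V
  E := T.E
  finV := T.finV
  finE := T.finE
  src := T.tgt
  tgt := T.src
  var := T.var
  star e := !T.star e

/-- `T^π`: identification of the vertices in a same block of the partition `π`. -/
def quot (T : StarGraph J) (π : Setoid T.V) : StarGraph J where
  V := Quotient π
  E := T.E
  finV := inferInstance
  finE := T.finE
  src e := Quotient.mk π (T.src e)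
  tgt e := Quotient.mk π (T.tgt e)
  var := T.var
  star := T.star

/-- Renaming of the variables. -/
def rename (f : J → K) (T : StarGraph J) : StarGraph K where
  V := T.V
  E := T.E
  finV := T.finV
  finE := T.finE
  src := T.src
  tgt := T.tgt
  var e := f (T.var e)
  star := T.star

/-- Disjoint union. -/
def sum (T T' : StarGraph J) : StarGraph J where
  V := T.V ⊕ T'.V
  E := T.E ⊕ T'.E
  finV := inferInstance
  finE := inferInstance
  src := Sum.map T.src T'.src
  tgt := Sum.map T.tgt T'.tgt
  var := Sum.elim T.var T'.var
  star := Sum.elim T.star T'.star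

/-- Isomorphisms of labelled directed graphs. -/
structure Iso (T T' : StarGraph J) where
  onV : T.V ≃ T'.V
  onE : T.E ≃ T'.E
  src_eq : ∀ e, T'.src (onE e) = onV (T.src e)
  tgt_eq : ∀ e, T'.tgt (onE e) = onV (T.tgt e)
  var_eq : ∀ e, T'.var (onE e) = T.var e
  star_eq : ∀ e, T'.star (onE e) = T.star e

theorem Linked.map {T : StarGraph J} {T' : StarGraph K} (f : T.V → T'.V)
    (h : ∀ e, T'.Linked (f (T.src e)) (f (T.tgt e))) {v w : T.V} (hvw : T.Linked v w) :
    T'.Linked (f v) (f w) := by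
  induction hvw with
  | rel x y hxy =>
    obtain ⟨e, rfl, rfl⟩ := hxy
    exact h e
  | refl x => exact .refl _
  | symm x y _ ih => exact .symm _ _ ih
  | trans x y z _ _ ih₁ ih₂ => exact .trans _ _ _ ih₁ ih₂

theorem linked_edge (T : StarGraph J) (e : T.E) : T.Linked (T.src e) (T.tgt e) :=
  .rel _ _ ⟨e, rfl, rfl⟩

theorem Connected.adjoint {T : StarGraph J} (h : T.Connected) : T.adjoint.Connected :=
  ⟨h.1, fun v w => (h.2 v w).map (T := T) (T' := T.adjoint) id fun e =>
    .symm (T.tgt e) (T.src e) (T.adjoint.linked_edge e)⟩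

theorem Connected.quot {T : StarGraph J} (h : T.Connected) (π : Setoid T.V) :
    (T.quot π).Connected := by
  refine ⟨h.1.map (Quotient.mk π), fun v w => ?_⟩
  induction v using Quotient.inductionOn
  induction w using Quotient.inductionOn
  exact (h.2 _ _).map (T' := T.quot π) (Quotient.mk π) (T.quot π).linked_edge

theorem Connected.rename {T : StarGraph J} (h : T.Connected) (f : J → K) :
    (T.rename f).Connected :=
  ⟨h.1, fun v w => (h.2 v w).map (T' := T.rename f) id (T.rename f).linked_edge⟩

theorem card_quot_lt (T : StarGraph J) {π : Setoid T.V} (h : π ≠ ⊥) :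
    Nat.card (T.quot π).V < Nat.card T.V := by
  have hle : Nat.card (Quotient π) ≤ Nat.card T.V :=
    Nat.card_le_card_of_surjective _ Quotient.mk_surjective
  refine lt_of_le_of_ne hle fun heq => h ?_
  have hinj : Function.Injective (Quotient.mk π) :=
    (Quotient.mk_surjective.bijective_of_nat_card_le heq.ge).1
  ext v w
  exact ⟨fun hvw => hinj (Quotient.sound hvw), fun hvw => hvw ▸ π.refl' v⟩

end StarGraph

/-- A `*`-test graph: a finite connected `*`-graph. -/
structure TestGraph (J : Type) extends StarGraph J where
  connected : toStarGraph.Connected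

/-- A `*`-graph monomial: a finite connected `*`-graph with an input and an output. -/
structure GraphMonomial (J : Type) extends TestGraph J where
  inp : V
  out : V

/-- An `n`-`*`-graph monomial: a `*`-test graph with an `n`-tuple of vertices. -/
structure MultiMonomial (n : ℕ) (J : Type) extends TestGraph J where
  root : Fin n → V

namespace TestGraph

variable {J : Type}

/-- `T^π` for a test graph. -/
def quot (T : TestGraph J) (π : Setoid T.V) : TestGraph J :=
  ⟨T.toStarGraph.quot π, T.connected.quot π⟩

end TestGraph

namespace GraphMonomial

variable {J K : Type}

/-- Isomorphisms preserving labels, input and output. -/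
structure Iso (t t' : GraphMonomial J) extends StarGraph.Iso t.toStarGraph t'.toStarGraph where
  inp_eq : t'.inp = onV t.inp
  out_eq : t'.out = onV t.out

/-- The adjoint `t^*`: edges are reversed, `x_j` and `x_j^*` exchanged, as well as the input
and the output. -/
def adjoint (t : GraphMonomial J) : GraphMonomial J where
  toStarGraph := t.toStarGraph.adjoint
  connected := t.connected.adjoint
  inp := t.out
  out := t.inp

/-- `t^ε` for `ε ∈ {1, *}`. -/
def power (t : GraphMonomial J) : Bool → GraphMonomial J
  | false => t
  | true => t.adjoint

/-- Renaming of the variables. -/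
def rename (f : J → K) (t : GraphMonomial J) : GraphMonomial K where
  toStarGraph := t.toStarGraph.rename f
  connected := t.connected.rename f
  inp := t.inp
  out := t.out

/-- The test graph obtained by identifying the input and the output. -/
def close (t : GraphMonomial J) : TestGraph J :=
  t.toTestGraph.quot (Relation.EqvGen.setoid fun v w => v = t.inp ∧ w = t.out)

/-- The monomial `x_{j_1}^{ε_1} ⋯ x_{j_L}^{ε_L}` seen as a graph: the edges `(i, i+1)`,
`i = 1, …, L`, labelled in order, with the two ends as input and output.
The empty word gives the unit. -/
def path (w : List (J × Bool)) : GraphMonomial J where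
  V := Fin (w.length + 1)
  E := Fin w.length
  finV := inferInstance
  finE := inferInstance
  src := Fin.castSucc
  tgt := Fin.succ
  var i := (w.get i).1
  star i := (w.get i).2
  connected := by
    have key : ∀ v : Fin (w.length + 1), StarGraph.Linked
        (⟨Fin (w.length + 1), Fin w.length, inferInstance, inferInstance, Fin.castSucc, Fin.succ,
          fun i => (w.get i).1, fun i => (w.get i).2⟩ : StarGraph J) 0 v := by
      intro v
      induction v using Fin.induction with
      | zero => exact .refl _
      | succ i ih => exact .trans _ _ _ ih (.rel _ _ ⟨i, rfl, rfl⟩)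
    exact ⟨⟨0⟩, fun v w => .trans _ _ _ (.symm _ _ (key v)) (key w)⟩
  inp := 0
  out := Fin.last _

/-- Vertices and edges before gluing in the substitution of the monomials `s j` for the
indeterminates `x_j` of `t`: the vertices of `t`, and for each edge `e` of `t` labelled `x_j^ε` a
disjoint copy of `(s j)^ε`. -/
def preSubst (t : GraphMonomial J) (s : J → GraphMonomial K) : StarGraph K where
  V := t.V ⊕ Σ e : t.E, ((s (t.var e)).power (t.star e)).V
  E := Σ e : t.E, ((s (t.var e)).power (t.star e)).E
  finV := inferInstance
  finE := inferInstance
  src f := Sum.inr ⟨f.1, ((s (t.var f.1)).power (t.star f.1)).src f.2⟩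
  tgt f := Sum.inr ⟨f.1, ((s (t.var f.1)).power (t.star f.1)).tgt f.2⟩
  var f := ((s (t.var f.1)).power (t.star f.1)).var f.2
  star f := ((s (t.var f.1)).power (t.star f.1)).star f.2

/-- The gluing in the substitution: the input of the copy of `(s j)^ε` attached to the edge `e`
is the source of `e`, and its output is the target of `e`. -/
inductive SubstGlue (t : GraphMonomial J) (s : J → GraphMonomial K) :
    (preSubst t s).V → (preSubst t s).V → Prop
  | source (e : t.E) : SubstGlue t s (Sum.inl (t.src e))
      (Sum.inr ⟨e, ((s (t.var e)).power (t.star e)).inp⟩)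
  | target (e : t.E) : SubstGlue t s (Sum.inl (t.tgt e))
      (Sum.inr ⟨e, ((s (t.var e)).power (t.star e)).out⟩)

theorem connected_subst (t : GraphMonomial J) (s : J → GraphMonomial K) :
    ((preSubst t s).quot (Relation.EqvGen.setoid (SubstGlue t s))).Connected := by
  set G := (preSubst t s).quot (Relation.EqvGen.setoid (SubstGlue t s)) with hG
  let q : (preSubst t s).V → G.V := Quotient.mk _
  have hsrc : ∀ e, q (Sum.inl (t.src e)) =
      q (Sum.inr ⟨e, ((s (t.var e)).power (t.star e)).inp⟩) := fun e =>
    Quotient.sound (.rel _ _ (.source e))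
  have htgt : ∀ e, q (Sum.inl (t.tgt e)) =
      q (Sum.inr ⟨e, ((s (t.var e)).power (t.star e)).out⟩) := fun e =>
    Quotient.sound (.rel _ _ (.target e))
  have hin : ∀ e (v w : ((s (t.var e)).power (t.star e)).V),
      G.Linked (q (Sum.inr ⟨e, v⟩)) (q (Sum.inr ⟨e, w⟩)) := fun e v w =>
    (((s (t.var e)).power (t.star e)).connected.2 v w).map (T' := G)
      (fun x => q (Sum.inr ⟨e, x⟩)) fun f => G.linked_edge ⟨e, f⟩
  have hout : ∀ v w : t.V, G.Linked (q (Sum.inl v)) (q (Sum.inl w)) := fun v w =>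
    (t.connected.2 v w).map (T' := G) (fun x => q (Sum.inl x)) fun e => by
      rw [hsrc, htgt]; exact hin e _ _
  have hall : ∀ x, G.Linked (q (Sum.inl t.inp)) (q x) := by
    rintro (v | ⟨e, v⟩)
    · exact hout _ _
    · exact .trans _ _ _ (hout _ (t.src e)) (by rw [hsrc]; exact hin e _ _)
  refine ⟨⟨q (Sum.inl t.inp)⟩, fun v w => ?_⟩
  induction v using Quotient.inductionOn
  induction w using Quotient.inductionOn
  exact .trans _ _ _ (.symm _ _ (hall _)) (hall _)

/-- Substitution: each edge of `t` labelled `x_j^ε` is replaced by the monomial `(s j)^ε`. -/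
def subst (t : GraphMonomial J) (s : J → GraphMonomial K) : GraphMonomial K where
  toStarGraph := (preSubst t s).quot (Relation.EqvGen.setoid (SubstGlue t s))
  connected := connected_subst t s
  inp := Quotient.mk _ (Sum.inl t.inp)
  out := Quotient.mk _ (Sum.inl t.out)

/-- The partition of the vertices generated by the edges labelled `x_j` or `x_j^*`. -/
def contractSetoid (t : GraphMonomial J) (j : J) : Setoid t.V :=
  Relation.EqvGen.setoid fun v w => ∃ e, t.var e = j ∧ t.src e = v ∧ t.tgt e = w

/-- The graph of `contract`. -/
def contractGraph (t : GraphMonomial J) (j : J) : StarGraph J where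
  V := Quotient (t.contractSetoid j)
  E := {e : t.E // t.var e ≠ j}
  finV := inferInstance
  finE := inferInstance
  src e := Quotient.mk _ (t.src e)
  tgt e := Quotient.mk _ (t.tgt e)
  var e := t.var e
  star e := t.star e

theorem connected_contract (t : GraphMonomial J) (j : J) : (t.contractGraph j).Connected := by
  let q : t.V → (t.contractGraph j).V := Quotient.mk (t.contractSetoid j)
  refine ⟨⟨q t.inp⟩, fun v w => ?_⟩
  induction v using Quotient.inductionOn with | h v => ?_
  induction w using Quotient.inductionOn with | h w => ?_
  refine (t.connected.2 v w).map (T' := t.contractGraph j) q fun e => ?_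
  by_cases he : t.var e = j
  · have : q (t.src e) = q (t.tgt e) := Quotient.sound (.rel _ _ ⟨e, he, rfl, rfl⟩)
    rw [this]
    exact .refl _
  · exact (t.contractGraph j).linked_edge ⟨e, he⟩

/-- Gluing the ends of each edge labelled `x_j` or `x_j^*`, and suppressing these edges. -/
def contract (t : GraphMonomial J) (j : J) : GraphMonomial J where
  toStarGraph := t.contractGraph j
  connected := t.connected_contract j
  inp := Quotient.mk _ t.inp
  out := Quotient.mk _ t.out

end GraphMonomial

namespace MultiMonomial

variable {n : ℕ} {J : Type}

/-- The adjoint of an `n`-`*`-graph monomial (the order of the roots is unchanged). -/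
def adjoint (t : MultiMonomial n J) : MultiMonomial n J where
  toStarGraph := t.toStarGraph.adjoint
  connected := t.connected.adjoint
  root := t.root

/-- The partition identifying the `i`-th roots of `t` and `t'` for each `i`. -/
def mergeSetoid (t t' : MultiMonomial n J) : Setoid (t.toStarGraph.sum t'.toStarGraph).V :=
  Relation.EqvGen.setoid fun v w => ∃ i, v = Sum.inl (t.root i) ∧ w = Sum.inr (t'.root i)

theorem connected_merge (t t' : MultiMonomial (n + 1) J) :
    ((t.toStarGraph.sum t'.toStarGraph).quot (mergeSetoid t t')).Connected := by
  set G := (t.toStarGraph.sum t'.toStarGraph).quot (mergeSetoid t t') with hG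
  let q : (t.toStarGraph.sum t'.toStarGraph).V → G.V := Quotient.mk _
  have h0 : q (Sum.inl (t.root 0)) = q (Sum.inr (t'.root 0)) :=
    Quotient.sound (.rel _ _ ⟨0, rfl, rfl⟩)
  have hall : ∀ x, G.Linked (q (Sum.inl (t.root 0))) (q x) := by
    rintro (v | v)
    · exact (t.connected.2 _ _).map (T' := G) (fun x => q (Sum.inl x))
        fun e => G.linked_edge (Sum.inl e)
    · rw [h0]
      exact (t'.connected.2 _ _).map (T' := G) (fun x => q (Sum.inr x))
        fun e => G.linked_edge (Sum.inr e)
  refine ⟨⟨q (Sum.inl (t.root 0))⟩, fun v w => ?_⟩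
  induction v using Quotient.inductionOn
  induction w using Quotient.inductionOn
  exact .trans _ _ _ (.symm _ _ (hall _)) (hall _)

/-- `T(t, t')`: the test graph obtained by merging the `i`-th roots of `t` and `t'` for each `i`
(there is at least one root, so that the result is connected). -/
def merge (t t' : MultiMonomial (n + 1) J) : TestGraph J :=
  ⟨(t.toStarGraph.sum t'.toStarGraph).quot (mergeSetoid t t'), connected_merge t t'⟩

end MultiMonomial

/-! ### Non commutative random variables -/

section StarProbability

variable (A : Type u) [Ring A] [StarRing A] [Algebra ℂ A] [StarModule ℂ A]

/-- A tracial state on a unital `*`-algebra, which makes it a `*`-probability space. -/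
structure TracialState where
  Φ : A →ₗ[ℂ] ℂ
  map_one : Φ 1 = 1
  tracial : ∀ a b, Φ (a * b) = Φ (b * a)
  nonneg : ∀ a, 0 ≤ Φ (star a * a)

variable {A}

/-- `a^ε` for `ε ∈ {1, *}`. -/
def starPow (a : A) : Bool → A
  | false => a
  | true => star a

/-- Non commutative `*`-polynomials in the variables `(x_j)_{j ∈ J}`; the generator `(j, false)`
is `x_j` and the generator `(j, true)` is `x_j^*`. -/
abbrev StarPoly (J : Type) : Type := FreeAlgebra ℂ (J × Bool)

/-- Evaluation of `*`-polynomials. -/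
def StarPoly.eval {J : Type} (a : J → A) : StarPoly J →ₐ[ℂ] A :=
  FreeAlgebra.lift ℂ fun x : J × Bool => starPow (a x.1) x.2

namespace TracialState

variable (S : TracialState A)

/-- The `*`-distribution of a family of variables. -/
def starDistribution {J : Type} (a : J → A) : StarPoly J →ₗ[ℂ] ℂ :=
  S.Φ ∘ₗ (StarPoly.eval a).toLinearMap

/-- `*`-freeness of the families `b i = (b i k)_{k ∈ K}`, `i ∈ I`. -/
def StarFree {I K : Type} (b : I → K → A) : Prop :=
  ∀ (n : ℕ) (i : Fin (n + 1) → I) (P : Fin (n + 1) → StarPoly K),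
    (∀ k : Fin n, i k.castSucc ≠ i k.succ) →
    (∀ k, S.Φ (StarPoly.eval (b (i k)) (P k)) = 0) →
    S.Φ (List.ofFn fun k => StarPoly.eval (b (i k)) (P k)).prod = 0

/-- A standard Gaussian variable. -/
def IsStandardGaussian (d : A) : Prop :=
  IsSelfAdjoint d ∧
    ∀ k : ℕ, S.Φ (d ^ k) = ((∫ t, t ^ k ∂(ProbabilityTheory.gaussianReal 0 1) : ℝ) : ℂ)

/-- A standard semicircular variable. -/
def IsSemicircular (s : A) : Prop :=
  IsSelfAdjoint s ∧
    ∀ k : ℕ, S.Φ (s ^ k) =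
      ((∫ t in (-2 : ℝ)..2, t ^ k * (1 / (2 * Real.pi) * Real.sqrt (4 - t ^ 2)) : ℝ) : ℂ)

end TracialState

/-- Convergence in `*`-distribution of the variables `m n` to the variable `m'`, which may live
in another `*`-probability space. -/
def ConvergesInStarDistribution {B : Type*} [Ring B] [StarRing B] [Algebra ℂ B] [StarModule ℂ B]
    (S : TracialState A) (m : ℕ → A) (S' : TracialState B) (m' : B) : Prop :=
  ∀ P : StarPoly Unit, Filter.Tendsto (fun n => S.starDistribution (fun _ => m n) P)
    Filter.atTop (nhds (S'.starDistribution (fun _ => m') P))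

end StarProbability

/-! ### Spaces of traffics -/

/-- A space of traffics: a `*`-probability space that is an algebra over the operad of `*`-graph
polynomials, with a non-negative traffic state inducing the tracial state. The evaluation of
`*`-graph polynomials is given on monomials, and extends by linearity. -/
structure TrafficSpace (A : Type u) [Ring A] [StarRing A] [Algebra ℂ A] [StarModule ℂ A]
    extends TracialState A where
  /-- The substitution `(t, a) ↦ t(a)`. -/
  ev : ∀ {J : Type}, GraphMonomial J → (J → A) → A
  /-- The traffic state `(T, a) ↦ τ[T(a)]`. -/
  τ : ∀ {J : Type}, TestGraph J → (J → A) → ℂ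
  /-- Graph monomials are considered up to isomorphism. -/
  ev_iso : ∀ {J : Type} (t t' : GraphMonomial J), t.Iso t' → ∀ a : J → A, ev t a = ev t' a
  /-- Test graphs are considered up to isomorphism. -/
  τ_iso : ∀ {J : Type} (T T' : TestGraph J), T.toStarGraph.Iso T'.toStarGraph →
    ∀ a : J → A, τ T a = τ T' a
  /-- Associativity. -/
  ev_subst : ∀ {J K : Type} (t : GraphMonomial J) (s : J → GraphMonomial K) (a : K → A),
    ev (t.subst s) a = ev t fun j => ev (s j) a
  /-- Linearity with respect to a variable that labels a single edge. -/
  ev_linear : ∀ {J : Type} [DecidableEq J] (t : GraphMonomial J) (e : t.E), t.star e = false →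
    (∀ e', t.var e' = t.var e → e' = e) → ∀ (a : J → A) (c : ℂ) (x y : A),
      ev t (Function.update a (t.var e) (c • x + y)) =
        c • ev t (Function.update a (t.var e) x) + ev t (Function.update a (t.var e) y)
  /-- Compatibility with the `*`-algebra structure. -/
  ev_path : ∀ {J : Type} (w : List (J × Bool)) (a : J → A),
    ev (GraphMonomial.path w) a = (w.map fun x => starPow (a x.1) x.2).prod
  /-- Role of the unit. -/
  ev_unit : ∀ {J : Type} [DecidableEq J] (t : GraphMonomial J) (j : J) (a : J → A),
    ev t (Function.update a j 1) = ev (t.contract j) a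
  /-- Involutivity. -/
  ev_adjoint : ∀ {J : Type} (t : GraphMonomial J) (a : J → A),
    ev t.adjoint a = star (ev t a)
  /-- Equivariance. -/
  ev_rename : ∀ {J K : Type} (f : J → K) (t : GraphMonomial J) (a : K → A),
    ev (t.rename f) a = ev t (a ∘ f)
  /-- The tracial state is given by the traffic state. -/
  state_ev : ∀ {J : Type} (t : GraphMonomial J) (a : J → A), Φ (ev t a) = τ t.close a
  /-- Non-negativity: `τ[T(t^*, t)(a)] ≥ 0` for the polynomial `t = ∑ i, c i • t i`. -/
  τ_nonneg : ∀ {J : Type} (n m : ℕ) (c : Fin m → ℂ) (t : Fin m → MultiMonomial (n + 1) J)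
    (a : J → A),
      0 ≤ ∑ i, ∑ k, (starRingEnd ℂ) (c i) * c k * τ ((t i).adjoint.merge (t k)) a

/-! ### The injective version of a functional on test graphs -/

/-- The injective version `τ⁰` of a functional `τ` on test graphs, which is the solution of
`τ[T] = ∑_{π ∈ P(V)} τ⁰[T^π]` (see `sum_injective`), computed recursively on the number of
vertices. The discrete partition `⊥` is the one for which `T^π` is `T`. -/
def injective {J : Type} (τ : TestGraph J → ℂ) (T : TestGraph J) : ℂ :=
  τ T - ∑ᶠ π : {π : Setoid T.V // π ≠ ⊥}, injective τ (T.quot π.1)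
termination_by Nat.card T.V
decreasing_by exact T.card_quot_lt π.2

theorem injective_iso {J : Type} (τ : TestGraph J → ℂ)
    (hτ : ∀ T T' : TestGraph J, T.toStarGraph.Iso T'.toStarGraph → τ T = τ T')
    (T T' : TestGraph J) (f : T.toStarGraph.Iso T'.toStarGraph) :
    injective τ T = injective τ T' := by
  induction hn : Nat.card T.V using Nat.strong_induction_on generalizing T T' with
  | _ n ih =>
    subst hn
    rw [injective, injective, hτ T T' f]
    congr 1
    let g : Setoid T'.V → Setoid T.V := fun π => π.comap f.onV
    have hg : ∀ π, g π = ⊥ ↔ π = ⊥ := by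
      intro π
      constructor
      · intro h
        ext x y
        have := congrArg (fun r : Setoid T.V => r (f.onV.symm x) (f.onV.symm y)) h
        simpa [g, Setoid.comap_rel, Setoid.bot_def] using this
      · rintro rfl
        ext x y
        simp [g]
    let G : {π : Setoid T'.V // π ≠ ⊥} ≃ {π : Setoid T.V // π ≠ ⊥} :=
      { toFun := fun π => ⟨g π.1, fun h => π.2 ((hg _).1 h)⟩
        invFun := fun π => ⟨π.1.comap f.onV.symm, fun h => π.2 (by
          have : g (π.1.comap f.onV.symm) = π.1 := by
            ext x y; simp [g, Setoid.comap_rel]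
          rw [← this, hg, h])⟩
        left_inv := fun π => Subtype.ext (by ext x y; simp [g, Setoid.comap_rel])
        right_inv := fun π => Subtype.ext (by ext x y; simp [g, Setoid.comap_rel]) }
    rw [← finsum_comp_equiv G]
    refine finsum_congr fun π => ?_
    refine ih _ (T.card_quot_lt (G π).2) _ _ ?_ rfl
    exact
      { onV := Quotient.congr f.onV fun x y => by
          show g π.1 x y ↔ π.1 _ _
          simp [g, Setoid.comap_rel]
        onE := f.onE
        src_eq := fun e => congrArg (Quotient.mk π.1) (f.src_eq e)
        tgt_eq := fun e => congrArg (Quotient.mk π.1) (f.tgt_eq e)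
        var_eq := f.var_eq
        star_eq := f.star_eq }

/-- The defining property of the injective version. -/
theorem sum_injective {J : Type} (τ : TestGraph J → ℂ)
    (hτ : ∀ T T' : TestGraph J, T.toStarGraph.Iso T'.toStarGraph → τ T = τ T')
    (T : TestGraph J) :
    τ T = ∑ᶠ π : Setoid T.V, injective τ (T.quot π) := by
  classical
  have : Finite (Setoid T.V) :=
    Finite.of_injective (fun π : Setoid T.V => fun x y => π x y)
      fun π π' h => Setoid.ext fun x y => iff_of_eq (congrFun (congrFun h x) y)
  have : Fintype (Setoid T.V) := Fintype.ofFinite _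
  have h0 : injective τ T = injective τ (T.quot ⊥) :=
    injective_iso τ hτ _ _
      { onV := Equiv.ofBijective (Quotient.mk ⊥)
          ⟨fun x y h => Quotient.exact h, Quotient.mk_surjective⟩
        onE := Equiv.refl _
        src_eq := fun _ => rfl
        tgt_eq := fun _ => rfl
        var_eq := fun _ => rfl
        star_eq := fun _ => rfl }
  rw [finsum_eq_sum_of_fintype, Fintype.sum_eq_add_sum_subtype_ne _ ⊥, ← h0, injective,
    finsum_eq_sum_of_fintype, sub_add_cancel]

/-! ### Traffic-freeness -/

namespace TestGraph

variable {J I : Type} (T : TestGraph J) (c : J → I)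

/-- The equivalence relation on edges generated by: to be labelled by variables of a same
family, and to have a common end. The variable `x_j` belongs to the family of index `c j`. -/
def colourSetoid : Setoid T.E :=
  Relation.EqvGen.setoid fun e e' => c (T.var e) = c (T.var e') ∧
    (T.src e = T.src e' ∨ T.src e = T.tgt e' ∨ T.tgt e = T.src e' ∨ T.tgt e = T.tgt e')

/-- The connected components of `T` that are labelled by variables in a same family, each given
by its class of edges. -/
def Component : Type := Quotient (T.colourSetoid c)

variable {T c}

/-- `v` is a vertex of the component `q`. -/
def Component.HasVertex (q : T.Component c) (v : T.V) : Prop :=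
  ∃ e, (Quotient.mk _ e : T.Component c) = q ∧ (T.src e = v ∨ T.tgt e = v)

/-- The graph of a component. -/
def Component.graph (q : T.Component c) : StarGraph J where
  V := {v : T.V // q.HasVertex v}
  E := {e : T.E // (Quotient.mk _ e : T.Component c) = q}
  finV := inferInstance
  finE := inferInstance
  src e := ⟨T.src e, e.1, e.2, Or.inl rfl⟩
  tgt e := ⟨T.tgt e, e.1, e.2, Or.inr rfl⟩
  var e := T.var e
  star e := T.star e

theorem Component.connected_graph (q : T.Component c) : q.graph.Connected := by
  have hst : ∀ e : q.graph.E, q.graph.Linked (q.graph.src e) (q.graph.tgt e) :=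
    q.graph.linked_edge
  have key : ∀ e e' : T.E, Relation.EqvGen (fun e e' : T.E => c (T.var e) = c (T.var e') ∧
      (T.src e = T.src e' ∨ T.src e = T.tgt e' ∨ T.tgt e = T.src e' ∨ T.tgt e = T.tgt e')) e e' →
      ∀ (h : (Quotient.mk _ e : T.Component c) = q) (h' : (Quotient.mk _ e' : T.Component c) = q),
        q.graph.Linked (q.graph.src ⟨e, h⟩) (q.graph.src ⟨e', h'⟩) := by
    intro e e' hee
    induction hee with
    | rel x y hxy =>
      intro h h'
      obtain ⟨-, h1 | h1 | h1 | h1⟩ := hxy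
      · have : q.graph.src ⟨x, h⟩ = q.graph.src ⟨y, h'⟩ := Subtype.ext h1
        rw [this]; exact .refl _
      · have : q.graph.src ⟨x, h⟩ = q.graph.tgt ⟨y, h'⟩ := Subtype.ext h1
        rw [this]; exact .symm _ _ (hst _)
      · have : q.graph.tgt ⟨x, h⟩ = q.graph.src ⟨y, h'⟩ := Subtype.ext h1
        rw [← this]; exact hst _
      · have : q.graph.tgt ⟨x, h⟩ = q.graph.tgt ⟨y, h'⟩ := Subtype.ext h1
        refine .trans _ _ _ (hst _) ?_
        rw [this]; exact .symm _ _ (hst _)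
    | refl x => intro h h'; exact .refl _
    | symm x y _ ih => intro h h'; exact .symm _ _ (ih h' h)
    | trans x y z hxy _ ih₁ ih₂ =>
      intro h h'
      have hy : (Quotient.mk _ y : T.Component c) = q := by
        rw [← h]; exact Quotient.sound (.symm _ _ hxy)
      exact .trans _ _ _ (ih₁ h hy) (ih₂ hy h')
  have hvert : ∀ v : q.graph.V, ∃ e : q.graph.E, q.graph.Linked (q.graph.src e) v := by
    rintro ⟨v, e, he, rfl | rfl⟩
    · exact ⟨⟨e, he⟩, .refl _⟩
    · exact ⟨⟨e, he⟩, hst ⟨e, he⟩⟩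
  constructor
  · induction q using Quotient.inductionOn with
    | h e => exact ⟨⟨T.src e, e, rfl, Or.inl rfl⟩⟩
  · intro v w
    obtain ⟨e, he⟩ := hvert v
    obtain ⟨e', he'⟩ := hvert w
    exact .trans _ _ _ (.symm _ _ he) (.trans _ _ _
      (key e.1 e'.1 (Quotient.exact (e.2.trans e'.2.symm)) e.2 e'.2) he')

/-- A component as a test graph. -/
def Component.toTestGraph (q : T.Component c) : TestGraph J := ⟨q.graph, q.connected_graph⟩

variable (T c)

/-- The vertices of `T` that are common to several components. -/
def CommonVertex : Type :=
  {v : T.V // ∃ q q' : T.Component c, q ≠ q' ∧ q.HasVertex v ∧ q'.HasVertex v}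

/-- The undirected graph `T̄` of components and common vertices, where a common vertex is linked
to the components which contain it. -/
def barGraph : SimpleGraph (T.Component c ⊕ T.CommonVertex c) where
  Adj
    | Sum.inl q, Sum.inr v => q.HasVertex v.1
    | Sum.inr v, Sum.inl q => q.HasVertex v.1
    | _, _ => False
  symm := ⟨by rintro (q | v) (q' | v') h <;> exact h⟩
  loopless := ⟨by rintro (q | v) h <;> exact h⟩

/-- `T` is a free product in the families of variables given by `c`. -/
def IsFreeProduct : Prop := (T.barGraph c).IsTree

/-- The one-vertex graph with two loops labelled `x`. -/
def doubleLoop : TestGraph Unit where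
  V := Unit
  E := Bool
  finV := inferInstance
  finE := inferInstance
  src _ := ()
  tgt _ := ()
  var _ := ()
  star _ := false
  connected := ⟨⟨()⟩, fun _ _ => .refl _⟩

/-- The graph with two vertices and two edges labelled `x`, one in each direction. -/
def doubleArrow : TestGraph Unit where
  V := Bool
  E := Bool
  finV := inferInstance
  finE := inferInstance
  src e := e
  tgt e := !e
  var _ := ()
  star _ := false
  connected := by
    refine ⟨⟨true⟩, ?_⟩
    rintro (_ | _) (_ | _)
    · exact .refl _
    · exact .rel _ _ ⟨false, rfl, rfl⟩
    · exact .rel _ _ ⟨true, rfl, rfl⟩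
    · exact .refl _

end TestGraph

namespace TrafficSpace

variable {A : Type u} [Ring A] [StarRing A] [Algebra ℂ A] [StarModule ℂ A] (S : TrafficSpace A)

/-- The injective version `τ⁰[T(a)]` of the traffic state. -/
def τ₀ {J : Type} (T : TestGraph J) (a : J → A) : ℂ := injective (fun T' => S.τ T' a) T

/-- Equality in law (same distribution of traffics). -/
def EqualInLaw {J : Type} (a b : J → A) : Prop := ∀ T : TestGraph J, S.τ T a = S.τ T b

/-- Traffic-freeness of the families `a_i = (a j)_{c j = i}`, `i ∈ I`. The graph reduced to one
vertex has no component: on it `τ⁰` is `1`, the empty product, and it is left aside. -/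
def TrafficFree {J I : Type} (c : J → I) (a : J → A) : Prop :=
  ∀ T : TestGraph J, Nonempty T.E →
    (T.IsFreeProduct c → S.τ₀ T a = ∏ᶠ q : T.Component c, S.τ₀ q.toTestGraph a) ∧
    (¬ T.IsFreeProduct c → S.τ₀ T a = 0)

end TrafficSpace

end Traffic

end

open Traffic

/-! Write Δ(a) for the evaluation at `a` of a single loop (`diag`), and Δ_n for the normalized sum
of the Δ(a_i). The moments Φ(m_n^k) alone do not satisfy a closed recursion, but the mixed moments
Φ(m_n^k Δ_n^j) do asymptotically, and √p d plays the role of Δ_n in the limit: the pair (√p d +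
√(1-p) s, √p d) satisfies the same recursion exactly.

The recursion. A word in the letters a_i and Δ(a_i) is a directed path with some edges closed into
loops. Its state is the sum of τ⁰ over the quotients of the path that join the two ends and turn the
diagonal letters into loops (`Φ_word`). Replacing the first letter by its diagonal part keeps the
quotients in which the first edge is a loop, so the difference of the two states is the sum over the
other quotients. If the colour of the first letter occurs exactly once more, on a letter that is not
diagonal, the surviving quotients are two closed walks bridged by a double arrow, and the difference
is (1-p) times the states of the two words that remain (`Φ_word_sub_eq_mul`). If the second
occurrence is diagonal, the difference is zero. A colour that occurs only once gives zero. A word of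
diagonal letters lives on one vertex, where a pair of loops of the same colour factors out with
weight p. The remaining colourings use too few colours to matter at the scale n^(-1/2) per letter
(`tendsto_colourSum_of_crowded`). The limits M therefore satisfy M(k+1,j) = M(k,j+1) + (1-p) ∑_{m<k}
M(m,0) M(k-m-1,j) and M(0,j+2) = (j+1) p M(0,j), with M(0,0) = 1 and M(0,1) = 0; this determines
them (`tendsto_moment`).

How freeness enters. The graph T̄ is always connected, so it is a tree exactly when equality holds
in #components + #vertices ≤ #incidences + 1. Components and incidences add up when T is covered by
edge-disjoint unions of components, so comparing numbers of vertices suffices to prove that τ⁰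
vanishes (`τ₀_eq_zero_of_cover`) or factorizes (`τ₀_eq_prod_of_cover`).

The limit. On an algebraic Fock space, a Gaussian operator acts on the leftmost tensor and a
semicircular operator adds or removes a tensor on the left. They are free in the vacuum state
(`Fock.isFree`), which is tracial on the algebra they generate, and a Schwinger-Dyson equation
yields the recursion (`Fock.mixedMoment_succ`). Joint moments of free elements depend only on the
individual moments (`IsFree.map_lift_eq`), so every other free pair gives the same limit. Finally p
and 1-p are nonnegative as the values of Φ on the squares of the self-adjoint elements Δ(a) and a -
Δ(a). -/

noncomputable section

namespace Traffic

namespace TestGraph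

/-! ### Trees of components as the equality case of an Euler characteristic inequality -/

section Rank

variable {J I : Type} (T : TestGraph J) (c : J → I)

instance : Finite (T.Component c) := inferInstanceAs (Finite (Quotient _))

instance : Finite (T.CommonVertex c) := inferInstanceAs (Finite {_v : T.V // _})

/-- Incidences between components and vertices. -/
def Incidence : Type := {x : T.Component c × T.V // x.1.HasVertex x.2}

instance : Finite (T.Incidence c) := inferInstanceAs (Finite {_x : T.Component c × T.V // _})

variable {T c}

/-- The component of an edge. -/
def componentOf (c : J → I) (e : T.E) : T.Component c := Quotient.mk _ e

theorem hasVertex_src (e : T.E) : (componentOf c e).HasVertex (T.src e) :=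
  ⟨e, rfl, Or.inl rfl⟩

theorem hasVertex_tgt (e : T.E) : (componentOf c e).HasVertex (T.tgt e) :=
  ⟨e, rfl, Or.inr rfl⟩

/-- The property of carrying an edge is constant along links, so connectedness spreads it from one
edge to all vertices. -/
theorem exists_edge_at [hE : Nonempty T.E] (v : T.V) : ∃ e, T.src e = v ∨ T.tgt e = v := by
  obtain ⟨e₀⟩ := hE
  have key : ∀ v w, T.Linked v w →
      ((∃ e, T.src e = v ∨ T.tgt e = v) ↔ ∃ e, T.src e = w ∨ T.tgt e = w) := by
    intro v w h
    induction h with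
    | rel x y h =>
      obtain ⟨e, rfl, rfl⟩ := h
      exact ⟨fun _ => ⟨e, Or.inr rfl⟩, fun _ => ⟨e, Or.inl rfl⟩⟩
    | refl => exact Iff.rfl
    | symm _ _ _ ih => exact ih.symm
    | trans _ _ _ _ _ ih ih' => exact ih.trans ih'
  exact (key (T.src e₀) v (T.connected.2 _ _)).1 ⟨e₀, Or.inl rfl⟩

theorem exists_component_at [Nonempty T.E] (c : J → I) (v : T.V) :
    ∃ q : T.Component c, q.HasVertex v := by
  obtain ⟨e, h⟩ := exists_edge_at v
  exact ⟨componentOf c e, e, rfl, h⟩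

theorem reachable_of_hasVertex {q q' : T.Component c} {v : T.V} (h : q.HasVertex v)
    (h' : q'.HasVertex v) : (T.barGraph c).Reachable (Sum.inl q) (Sum.inl q') := by
  by_cases hq : q = q'
  · rw [hq]
  · have a₁ : (T.barGraph c).Adj (Sum.inl q) (Sum.inr ⟨v, q, q', hq, h, h'⟩) := h
    have a₂ : (T.barGraph c).Adj (Sum.inr ⟨v, q, q', hq, h, h'⟩) (Sum.inl q') := h'
    exact a₁.reachable.trans a₂.reachable

/-- Components sharing a vertex are equal or joined through it, so an undirected path in `T` lifts
to a path in the bar graph. Being a tree thus becomes a matter of counting. -/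
theorem connected_barGraph [hE : Nonempty T.E] (c : J → I) : (T.barGraph c).Connected := by
  have key : ∀ v w, T.Linked v w → ∀ q q' : T.Component c, q.HasVertex v → q'.HasVertex w →
      (T.barGraph c).Reachable (Sum.inl q) (Sum.inl q') := by
    intro v w h
    induction h with
    | rel x y h =>
      obtain ⟨e, rfl, rfl⟩ := h
      intro q q' hq hq'
      exact (reachable_of_hasVertex hq (hasVertex_src e)).trans
        (reachable_of_hasVertex (hasVertex_tgt e) hq')
    | refl => intro q q' hq hq'; exact reachable_of_hasVertex hq hq'
    | symm _ _ _ ih => intro q q' hq hq'; exact (ih q' q hq' hq).symm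
    | trans x y z _ _ ih ih' =>
      intro q q' hq hq'
      obtain ⟨q'', h''⟩ := exists_component_at c y
      exact (ih q q'' hq h'').trans (ih' q'' q' h'' hq')
  have hqq : ∀ q q' : T.Component c, (T.barGraph c).Reachable (Sum.inl q) (Sum.inl q') := by
    intro q q'
    induction q using Quotient.inductionOn with | h e => ?_
    induction q' using Quotient.inductionOn with | h e' => ?_
    exact key _ _ (T.connected.2 _ _) _ _ (hasVertex_src e) (hasVertex_src e')
  obtain ⟨e₀⟩ := hE
  refine SimpleGraph.connected_iff_exists_forall_reachable _ |>.2
    ⟨Sum.inl (componentOf c e₀), ?_⟩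
  rintro (q | ⟨v, q, q', hne, h, h'⟩)
  · exact hqq _ _
  · have a : (T.barGraph c).Adj (Sum.inl q) (Sum.inr ⟨v, q, q', hne, h, h'⟩) := h
    exact (hqq _ q).trans a.reachable

variable (T c)

/-- Edges of `T̄` as incidences with common vertices. -/
def barGraphEdgeEquiv :
    {x : T.Component c × T.CommonVertex c // x.1.HasVertex x.2.1} ≃ (T.barGraph c).edgeSet :=
  Equiv.ofBijective (fun x => ⟨s(Sum.inl x.1.1, Sum.inr x.1.2), x.2⟩) (by
    constructor
    · rintro ⟨⟨q, v⟩, h⟩ ⟨⟨q', v'⟩, h'⟩ heq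
      have := congrArg Subtype.val heq
      simp only [Sym2.eq_iff, Sum.inl.injEq, Sum.inr.injEq, reduceCtorEq, and_self, or_false]
        at this
      obtain ⟨rfl, rfl⟩ := this
      rfl
    · rintro ⟨x, hx⟩
      induction x using Sym2.ind with | _ x y => ?_
      rcases x with q | v <;> rcases y with q' | v'
      · exact absurd hx id
      · exact ⟨⟨(q, v'), hx⟩, rfl⟩
      · refine ⟨⟨(q', v), hx⟩, Subtype.ext ?_⟩
        exact Sym2.eq_swap
      · exact absurd hx id)

-- A vertex that is not common lies in exactly one component and gives one incidence; the incidences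
-- at common vertices are the edges of the bar graph.
open Classical in
theorem card_incidence [Nonempty T.E] :
    Nat.card (T.Incidence c) = Nat.card (T.barGraph c).edgeSet +
      Nat.card {v : T.V // ¬ ∃ q q' : T.Component c, q ≠ q' ∧ q.HasVertex v ∧ q'.HasVertex v} := by
  rw [← Nat.card_congr (T.barGraphEdgeEquiv c), ← Nat.card_sum]
  refine (Nat.card_congr (Equiv.ofBijective (Sum.elim
    (fun x => (⟨(x.1.1, x.1.2.1), x.2⟩ : T.Incidence c))
    (fun v => ⟨((exists_component_at c v.1).choose, v.1), (exists_component_at c v.1).choose_spec⟩))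
      ⟨?_, ?_⟩)).symm
  · rintro (⟨⟨q, v⟩, h⟩ | ⟨v, h⟩) (⟨⟨q', v'⟩, h'⟩ | ⟨v', h'⟩) heq
    · have h₁ := congrArg (fun x => x.1.1) heq
      have h₂ := congrArg (fun x => x.1.2) heq
      simp only [Sum.elim_inl] at h₁ h₂
      have h₃ : v = v' := Subtype.ext h₂
      subst h₁ h₃
      rfl
    · have h₂ := congrArg (fun x => x.1.2) heq
      simp only [Sum.elim_inl, Sum.elim_inr] at h₂
      exact absurd (h₂ ▸ v.2) h'
    · have h₂ := congrArg (fun x => x.1.2) heq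
      simp only [Sum.elim_inl, Sum.elim_inr] at h₂
      exact absurd (h₂ ▸ v'.2) h
    · have h₂ := congrArg (fun x => x.1.2) heq
      simp only [Sum.elim_inr] at h₂
      subst h₂
      rfl
  · rintro ⟨⟨q, v⟩, h⟩
    by_cases hv : ∃ q q' : T.Component c, q ≠ q' ∧ q.HasVertex v ∧ q'.HasVertex v
    · exact ⟨Sum.inl ⟨(q, ⟨v, hv⟩), h⟩, rfl⟩
    · refine ⟨Sum.inr ⟨v, hv⟩, Subtype.ext (Prod.ext ?_ rfl)⟩
      by_contra hne
      exact hv ⟨_, _, hne, (exists_component_at c v).choose_spec, h⟩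

open Classical in
theorem card_vertex : Nat.card T.V = Nat.card (T.CommonVertex c) +
      Nat.card {v : T.V // ¬ ∃ q q' : T.Component c, q ≠ q' ∧ q.HasVertex v ∧ q'.HasVertex v} := by
  rw [← Nat.card_congr (Equiv.sumCompl fun v : T.V =>
    ∃ q q' : T.Component c, q ≠ q' ∧ q.HasVertex v ∧ q'.HasVertex v), Nat.card_sum]
  rfl

theorem isEmpty_component [hE : IsEmpty T.E] : IsEmpty (T.Component c) :=
  ⟨fun q => by induction q using Quotient.inductionOn with | h e => exact hE.false e⟩

theorem subsingleton_vertex [hE : IsEmpty T.E] : Subsingleton T.V := by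
  refine ⟨fun v w => ?_⟩
  induction T.connected.2 v w with
  | rel x y h => exact (hE.false h.choose).elim
  | refl => rfl
  | symm _ _ _ ih => exact ih.symm
  | trans _ _ _ _ _ ih ih' => exact ih.trans ih'

/-- The vertices that are not common count once on each side, and what remains is the bound on the
number of vertices of a connected graph. The edgeless graph is included because pieces of a cover
may be edgeless. -/
theorem card_le_card_incidence :
    Nat.card (T.Component c) + Nat.card T.V ≤ Nat.card (T.Incidence c) + 1 := by
  by_cases hE : Nonempty T.E
  · have h := (connected_barGraph (T := T) c).card_vert_le_card_edgeSet_add_one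
    rw [Nat.card_sum] at h
    rw [T.card_incidence c, T.card_vertex c]
    omega
  · have hE' : IsEmpty T.E := not_nonempty_iff.1 hE
    have : IsEmpty (T.Component c) := T.isEmpty_component c
    have hV := Finite.card_le_one_iff_subsingleton.2 T.subsingleton_vertex
    rw [Nat.card_of_isEmpty (α := T.Component c)]
    omega

theorem isFreeProduct_iff_card [Nonempty T.E] : T.IsFreeProduct c ↔
    Nat.card (T.Incidence c) + 1 = Nat.card (T.Component c) + Nat.card T.V := by
  rw [IsFreeProduct, SimpleGraph.isTree_iff_connected_and_card, T.card_incidence c,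
    T.card_vertex c, Nat.card_sum]
  constructor
  · rintro ⟨-, h⟩; omega
  · intro h; exact ⟨connected_barGraph c, by omega⟩

end Rank

end TestGraph

end Traffic

end

/-! ### Invariance of the traffic state, and covers by unions of components -/

noncomputable section

namespace Traffic

namespace TestGraph

/-- Renaming of the variables of a test graph. -/
def rename {J K : Type} (f : J → K) (T : TestGraph J) : TestGraph K :=
  ⟨T.toStarGraph.rename f, T.connected.rename f⟩

/-- A test graph as a graph monomial with equal input and output. -/
def rooted {J : Type} (T : TestGraph J) (v : T.V) : GraphMonomial J where
  toTestGraph := T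
  inp := v
  out := v

/-- Identifying a vertex with itself does nothing. -/
def rootedCloseIso {J : Type} (T : TestGraph J) (v : T.V) :
    T.toStarGraph.Iso (T.rooted v).close.toStarGraph where
  onV := Equiv.ofBijective (Quotient.mk _) ⟨fun x y h => by
      have h' : Relation.EqvGen (fun x y : T.V => x = v ∧ y = v) x y := Quotient.exact h
      clear h
      induction h' with
      | rel _ _ h => exact h.1.trans h.2.symm
      | refl => rfl
      | symm _ _ _ ih => exact ih.symm
      | trans _ _ _ _ _ ih ih' => exact ih.trans ih',
    Quotient.mk_surjective⟩
  onE := Equiv.refl _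
  src_eq _ := rfl
  tgt_eq _ := rfl
  var_eq _ := rfl
  star_eq _ := rfl

/-- The graph reduced to a vertex. -/
def point (J : Type) : TestGraph J := (GraphMonomial.path (J := J) []).toTestGraph

/-- One loop. -/
def loop : TestGraph Unit where
  V := Unit
  E := Unit
  finV := inferInstance
  finE := inferInstance
  src _ := ()
  tgt _ := ()
  var _ := ()
  star _ := false
  connected := ⟨⟨()⟩, fun _ _ => .refl _⟩

end TestGraph

open TestGraph

namespace TrafficSpace

variable {A : Type*} [Ring A] [StarRing A] [Algebra ℂ A] [StarModule ℂ A] (S : TrafficSpace A)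

/-- The axioms on renaming and on paths are stated for `ev`; rooting a test graph at both ends of
the same vertex transfers them to `τ`. -/
theorem τ_eq_Φ_rooted {J : Type} (T : TestGraph J) (v : T.V) (a : J → A) :
    S.τ T a = S.Φ (S.ev (T.rooted v) a) := by
  rw [S.state_ev, S.τ_iso _ _ (T.rootedCloseIso v)]

theorem τ_rename {J K : Type} (f : J → K) (T : TestGraph J) (a : K → A) :
    S.τ (T.rename f) a = S.τ T (a ∘ f) := by
  obtain ⟨v⟩ := T.connected.1
  rw [S.τ_eq_Φ_rooted T v, S.τ_eq_Φ_rooted (T.rename f) v, ← S.ev_rename]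
  rfl

theorem τ₀_rename {J K : Type} (f : J → K) (T : TestGraph J) (a : K → A) :
    S.τ₀ (T.rename f) a = S.τ₀ T (a ∘ f) := by
  unfold τ₀
  induction hn : Nat.card T.V using Nat.strong_induction_on generalizing T with
  | _ n ih =>
    subst hn
    rw [injective, injective, S.τ_rename]
    congr 1
    exact finsum_congr fun π => ih _ (T.card_quot_lt π.2) (T.quot π.1) rfl

theorem τ₀_iso {J : Type} (T T' : TestGraph J) (f : T.toStarGraph.Iso T'.toStarGraph)
    (a : J → A) : S.τ₀ T a = S.τ₀ T' a :=
  injective_iso _ (fun T T' h => S.τ_iso T T' h a) T T' f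

theorem τ_eq_sum {J : Type} (T : TestGraph J) (a : J → A) :
    S.τ T a = ∑ᶠ π : Setoid T.V, S.τ₀ (T.quot π) a :=
  sum_injective (fun T => S.τ T a) (fun T T' h => S.τ_iso T T' h a) T

theorem τ₀_eq_τ_of_subsingleton {J : Type} (T : TestGraph J) [hT : Subsingleton T.V] (a : J → A) :
    S.τ₀ T a = S.τ T a := by
  have : IsEmpty {π : Setoid T.V // π ≠ ⊥} :=
    ⟨fun π => π.2 (Setoid.ext fun x y => by
      rw [Subsingleton.elim x y]; exact ⟨fun _ => Setoid.refl' _ _, fun _ => Setoid.refl' _ _⟩)⟩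
  rw [τ₀, injective, finsum_of_isEmpty, sub_zero]

theorem τ_point {J : Type} (a : J → A) : S.τ (point J) a = 1 := by
  have h := S.τ_eq_Φ_rooted (point J) (0 : Fin 1) a
  have h' : (point J).rooted (0 : Fin 1) = GraphMonomial.path (J := J) [] := rfl
  rw [h, h', S.ev_path]
  simp [S.map_one]

theorem τ₀_of_isEmpty {J : Type} (T : TestGraph J) [hE : IsEmpty T.E] (a : J → A) :
    S.τ₀ T a = 1 := by
  have := T.subsingleton_vertex
  obtain ⟨v⟩ := T.connected.1
  rw [S.τ₀_eq_τ_of_subsingleton, ← S.τ_point a]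
  have : IsEmpty (point J).E := inferInstanceAs (IsEmpty (Fin 0))
  have : Unique T.V := ⟨⟨v⟩, fun _ => Subsingleton.elim _ _⟩
  exact S.τ_iso _ _
    { onV := Equiv.ofUnique T.V (Fin 1)
      onE := Equiv.equivOfIsEmpty _ _
      src_eq := fun e => hE.elim e
      tgt_eq := fun e => hE.elim e
      var_eq := fun e => hE.elim e
      star_eq := fun e => hE.elim e } a

end TrafficSpace

/-- The components for the partition of the variables into singletons. -/
abbrev TestGraph.Comp (T : TestGraph ℕ) : Type := T.Component fun n : ℕ => n

theorem TestGraph.var_eq_of_componentOf_eq {T : TestGraph ℕ} {e e' : T.E}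
    (h : (componentOf (fun n : ℕ => n) e) = componentOf (fun n : ℕ => n) e') :
    T.var e = T.var e' := by
  have h' : Relation.EqvGen (fun e e' : T.E => T.var e = T.var e' ∧
    (T.src e = T.src e' ∨ T.src e = T.tgt e' ∨ T.tgt e = T.src e' ∨ T.tgt e = T.tgt e')) e e' :=
    Quotient.exact h
  clear h
  induction h' with
  | rel _ _ h => exact h.1
  | refl => rfl
  | symm _ _ _ ih => exact ih.symm
  | trans _ _ _ _ _ ih ih' => exact ih.trans ih'

/-- The data of a subgraph `T'` of `T`, up to renaming of the colours, that is a union of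
monochromatic components (and possibly of an isolated vertex). -/
structure Piece (T' T : TestGraph ℕ) where
  onV : T'.V → T.V
  onE : T'.E → T.E
  injV : Function.Injective onV
  injE : Function.Injective onE
  src_eq : ∀ e, T.src (onE e) = onV (T'.src e)
  tgt_eq : ∀ e, T.tgt (onE e) = onV (T'.tgt e)
  star_eq : ∀ e, T.star (onE e) = T'.star e
  var_iff : ∀ e e', T.var (onE e) = T.var (onE e') ↔ T'.var e = T'.var e'
  saturated : ∀ e f, T.var (onE e) = T.var f →
    (T.src (onE e) = T.src f ∨ T.src (onE e) = T.tgt f ∨ T.tgt (onE e) = T.src f ∨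
      T.tgt (onE e) = T.tgt f) → ∃ e', onE e' = f

namespace Piece

variable {T' T : TestGraph ℕ} (f : Piece T' T)

theorem exists_of_rel {x y : T.E}
    (h : componentOf (fun n : ℕ => n) x = componentOf (fun n : ℕ => n) y) (e : T'.E)
    (he : f.onE e = x) : ∃ e', f.onE e' = y ∧
      componentOf (fun n : ℕ => n) e = componentOf (fun n : ℕ => n) e' := by
  have h' : Relation.EqvGen (fun e e' : T.E => T.var e = T.var e' ∧
    (T.src e = T.src e' ∨ T.src e = T.tgt e' ∨ T.tgt e = T.src e' ∨ T.tgt e = T.tgt e')) x y :=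
    Quotient.exact h
  clear h
  -- Both directions are proved together so that the symmetry case of the induction is immediate.
  suffices H : (∀ e, f.onE e = x → ∃ e', f.onE e' = y ∧
      componentOf (fun n : ℕ => n) e = componentOf (fun n : ℕ => n) e') ∧
      (∀ e, f.onE e = y → ∃ e', f.onE e' = x ∧
      componentOf (fun n : ℕ => n) e = componentOf (fun n : ℕ => n) e') from H.1 e he
  clear he
  have one : ∀ e e' : T'.E, T.var (f.onE e) = T.var (f.onE e') →
      (T.src (f.onE e) = T.src (f.onE e') ∨ T.src (f.onE e) = T.tgt (f.onE e') ∨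
      T.tgt (f.onE e) = T.src (f.onE e') ∨ T.tgt (f.onE e) = T.tgt (f.onE e')) →
      componentOf (fun n : ℕ => n) e = componentOf (fun n : ℕ => n) e' := by
    intro e e' hv ht
    refine Quotient.sound (.rel _ _ ⟨(f.var_iff _ _).1 hv, ?_⟩)
    simpa only [f.src_eq, f.tgt_eq, f.injV.eq_iff] using ht
  induction h' with
  | rel x y h =>
    constructor
    · rintro e rfl
      obtain ⟨e', rfl⟩ := f.saturated e y h.1 h.2
      exact ⟨e', rfl, one _ _ h.1 h.2⟩
    · rintro e rfl
      obtain ⟨e', rfl⟩ := f.saturated e x h.1.symm (by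
        rcases h.2 with h | h | h | h <;> simp [h])
      exact ⟨e', rfl, (one _ _ h.1 h.2).symm⟩
  | refl x => exact ⟨fun e he => ⟨e, he, rfl⟩, fun e he => ⟨e, he, rfl⟩⟩
  | symm x y _ ih => exact ih.symm
  | trans x y z _ _ ih ih' =>
    constructor
    · intro e he
      obtain ⟨e', he', h⟩ := ih.1 e he
      obtain ⟨e'', he'', h'⟩ := ih'.1 e' he'
      exact ⟨e'', he'', h.trans h'⟩
    · intro e he
      obtain ⟨e', he', h⟩ := ih'.2 e he
      obtain ⟨e'', he'', h'⟩ := ih.2 e' he'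
      exact ⟨e'', he'', h.trans h'⟩

theorem componentOf_onE {e e' : T'.E}
    (h : componentOf (fun n : ℕ => n) e = componentOf (fun n : ℕ => n) e') :
    componentOf (fun n : ℕ => n) (f.onE e) = componentOf (fun n : ℕ => n) (f.onE e') := by
  have h' : Relation.EqvGen (fun e e' : T'.E => T'.var e = T'.var e' ∧
    (T'.src e = T'.src e' ∨ T'.src e = T'.tgt e' ∨ T'.tgt e = T'.src e' ∨
      T'.tgt e = T'.tgt e')) e e' := Quotient.exact h
  clear h
  induction h' with
  | rel x y h =>
    refine Quotient.sound (.rel _ _ ⟨(f.var_iff _ _).2 h.1, ?_⟩)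
    simpa only [f.src_eq, f.tgt_eq, f.injV.eq_iff] using h.2
  | refl => rfl
  | symm _ _ _ ih => exact ih.symm
  | trans _ _ _ _ _ ih ih' => exact ih.trans ih'

/-- The map between components. -/
def map (q : T'.Comp) : T.Comp :=
  Quotient.lift (fun e => componentOf (fun n : ℕ => n) (f.onE e))
    (fun _ _ h => f.componentOf_onE (Quotient.sound h)) q

theorem componentOf_eq_map {q : T'.Comp} {y : T.E}
    (h : componentOf (fun n : ℕ => n) y = f.map q) :
    ∃ e, f.onE e = y ∧ componentOf _ e = q := by
  induction q using Quotient.inductionOn with | h e => ?_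
  obtain ⟨e', h₁, h₂⟩ := f.exists_of_rel h.symm e rfl
  exact ⟨e', h₁, h₂.symm⟩

theorem hasVertex_map_iff (q : T'.Comp) (v : T.V) :
    (f.map q).HasVertex v ↔ ∃ v', f.onV v' = v ∧ q.HasVertex v' := by
  constructor
  · rintro ⟨y, hy, hv⟩
    obtain ⟨e, rfl, rfl⟩ := f.componentOf_eq_map hy
    rw [f.src_eq, f.tgt_eq] at hv
    rcases hv with rfl | rfl
    · exact ⟨_, rfl, hasVertex_src e⟩
    · exact ⟨_, rfl, hasVertex_tgt e⟩
  · rintro ⟨v', rfl, e, rfl, hv⟩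
    refine ⟨f.onE e, rfl, ?_⟩
    rw [f.src_eq, f.tgt_eq, f.injV.eq_iff, f.injV.eq_iff]
    exact hv

/-- A component and its image have the same shape. -/
def mapIso (q : T'.Comp) :
    (q.toTestGraph.rename fun _ => ()).toStarGraph.Iso
      ((f.map q).toTestGraph.rename fun _ => ()).toStarGraph where
  onV := Equiv.ofBijective
    (fun v : {v : T'.V // q.HasVertex v} =>
      (⟨f.onV v.1, (f.hasVertex_map_iff q _).2 ⟨v.1, rfl, v.2⟩⟩ :
        {v : T.V // (f.map q).HasVertex v}))
    ⟨fun v w h => Subtype.ext (f.injV (congrArg Subtype.val h)), fun ⟨w, hw⟩ => by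
      obtain ⟨v, rfl, hv⟩ := (f.hasVertex_map_iff q w).1 hw
      exact ⟨⟨v, hv⟩, rfl⟩⟩
  onE := Equiv.ofBijective
    (fun e : {e : T'.E // (Quotient.mk _ e : T'.Comp) = q} =>
      (⟨f.onE e.1, by obtain ⟨e, rfl⟩ := e; rfl⟩ :
        {e : T.E // (Quotient.mk _ e : T.Comp) = f.map q}))
    ⟨fun v w h => Subtype.ext (f.injE (congrArg Subtype.val h)), fun ⟨w, hw⟩ => by
      obtain ⟨e, rfl, he⟩ := f.componentOf_eq_map hw
      exact ⟨⟨e, he⟩, rfl⟩⟩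
  src_eq e := Subtype.ext (f.src_eq e.1)
  tgt_eq e := Subtype.ext (f.tgt_eq e.1)
  var_eq _ := rfl
  star_eq e := f.star_eq e.1

/-- A component as a piece. -/
def ofComponent (q : T.Comp) : Piece q.toTestGraph T where
  onV v := v.1
  onE e := e.1
  injV := Subtype.val_injective
  injE := Subtype.val_injective
  src_eq _ := rfl
  tgt_eq _ := rfl
  star_eq _ := rfl
  var_iff _ _ := Iff.rfl
  saturated e f hv ht := ⟨⟨f, by rw [← e.2]; exact Quotient.sound (.symm _ _ (.rel _ _ ⟨hv, ht⟩))⟩,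
    rfl⟩

section Family

variable {K : Type} {G : K → TestGraph ℕ} (f : ∀ k, Piece (G k) T)

/-- The pieces cover `T` without overlap of edges. -/
def Cover : Prop := Function.Bijective fun x : Σ k, (G k).E => (f x.1).onE x.2

variable {f}

/-- Saturation forbids a component of `T` from leaving the piece that contains one of its edges, and
each edge lies in exactly one piece. -/
theorem Cover.bijective_map (hf : Cover f) :
    Function.Bijective fun x : Σ k, (G k).Comp => (f x.1).map x.2 := by
  constructor
  · rintro ⟨k, q⟩ ⟨k', q'⟩ h
    dsimp only at h
    induction q' using Quotient.inductionOn with | h e' => ?_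
    obtain ⟨e, he, rfl⟩ := (f k).componentOf_eq_map (y := (f k').onE e') h.symm
    have := hf.1 (a₁ := ⟨k, e⟩) (a₂ := ⟨k', e'⟩) he
    cases this
    rfl
  · intro q
    induction q using Quotient.inductionOn with | h e => ?_
    obtain ⟨⟨k, e⟩, rfl⟩ := hf.2 e
    exact ⟨⟨k, componentOf _ e⟩, rfl⟩

theorem Cover.bijective_incidence (hf : Cover f) :
    Function.Bijective fun x : Σ k, (G k).Incidence fun n => n =>
      (⟨((f x.1).map x.2.1.1, (f x.1).onV x.2.1.2),
        ((f x.1).hasVertex_map_iff _ _).2 ⟨_, rfl, x.2.2⟩⟩ : T.Incidence fun n => n) := by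
  constructor
  · rintro ⟨k, ⟨q, v⟩, h⟩ ⟨k', ⟨q', v'⟩, h'⟩ heq
    have h₁ := congrArg (fun x => x.1.1) heq
    have h₂ := congrArg (fun x => x.1.2) heq
    have := hf.bijective_map.1 (a₁ := ⟨k, q⟩) (a₂ := ⟨k', q'⟩) h₁
    cases this
    have := (f k).injV h₂
    cases this
    rfl
  · rintro ⟨⟨q, v⟩, h⟩
    obtain ⟨⟨k, q⟩, rfl⟩ := hf.bijective_map.2 q
    obtain ⟨v, rfl, hv⟩ := ((f k).hasVertex_map_iff _ _).1 h
    exact ⟨⟨k, ⟨q, v⟩, hv⟩, rfl⟩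

theorem Cover.card_component [Fintype K] (hf : Cover f) :
    Nat.card T.Comp = ∑ k, Nat.card (G k).Comp := by
  rw [← Nat.card_congr (Equiv.ofBijective _ hf.bijective_map), Nat.card_sigma]

/-- Incidences are additive like components, whereas vertices shared by several pieces are not; all
the information on how the pieces are glued is in the number of vertices. -/
theorem Cover.card_incidence [Fintype K] (hf : Cover f) :
    Nat.card (T.Incidence fun n => n) = ∑ k, Nat.card ((G k).Incidence fun n => n) := by
  rw [← Nat.card_sigma]
  exact (Nat.card_congr (Equiv.ofBijective _ hf.bijective_incidence)).symm

end Family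

end Piece

/-- The hypotheses on the variables: they are identically distributed and traffic-free. -/
structure TrafficIID {A : Type*} [Ring A] [StarRing A] [Algebra ℂ A] [StarModule ℂ A]
    (S : TrafficSpace A) (a : ℕ → A) : Prop where
  law : ∀ n n', S.EqualInLaw (fun _ : Unit => a n) (fun _ : Unit => a n')
  free : S.TrafficFree (fun n : ℕ => n) a

namespace TrafficIID

variable {A : Type*} [Ring A] [StarRing A] [Algebra ℂ A] [StarModule ℂ A]
  {S : TrafficSpace A} {a : ℕ → A} (h : TrafficIID S a)
include h

/-- The counting form of traffic-freeness also covers the edgeless graph, where the condition reads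
0 + 1 = 0 + 1 and both sides are 1. -/
theorem τ₀_eq (T : TestGraph ℕ) : S.τ₀ T a =
    open Classical in
    if Nat.card (T.Incidence fun n => n) + 1 = Nat.card T.Comp + Nat.card T.V then
      ∏ᶠ q : T.Comp, S.τ₀ q.toTestGraph a else 0 := by
  by_cases hE : Nonempty T.E
  · have := h.free T hE
    rw [isFreeProduct_iff_card] at this
    split_ifs with h'
    · exact this.1 h'
    · exact this.2 h'
  · have hE' : IsEmpty T.E := not_nonempty_iff.1 hE
    have hC : IsEmpty T.Comp := T.isEmpty_component _
    have hI : IsEmpty (T.Incidence fun n => n) := ⟨fun x => hC.false x.1.1⟩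
    have hV := T.subsingleton_vertex
    have hV' := T.connected.1
    rw [if_pos (by simp), finprod_of_isEmpty, S.τ₀_of_isEmpty]

/-- All edges of a component carry the same variable, which may be exchanged for `a 0` since the
laws agree. Hence only the shape of a component matters. -/
theorem τ₀_component (T : TestGraph ℕ) (q : T.Comp) :
    S.τ₀ q.toTestGraph a = S.τ₀ (q.toTestGraph.rename fun _ => ()) (fun _ => a 0) := by
  induction q using Quotient.inductionOn with | h e => ?_
  set q : T.Comp := Quotient.mk _ e
  have hlaw : S.τ₀ (q.toTestGraph.rename fun _ => ()) (fun _ => a 0) =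
      S.τ₀ (q.toTestGraph.rename fun _ => ()) (fun _ => a (T.var e)) := by
    unfold TrafficSpace.τ₀
    rw [show (fun T' : TestGraph Unit => S.τ T' fun _ => a 0) =
      fun T' => S.τ T' fun _ => a (T.var e) from funext fun T' => h.law _ _ T']
  rw [hlaw]
  refine Eq.trans ?_ (S.τ₀_rename (fun _ : Unit => T.var e)
    (q.toTestGraph.rename fun _ => ()) a)
  exact S.τ₀_iso q.toTestGraph ((q.toTestGraph.rename fun _ => ()).rename fun _ => T.var e)
    { onV := Equiv.refl _
      onE := Equiv.refl _
      src_eq := fun _ => rfl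
      tgt_eq := fun _ => rfl
      var_eq := fun e' : {e' : T.E // (Quotient.mk _ e' : T.Comp) = q} =>
        (var_eq_of_componentOf_eq (T := T) (e := e'.1) (e' := e) e'.2).symm
      star_eq := fun _ => rfl } a

theorem τ₀_map {T T' : TestGraph ℕ} (f : Piece T' T) (q : T'.Comp) :
    S.τ₀ (f.map q).toTestGraph a = S.τ₀ q.toTestGraph a := by
  rw [h.τ₀_component, h.τ₀_component, S.τ₀_iso _ _ (f.mapIso q)]

variable {K : Type} [Fintype K] {G : K → TestGraph ℕ} {T : TestGraph ℕ} {f : ∀ k, Piece (G k) T}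

/-- Summing `card_le_card_incidence` over the pieces gives #components + #vertices < #incidences + 1
for `T`: the pieces are glued along a cycle, and the bar graph is not a tree. -/
theorem τ₀_eq_zero_of_cover (hf : Piece.Cover f)
    (hlt : Nat.card T.V + Fintype.card K < ∑ k, Nat.card (G k).V + 1) : S.τ₀ T a = 0 := by
  rw [h.τ₀_eq, if_neg]
  rw [hf.card_component, hf.card_incidence]
  have hle : ∀ k ∈ Finset.univ, Nat.card (G k).Comp + Nat.card (G k).V ≤
      Nat.card ((G k).Incidence fun n => n) + 1 := fun k _ => (G k).card_le_card_incidence _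
  have := Finset.sum_le_sum hle
  simp only [Finset.sum_add_distrib, Finset.sum_const, Finset.card_univ, smul_eq_mul,
    mul_one] at this
  omega

/-- Call #incidences + 1 - #components - #vertices the defect. Under the equality the defect of `T`
is the sum of the defects of the pieces, all nonnegative. So `T` is a tree of components if and only
if every piece is; otherwise some factor vanishes together with the left side. -/
theorem τ₀_eq_prod_of_cover (hf : Piece.Cover f)
    (heq : Nat.card T.V + Fintype.card K = ∑ k, Nat.card (G k).V + 1) :
    S.τ₀ T a = ∏ k, S.τ₀ (G k) a := by
  classical
  rw [h.τ₀_eq, hf.card_component, hf.card_incidence]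
  have hle : ∀ k ∈ Finset.univ, Nat.card (G k).Comp + Nat.card (G k).V ≤
      Nat.card ((G k).Incidence fun n => n) + 1 := fun k _ => (G k).card_le_card_incidence _
  split_ifs with hfree
  · have hk : ∀ k ∈ Finset.univ, Nat.card (G k).Comp + Nat.card (G k).V =
        Nat.card ((G k).Incidence fun n => n) + 1 := by
      rw [← Finset.sum_eq_sum_iff_of_le hle]
      simp only [Finset.sum_add_distrib, Finset.sum_const, Finset.card_univ, smul_eq_mul, mul_one]
      omega
    have : ∀ k, S.τ₀ (G k) a = ∏ᶠ q : (G k).Comp, S.τ₀ q.toTestGraph a := fun k => by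
      rw [h.τ₀_eq (G k), if_pos (hk k (Finset.mem_univ _)).symm]
    have hF : ∀ k, Fintype (G k).Comp := fun k => Fintype.ofFinite _
    rw [← finprod_comp_equiv (Equiv.ofBijective _ hf.bijective_map), finprod_eq_prod_of_fintype,
      Fintype.prod_sigma]
    refine Finset.prod_congr rfl fun k _ => ?_
    rw [this, finprod_eq_prod_of_fintype]
    exact Finset.prod_congr rfl fun q _ => h.τ₀_map (f k) q
  · have hk : ∃ k, Nat.card (G k).Comp + Nat.card (G k).V ≠
        Nat.card ((G k).Incidence fun n => n) + 1 := by
      by_contra hcon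
      push Not at hcon
      refine hfree ?_
      have := Finset.sum_congr rfl fun k (_ : k ∈ Finset.univ) => hcon k
      simp only [Finset.sum_add_distrib, Finset.sum_const, Finset.card_univ, smul_eq_mul,
        mul_one] at this
      omega
    obtain ⟨k, hk⟩ := hk
    refine (Finset.prod_eq_zero (Finset.mem_univ k) ?_).symm
    rw [h.τ₀_eq, if_neg (Ne.symm hk)]

end TrafficIID

end Traffic

end

/-! ### Erasing a colour, splitting off loops, and cutting along two edges -/

noncomputable section

namespace Traffic

open TestGraph

namespace TestGraph

/-- The graph obtained by suppressing the edges of a colour. -/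
def eraseGraph (T : TestGraph ℕ) (c : ℕ) : StarGraph ℕ where
  V := T.V
  E := {e : T.E // T.var e ≠ c}
  finV := inferInstance
  finE := inferInstance
  src e := T.src e
  tgt e := T.tgt e
  var e := T.var e
  star e := T.star e

/-- The components of a given colour. -/
def ColourComp (T : TestGraph ℕ) (c : ℕ) : Type :=
  {q : T.Comp // ∃ e, componentOf _ e = q ∧ T.var e = c}

instance (T : TestGraph ℕ) (c : ℕ) : Fintype (T.ColourComp c) :=
  @Fintype.ofFinite _ (inferInstanceAs (Finite {_q : T.Comp // _}))

/-- The component of an edge of a given colour. -/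
def colourComp {T : TestGraph ℕ} {c : ℕ} (e : T.E) (he : T.var e = c) : T.ColourComp c :=
  ⟨componentOf _ e, e, rfl, he⟩

theorem ColourComp.var_eq {T : TestGraph ℕ} {c : ℕ} (q : T.ColourComp c) (e : T.E)
    (he : componentOf _ e = q.1) : T.var e = c := by
  obtain ⟨e', he', rfl⟩ := q.2
  exact var_eq_of_componentOf_eq (he.trans he'.symm)

end TestGraph

namespace Piece

/-- The graph without the edges of a colour, if it is connected, is a piece. -/
def erase {T : TestGraph ℕ} {c : ℕ} (hconn : (T.eraseGraph c).Connected) :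
    Piece ⟨T.eraseGraph c, hconn⟩ T where
  onV := id
  onE e := e.1
  injV := Function.injective_id
  injE := Subtype.val_injective
  src_eq _ := rfl
  tgt_eq _ := rfl
  star_eq _ := rfl
  var_iff _ _ := Iff.rfl
  saturated e f hv _ := ⟨⟨f, fun h => e.2 (hv.trans h)⟩, rfl⟩

/-- A piece which is a component of given colour and shape. -/
def ofShape {T : TestGraph ℕ} (G : TestGraph Unit) (c : ℕ) (onV : G.V → T.V) (onE : G.E → T.E)
    (injV : Function.Injective onV) (injE : Function.Injective onE)
    (src_eq : ∀ e, T.src (onE e) = onV (G.src e)) (tgt_eq : ∀ e, T.tgt (onE e) = onV (G.tgt e))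
    (star_eq : ∀ e, T.star (onE e) = G.star e) (var_eq : ∀ e, T.var (onE e) = c)
    (surj : ∀ f, T.var f = c → ∃ e, onE e = f) : Piece (G.rename fun _ => c) T where
  onV := onV
  onE := onE
  injV := injV
  injE := injE
  src_eq := src_eq
  tgt_eq := tgt_eq
  star_eq := star_eq
  var_iff e e' := ⟨fun _ => rfl, fun _ => (var_eq e).trans (var_eq e').symm⟩
  saturated e f hv _ := surj f (hv.symm.trans (var_eq e))

end Piece

namespace TrafficIID

variable {A : Type*} [Ring A] [StarRing A] [Algebra ℂ A] [StarModule ℂ A]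
  {S : TrafficSpace A} {a : ℕ → A} (h : TrafficIID S a)
include h

theorem τ₀_rename_const (G : TestGraph Unit) (c : ℕ) :
    S.τ₀ (G.rename fun _ => c) a = S.τ₀ G fun _ => a 0 := by
  rw [S.τ₀_rename]
  unfold TrafficSpace.τ₀
  congr 1
  exact funext fun T' => h.law c 0 T'

/-- If `T` stays connected without the colour `c`, the ends of `e` are joined both inside and
outside this colour, which makes a cycle. In the count, the erased graph already has all the
vertices, and the component of `e` adds at least two more. -/
theorem τ₀_eq_zero_of_erase {T : TestGraph ℕ} {c : ℕ} (hconn : (T.eraseGraph c).Connected)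
    (e : T.E) (he : T.var e = c) (hne : T.src e ≠ T.tgt e) : S.τ₀ T a = 0 := by
  let G : Option (T.ColourComp c) → TestGraph ℕ := fun k =>
    k.elim ⟨T.eraseGraph c, hconn⟩ fun q => q.1.toTestGraph
  let f : ∀ k, Piece (G k) T := fun k => match k with
    | none => Piece.erase hconn
    | some q => Piece.ofComponent q.1
  have hf : Piece.Cover f := by
    constructor
    · rintro ⟨_ | q, e⟩ ⟨_ | q', e'⟩ hee
      · have : e = e' := Subtype.ext hee
        rw [this]
      · have hee : e.1 = e'.1 := hee
        exact absurd (hee ▸ q'.var_eq e'.1 e'.2) e.2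
      · have hee : e.1 = e'.1 := hee
        exact absurd (hee ▸ q.var_eq e.1 e.2) e'.2
      · have hee : e.1 = e'.1 := hee
        have hq : q = q' := Subtype.ext (e.2.symm.trans ((congrArg _ hee).trans e'.2))
        subst hq
        have : e = e' := Subtype.ext hee
        rw [this]
    · intro e
      by_cases he : T.var e = c
      · exact ⟨⟨some (colourComp e he), e, rfl⟩, rfl⟩
      · exact ⟨⟨none, e, he⟩, rfl⟩
  refine h.τ₀_eq_zero_of_cover hf ?_
  rw [Fintype.sum_option, Fintype.card_option]
  have h₁ : Nat.card (G none).V = Nat.card T.V := rfl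
  have h₂ : ∑ _q : T.ColourComp c, 1 < ∑ q : T.ColourComp c, Nat.card (G (some q)).V := by
    refine Finset.sum_lt_sum (fun q _ => ?_) ⟨colourComp e he, Finset.mem_univ _, ?_⟩
    · have := (G (some q)).connected.1
      exact Nat.card_pos
    · refine Finite.one_lt_card_iff_nontrivial.2 ⟨⟨T.src e, hasVertex_src e⟩,
        ⟨T.tgt e, hasVertex_tgt e⟩, fun heq => hne (congrArg Subtype.val heq)⟩
  simp only [Finset.sum_const, smul_eq_mul, mul_one, Finset.card_univ] at h₂
  omega

/-- A loop alone in its colour is a piece with one vertex, so it splits off as a factor, which is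
zero by centring. -/
theorem τ₀_eq_zero_of_loop {T : TestGraph ℕ} (e : T.E) (hloop : T.src e = T.tgt e)
    (hstar : T.star e = false)
    (huniq : ∀ e', T.var e' = T.var e → e' = e) (hmean : S.τ₀ loop (fun _ => a 0) = 0) :
    S.τ₀ T a = 0 := by
  have hconn : (T.eraseGraph (T.var e)).Connected := by
    refine ⟨T.connected.1, fun v w => (T.connected.2 v w).map (T := T.toStarGraph)
      (T' := T.eraseGraph (T.var e)) id
      fun e' => ?_⟩
    by_cases he : T.var e' = T.var e
    · rw [huniq _ he, hloop]; exact .refl _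
    · exact (T.eraseGraph (T.var e)).linked_edge ⟨e', he⟩
  let G : Bool → TestGraph ℕ := fun k =>
    if k then ⟨T.eraseGraph (T.var e), hconn⟩ else loop.rename fun _ => T.var e
  let f : ∀ k, Piece (G k) T := fun k => match k with
    | true => Piece.erase hconn
    | false => Piece.ofShape loop (T.var e) (fun _ => T.src e) (fun _ => e)
        (fun _ _ _ => rfl) (fun _ _ _ => rfl) (fun _ => rfl) (fun _ => hloop.symm)
        (fun _ => hstar) (fun _ => rfl) (fun f hf => ⟨(), (huniq f hf).symm⟩)
  have hf : Piece.Cover f := by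
    constructor
    · rintro ⟨_ | _, e₁⟩ ⟨_ | _, e₂⟩ hee
      · rfl
      · have hee : e = e₂.1 := hee
        exact absurd (congrArg T.var hee.symm) e₂.2
      · have hee : e₁.1 = e := hee
        exact absurd (congrArg T.var hee) e₁.2
      · have : e₁ = e₂ := Subtype.ext hee
        rw [this]
    · intro e'
      by_cases he : T.var e' = T.var e
      · exact ⟨⟨false, ()⟩, (huniq _ he).symm⟩
      · exact ⟨⟨true, e', he⟩, rfl⟩
  have h₁ : Nat.card (G true).V = Nat.card T.V := rfl
  have h₂ : Nat.card (G false).V = 1 := Nat.card_unique (α := Unit)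
  rw [h.τ₀_eq_prod_of_cover hf (by rw [Fintype.sum_bool, Fintype.card_bool, h₁, h₂])]
  refine Finset.prod_eq_zero (Finset.mem_univ false) ?_
  exact (h.τ₀_rename_const loop (T.var e)).trans hmean

/-- On a single vertex all pieces have one vertex, so the count 1 + 2 = (1 + 1) + 1 always allows
factorization. -/
theorem τ₀_eq_mul_of_subsingleton {T G₁ : TestGraph ℕ} [Subsingleton T.V]
    (hstar : ∀ e, T.star e = false)
    (e₀ e₁ : T.E) (hne : e₀ ≠ e₁) (hvar : T.var e₁ = T.var e₀)
    (huniq : ∀ e, T.var e = T.var e₀ → e = e₀ ∨ e = e₁) (f₁ : Piece G₁ T)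
    (hcov : ∀ e, (∃ e', f₁.onE e' = e) ↔ e ≠ e₀ ∧ e ≠ e₁) :
    S.τ₀ T a = S.τ₀ doubleLoop (fun _ => a 0) * S.τ₀ G₁ a := by
  let G : Bool → TestGraph ℕ := fun k =>
    if k then doubleLoop.rename fun _ => T.var e₀ else G₁
  let f : ∀ k, Piece (G k) T := fun k => match k with
    | false => f₁
    | true => Piece.ofShape doubleLoop (T.var e₀) (fun _ => T.src e₀)
        (fun b => bif b then e₀ else e₁)
        (fun _ _ _ => rfl)
        (by rintro (_ | _) (_ | _) hh
            · rfl
            · exact absurd hh.symm hne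
            · exact absurd hh hne
            · rfl)
        (fun _ => Subsingleton.elim _ _) (fun _ => Subsingleton.elim _ _)
        (fun _ => hstar _) (by rintro (_ | _) <;> simp [hvar])
        (fun f hf => (huniq f hf).elim (fun hh => ⟨true, hh.symm⟩) fun hh => ⟨false, hh.symm⟩)
  have hf : Piece.Cover f := by
    constructor
    · rintro ⟨_ | _, e₁'⟩ ⟨_ | _, e₂'⟩ hee
      · exact congrArg (Sigma.mk _) ((f _).injE hee)
      · have := (hcov _).1 ⟨e₁', hee⟩
        rcases e₂' with _ | _
        · exact absurd rfl this.2
        · exact absurd rfl this.1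
      · have := (hcov _).1 ⟨e₂', hee.symm⟩
        rcases e₁' with _ | _
        · exact absurd rfl this.2
        · exact absurd rfl this.1
      · exact congrArg (Sigma.mk _) ((f _).injE hee)
    · intro e
      by_cases h₀ : e = e₀
      · exact ⟨⟨true, true⟩, h₀.symm⟩
      by_cases h₁ : e = e₁
      · exact ⟨⟨true, false⟩, h₁.symm⟩
      obtain ⟨e', he'⟩ := (hcov e).2 ⟨h₀, h₁⟩
      exact ⟨⟨false, e'⟩, he'⟩
  have h₀ : Nat.card T.V = 1 := by
    have := T.connected.1
    exact Nat.card_eq_one_iff_unique.2 ⟨inferInstance, this⟩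
  have h₂ : Nat.card (G true).V = 1 := Nat.card_unique (α := Unit)
  have h₁ : Nat.card (G false).V = 1 := by
    have : Subsingleton G₁.V := f₁.injV.subsingleton
    exact Nat.card_eq_one_iff_unique.2 ⟨this, G₁.connected.1⟩
  rw [h.τ₀_eq_prod_of_cover hf (by rw [Fintype.sum_bool, Fintype.card_bool, h₀, h₁, h₂]),
    Fintype.prod_bool]
  congr 1
  exact h.τ₀_rename_const doubleLoop (T.var e₀)

section Cut

variable {T G₁ G₂ : TestGraph ℕ} (e₀ e₁ : T.E) (hvar : T.var e₁ = T.var e₀)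
    (f₁ : Piece G₁ T) (f₂ : Piece G₂ T)
    (hV : Function.Bijective (Sum.elim f₁.onV f₂.onV))
    (hE : ∀ e, T.var e ≠ T.var e₀ ↔ (∃ e', f₁.onE e' = e) ∨ ∃ e', f₂.onE e' = e)
    (hdisj : ∀ e e', f₁.onE e ≠ f₂.onE e')
    {s₀ t₁ : G₂.V} {t₀ s₁ : G₁.V} (hs₀ : T.src e₀ = f₂.onV s₀) (ht₀ : T.tgt e₀ = f₁.onV t₀)
    (hs₁ : T.src e₁ = f₁.onV s₁) (ht₁ : T.tgt e₁ = f₂.onV t₁)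

include hvar hV hE hdisj hs₀ ht₀ hs₁ ht₁ in
-- Without the colour of `e₀`, the graph falls into two vertex-disjoint pieces bridged by `e₀` (from
-- `G₂` to `G₁`) and `e₁` (back). If the two bridges do not have the same pair of ends, they close a
-- cycle through one of the pieces.
theorem τ₀_eq_zero_of_cut (hne : ¬ (t₀ = s₁ ∧ s₀ = t₁)) : S.τ₀ T a = 0 := by
  classical
  set c := T.var e₀ with hc
  let G : Bool ⊕ T.ColourComp c → TestGraph ℕ := fun k => match k with
    | Sum.inl b => if b then G₁ else G₂
    | Sum.inr q => q.1.toTestGraph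
  let f : ∀ k, Piece (G k) T := fun k => match k with
    | Sum.inl true => f₁
    | Sum.inl false => f₂
    | Sum.inr q => Piece.ofComponent q.1
  have hf : Piece.Cover f := by
    constructor
    · rintro ⟨(_ | _) | q, e⟩ ⟨(_ | _) | q', e'⟩ hee
      · exact congrArg (Sigma.mk _) ((f (Sum.inl false)).injE hee)
      · exact absurd hee.symm (hdisj _ _)
      · exact absurd (q'.var_eq e'.1 e'.2) ((hE _).2 (Or.inr ⟨e, hee⟩))
      · exact absurd hee (hdisj _ _)
      · exact congrArg (Sigma.mk _) ((f (Sum.inl true)).injE hee)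
      · exact absurd (q'.var_eq e'.1 e'.2) ((hE _).2 (Or.inl ⟨e, hee⟩))
      · exact absurd (q.var_eq e.1 e.2) ((hE _).2 (Or.inr ⟨e', hee.symm⟩))
      · exact absurd (q.var_eq e.1 e.2) ((hE _).2 (Or.inl ⟨e', hee.symm⟩))
      · have hee : e.1 = e'.1 := hee
        have hq : q = q' := Subtype.ext (e.2.symm.trans ((congrArg _ hee).trans e'.2))
        subst hq
        have : e = e' := Subtype.ext hee
        rw [this]
    · intro e
      by_cases he : T.var e = c
      · exact ⟨⟨Sum.inr (colourComp e he), e, rfl⟩, rfl⟩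
      · rcases (hE e).1 he with ⟨e', he'⟩ | ⟨e', he'⟩
        · exact ⟨⟨Sum.inl true, e'⟩, he'⟩
        · exact ⟨⟨Sum.inl false, e'⟩, he'⟩
  have hcross : ∀ v w, f₁.onV v ≠ f₂.onV w := fun v w hvw => by
    have := hV.1 (a₁ := Sum.inl v) (a₂ := Sum.inr w) hvw
    cases this
  have hcard : Nat.card T.V = Nat.card G₁.V + Nat.card G₂.V := by
    rw [← Nat.card_congr (Equiv.ofBijective _ hV), Nat.card_sum]
  refine h.τ₀_eq_zero_of_cover hf ?_
  rw [Fintype.sum_sum_type, Fintype.card_sum, Fintype.sum_bool, Fintype.card_bool]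
  have h₁ : Nat.card (G (Sum.inl true)).V = Nat.card G₁.V := rfl
  have h₂ : Nat.card (G (Sum.inl false)).V = Nat.card G₂.V := rfl
  have hpos : ∀ q : T.ColourComp c, 1 ≤ Nat.card (G (Sum.inr q)).V := fun q => by
    have := (G (Sum.inr q)).connected.1
    exact Nat.card_pos
  have hsum : ∑ q : T.ColourComp c, Nat.card (G (Sum.inr q)).V =
      ∑ q : T.ColourComp c, (Nat.card (G (Sum.inr q)).V - 1) + Fintype.card (T.ColourComp c) := by
    rw [← Finset.card_univ, Finset.card_eq_sum_ones, ← Finset.sum_add_distrib]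
    exact Finset.sum_congr rfl fun q _ => (Nat.sub_add_cancel (hpos q)).symm
  -- The strict inequality needed amounts to this bound. Two distinct components contribute one
  -- each, having an edge across the cut; a single component contributes two, since it has three
  -- vertices when the ends of the bridges do not match.
  have htwo : 2 ≤ ∑ q : T.ColourComp c, (Nat.card (G (Sum.inr q)).V - 1) := by
    by_cases hq : colourComp e₀ rfl = colourComp e₁ hvar
    · refine le_trans ?_ (Finset.single_le_sum (f := fun q => Nat.card (G (Sum.inr q)).V - 1)
        (fun _ _ => Nat.zero_le _) (Finset.mem_univ (colourComp e₀ rfl)))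
      have hq' : componentOf (fun n : ℕ => n) e₁ = componentOf (fun n : ℕ => n) e₀ :=
        (congrArg Subtype.val hq).symm
      let V := (G (Sum.inr (colourComp e₀ rfl))).V
      have : Fintype V := Fintype.ofFinite V
      let v₁ : V := ⟨T.src e₀, hasVertex_src e₀⟩
      let v₂ : V := ⟨T.tgt e₀, hasVertex_tgt e₀⟩
      let v₃ : V := ⟨T.src e₁, by
        show (componentOf _ e₀).HasVertex _
        rw [← hq']; exact hasVertex_src e₁⟩
      let v₄ : V := ⟨T.tgt e₁, by
        show (componentOf _ e₀).HasVertex _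
        rw [← hq']; exact hasVertex_tgt e₁⟩
      have h12 : v₁ ≠ v₂ := fun hh => hcross _ _
        (ht₀.symm.trans ((congrArg Subtype.val hh).symm.trans hs₀))
      have h32 : v₁ ≠ v₃ := fun hh => hcross _ _
        (hs₁.symm.trans ((congrArg Subtype.val hh).symm.trans hs₀))
      have h42 : v₄ ≠ v₂ := fun hh => hcross _ _
        (ht₀.symm.trans ((congrArg Subtype.val hh).symm.trans ht₁))
      have h3 : 2 < Nat.card V := by
        rw [Nat.card_eq_fintype_card, Fintype.two_lt_card_iff]
        by_cases h1 : t₀ = s₁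
        · refine ⟨v₁, v₂, v₄, h12, fun hh => hne ⟨h1, ?_⟩, h42.symm⟩
          exact f₂.injV (hs₀.symm.trans ((congrArg Subtype.val hh).trans ht₁))
        · refine ⟨v₁, v₂, v₃, h12, h32, fun hh => h1 ?_⟩
          exact f₁.injV (ht₀.symm.trans ((congrArg Subtype.val hh).trans hs₁))
      exact Nat.le_sub_one_of_lt h3
    · have key : ∀ (e : T.E) (he : T.var e = c), T.src e ≠ T.tgt e →
          1 ≤ Nat.card (G (Sum.inr (colourComp e he))).V - 1 := fun e he hne => by
        refine Nat.le_sub_one_of_lt (Finite.one_lt_card_iff_nontrivial.2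
          ⟨⟨T.src e, hasVertex_src e⟩, ⟨T.tgt e, hasVertex_tgt e⟩,
            fun heq => hne (congrArg Subtype.val heq)⟩)
      have k₀ := key e₀ rfl fun hh => hcross _ _ (ht₀.symm.trans (hh.symm.trans hs₀))
      have k₁ := key e₁ hvar fun hh => hcross _ _ (hs₁.symm.trans (hh.trans ht₁))
      have := Finset.sum_le_sum_of_subset (f := fun q => Nat.card (G (Sum.inr q)).V - 1)
        (Finset.subset_univ {colourComp e₀ rfl, colourComp e₁ hvar})
      rw [Finset.sum_pair hq] at this
      omega
  omega

include hvar hV hE hdisj hs₀ ht₀ hs₁ ht₁ in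
-- When the ends match, the bridges form a double arrow, which has two vertices, and three pieces
-- meet at two vertices: the count is |V| + 3 = 2 + |V₁| + |V₂| + 1.
theorem τ₀_eq_mul_of_cut (huniq : ∀ e, T.var e = T.var e₀ → e = e₀ ∨ e = e₁)
    (hstar : ∀ e, T.star e = false) (hts : t₀ = s₁) (hst : s₀ = t₁) :
    S.τ₀ T a = S.τ₀ doubleArrow (fun _ => a 0) * (S.τ₀ G₁ a * S.τ₀ G₂ a) := by
  subst hts hst
  have hcross : ∀ v w, f₁.onV v ≠ f₂.onV w := fun v w hvw => by
    have := hV.1 (a₁ := Sum.inl v) (a₂ := Sum.inr w) hvw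
    cases this
  have hcard : Nat.card T.V = Nat.card G₁.V + Nat.card G₂.V := by
    rw [← Nat.card_congr (Equiv.ofBijective _ hV), Nat.card_sum]
  have hne : e₀ ≠ e₁ := by
    rintro rfl
    exact hcross _ _ (hs₁.symm.trans hs₀)
  let G : Option Bool → TestGraph ℕ := fun k => match k with
    | none => doubleArrow.rename fun _ => T.var e₀
    | some true => G₁
    | some false => G₂
  let f : ∀ k, Piece (G k) T := fun k => match k with
    | some true => f₁
    | some false => f₂
    | none => Piece.ofShape doubleArrow (T.var e₀) (fun b => bif b then f₂.onV s₀ else f₁.onV t₀)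
        (fun b => bif b then e₀ else e₁)
        (by rintro (_ | _) (_ | _) hh
            · rfl
            · exact absurd hh (hcross _ _)
            · exact absurd hh.symm (hcross _ _)
            · rfl)
        (by rintro (_ | _) (_ | _) hh
            · rfl
            · exact absurd hh.symm hne
            · exact absurd hh hne
            · rfl)
        (by rintro (_ | _); exacts [hs₁, hs₀]) (by rintro (_ | _); exacts [ht₁, ht₀])
        (fun _ => hstar _) (by rintro (_ | _) <;> simp [hvar])
        (fun f hf => (huniq f hf).elim (fun hh => ⟨true, hh.symm⟩) fun hh => ⟨false, hh.symm⟩)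
  have hnone : ∀ e : (G none).E, T.var ((f none).onE e) = T.var e₀ := by
    rintro (_ | _); exacts [hvar, rfl]
  have hf : Piece.Cover f := by
    constructor
    · rintro ⟨_ | _ | _, e⟩ ⟨_ | _ | _, e'⟩ hee
      · exact congrArg (Sigma.mk _) ((f (none)).injE hee)
      · exact absurd (hnone e) ((hE _).2 (Or.inr ⟨e', hee.symm⟩))
      · exact absurd (hnone e) ((hE _).2 (Or.inl ⟨e', hee.symm⟩))
      · exact absurd (hnone e') ((hE _).2 (Or.inr ⟨e, hee⟩))
      · exact congrArg (Sigma.mk _) ((f (some false)).injE hee)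
      · exact absurd hee.symm (hdisj _ _)
      · exact absurd (hnone e') ((hE _).2 (Or.inl ⟨e, hee⟩))
      · exact absurd hee (hdisj _ _)
      · exact congrArg (Sigma.mk _) ((f (some true)).injE hee)
    · intro e
      by_cases he : T.var e = T.var e₀
      · rcases huniq e he with rfl | rfl
        · exact ⟨⟨none, true⟩, rfl⟩
        · exact ⟨⟨none, false⟩, rfl⟩
      · rcases (hE e).1 he with ⟨e', he'⟩ | ⟨e', he'⟩
        · exact ⟨⟨some true, e'⟩, he'⟩
        · exact ⟨⟨some false, e'⟩, he'⟩
  have h₁ : Nat.card (G none).V = 2 :=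
    (Nat.card_eq_fintype_card (α := Bool)).trans Fintype.card_bool
  rw [h.τ₀_eq_prod_of_cover hf (by
    rw [Fintype.sum_option, Fintype.sum_bool, Fintype.card_option, Fintype.card_bool, h₁]
    show Nat.card T.V + 3 = 2 + (Nat.card G₁.V + Nat.card G₂.V) + 1
    omega), Fintype.prod_option, Fintype.prod_bool]
  congr 1
  exact h.τ₀_rename_const doubleArrow (T.var e₀)

end Cut

end TrafficIID

end Traffic

end

/-! ### Quotients of a directed path, and partitions split into two arcs -/

noncomputable section

namespace Traffic

open TestGraph

/-- The directed path with `N` edges, the edge from `t` to `t + 1` having the colour `i t`. -/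
def walk (N : ℕ) (i : ℕ → ℕ) : TestGraph ℕ where
  V := Fin (N + 1)
  E := Fin N
  finV := inferInstance
  finE := inferInstance
  src := Fin.castSucc
  tgt := Fin.succ
  var t := i t
  star _ := false
  connected := by
    have key : ∀ v : Fin (N + 1), StarGraph.Linked
        (⟨Fin (N + 1), Fin N, inferInstance, inferInstance, Fin.castSucc, Fin.succ,
          fun t => i t, fun _ => false⟩ : StarGraph ℕ) 0 v := by
      intro v
      induction v using Fin.induction with
      | zero => exact .refl _
      | succ i ih => exact .trans _ _ _ ih (.rel _ _ ⟨i, rfl, rfl⟩)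
    exact ⟨⟨0⟩, fun v w => .trans _ _ _ (.symm _ _ (key v)) (key w)⟩

/-- A quotient of the path. -/
def walkQuot (N : ℕ) (i : ℕ → ℕ) (π : Setoid (Fin (N + 1))) : TestGraph ℕ := (walk N i).quot π

/-- A stretch of the path survives the erasure of a colour as long as its steps of that colour have
been contracted by the partition. -/
theorem linked_erase_walkQuot {N : ℕ} {i : ℕ → ℕ} {π : Setoid (Fin (N + 1))} {c : ℕ} (u d : ℕ)
    (hN : u + d < N + 1)
    (hstep : ∀ r : Fin N, u ≤ r → r < u + d → i r ≠ c ∨ π r.castSucc r.succ) :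
    ((walkQuot N i π).eraseGraph c).Linked (Quotient.mk π ⟨u, by omega⟩)
      (Quotient.mk π ⟨u + d, hN⟩) := by
  induction d with
  | zero => exact .refl _
  | succ d ih =>
    refine .trans _ _ _ (ih (by omega) fun r h₁ h₂ => hstep r h₁ (by omega)) ?_
    rcases hstep ⟨u + d, by omega⟩ (by simp) (by simp) with h | h
    · exact ((walkQuot N i π).eraseGraph c).linked_edge ⟨⟨u + d, by omega⟩, h⟩
    · have : (Quotient.mk π ⟨u + d, by omega⟩ : Quotient π) = Quotient.mk π ⟨u + (d + 1), hN⟩ :=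
        Quotient.sound h
      rw [← this]
      exact .refl _

section Partitions

instance {α : Type*} [Finite α] : Finite (Setoid α) :=
  Finite.of_injective (fun π : Setoid α => fun x y => π x y)
    fun _ _ h => Setoid.ext fun x y => iff_of_eq (congrFun (congrFun h x) y)

instance {n : ℕ} : Fintype (Setoid (Fin n)) := Fintype.ofFinite _

/-- The partitions of the vertices of the path that close it up and turn into loops the steps of
kind `true`. -/
def closings (N : ℕ) (x : ℕ → Bool × ℕ) : Set (Setoid (Fin (N + 1))) :=
  {π | π 0 (Fin.last N) ∧ ∀ t : Fin N, (x t).1 = true → π t.castSucc t.succ}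

variable (k₁ k₂ : ℕ)

/-- First part of the vertices of a path after suppression of two edges. -/
def leftPart (x : Fin (k₁ + 1)) : Fin (k₁ + k₂ + 2 + 1) := ⟨x + 1, by omega⟩

/-- Second part of the vertices of a path after suppression of two edges. -/
def rightPart (y : Fin (k₂ + 1)) : Fin (k₁ + k₂ + 2 + 1) := ⟨y + (k₁ + 2), by omega⟩

/-- The part to which a vertex belongs; the vertex `0` is taken to be the last one. -/
def partOf (v : Fin (k₁ + k₂ + 2 + 1)) : Fin (k₁ + 1) ⊕ Fin (k₂ + 1) :=
  if v.1 = 0 then Sum.inr (Fin.last _)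
  else if h : v.1 < k₁ + 2 then Sum.inl ⟨v - 1, by omega⟩
  else Sum.inr ⟨v - (k₁ + 2), by omega⟩

@[simp] theorem partOf_leftPart (x) : partOf k₁ k₂ (leftPart k₁ k₂ x) = Sum.inl x := by
  have : (leftPart k₁ k₂ x).1 = x + 1 := rfl
  rw [partOf, if_neg (by omega), dif_pos (by omega)]
  congr 1

@[simp] theorem partOf_rightPart (y) : partOf k₁ k₂ (rightPart k₁ k₂ y) = Sum.inr y := by
  have : (rightPart k₁ k₂ y).1 = y + (k₁ + 2) := rfl
  rw [partOf, if_neg (by omega), dif_neg (by omega)]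
  congr 1
  ext
  simp [this]

@[simp] theorem partOf_zero : partOf k₁ k₂ 0 = Sum.inr (Fin.last _) := if_pos rfl

theorem rightPart_last : rightPart k₁ k₂ (Fin.last _) = Fin.last _ := by
  ext
  simp only [rightPart, Fin.val_last]
  omega

/-- The partition made of partitions of both parts. -/
def gluePart (π₁ : Setoid (Fin (k₁ + 1))) (π₂ : Setoid (Fin (k₂ + 1))) :
    Setoid (Fin (k₁ + k₂ + 2 + 1)) :=
  Setoid.ker (Sum.map (Quotient.mk π₁) (Quotient.mk π₂) ∘ partOf k₁ k₂)

theorem gluePart_rel {π₁ π₂} (v w) : gluePart k₁ k₂ π₁ π₂ v w ↔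
    Sum.map (Quotient.mk π₁) (Quotient.mk π₂) (partOf k₁ k₂ v) =
      Sum.map (Quotient.mk π₁) (Quotient.mk π₂) (partOf k₁ k₂ w) := Iff.rfl

theorem gluePart_left {π₁ π₂} (x y) :
    gluePart k₁ k₂ π₁ π₂ (leftPart k₁ k₂ x) (leftPart k₁ k₂ y) ↔ π₁ x y := by
  simp [gluePart_rel, Quotient.eq]

theorem gluePart_right {π₁ π₂} (x y) :
    gluePart k₁ k₂ π₁ π₂ (rightPart k₁ k₂ x) (rightPart k₁ k₂ y) ↔ π₂ x y := by
  simp [gluePart_rel, Quotient.eq]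

theorem gluePart_left_right {π₁ π₂} (x y) :
    ¬ gluePart k₁ k₂ π₁ π₂ (leftPart k₁ k₂ x) (rightPart k₁ k₂ y) := by
  simp [gluePart_rel]

theorem gluePart_zero_last {π₁ π₂} : gluePart k₁ k₂ π₁ π₂ 0 (Fin.last _) := by
  rw [← rightPart_last]
  simp [gluePart_rel]

theorem rel_of_partOf {π : Setoid (Fin (k₁ + k₂ + 2 + 1))} (h0 : π 0 (Fin.last _)) (v) :
    π v (Sum.elim (leftPart k₁ k₂) (rightPart k₁ k₂) (partOf k₁ k₂ v)) := by
  by_cases hv : v.1 = 0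
  · have : v = 0 := Fin.ext hv
    subst this
    rw [partOf_zero, Sum.elim_inr, rightPart_last]
    exact h0
  · rw [partOf, if_neg hv]
    split_ifs with h
    · have : leftPart k₁ k₂ ⟨v - 1, by omega⟩ = v := Fin.ext (by simp [leftPart]; omega)
      rw [Sum.elim_inl, this]
    · have : rightPart k₁ k₂ ⟨v - (k₁ + 2), by omega⟩ = v :=
        Fin.ext (by simp [rightPart]; omega)
      rw [Sum.elim_inr, this]

/-- Since 0 is equivalent to the last vertex, each vertex has a representative in one of the two
arcs; without a crossing block, the traces on the arcs determine the partition. -/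
theorem eq_gluePart {π : Setoid (Fin (k₁ + k₂ + 2 + 1))} (h0 : π 0 (Fin.last _))
    (hcross : ∀ x y, ¬ π (leftPart k₁ k₂ x) (rightPart k₁ k₂ y)) :
    π = gluePart k₁ k₂ (π.comap (leftPart k₁ k₂)) (π.comap (rightPart k₁ k₂)) := by
  ext v w
  have hv := rel_of_partOf k₁ k₂ h0 v
  have hw := rel_of_partOf k₁ k₂ h0 w
  have : π v w ↔ π (Sum.elim (leftPart k₁ k₂) (rightPart k₁ k₂) (partOf k₁ k₂ v))
      (Sum.elim (leftPart k₁ k₂) (rightPart k₁ k₂) (partOf k₁ k₂ w)) :=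
    ⟨fun h => π.trans' (π.symm' hv) (π.trans' h hw),
      fun h => π.trans' hv (π.trans' h (π.symm' hw))⟩
  rw [this, gluePart, Setoid.ker_def, Function.comp, Function.comp]
  rcases partOf k₁ k₂ v with x | x <;> rcases partOf k₁ k₂ w with y | y
  · simp [Quotient.eq, Setoid.comap_rel]
  · simpa using hcross x y
  · simpa using fun h => hcross y x (π.symm' h)
  · simp [Quotient.eq, Setoid.comap_rel]

theorem gluePart_injective :
    Function.Injective fun π : Setoid (Fin (k₁ + 1)) × Setoid (Fin (k₂ + 1)) =>
      gluePart k₁ k₂ π.1 π.2 := by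
  rintro ⟨π₁, π₂⟩ ⟨π₁', π₂'⟩ h
  dsimp only at h
  refine Prod.ext (Setoid.ext fun x y => ?_) (Setoid.ext fun x y => ?_)
  · rw [← gluePart_left k₁ k₂ (π₁ := π₁) (π₂ := π₂), h, gluePart_left]
  · rw [← gluePart_right k₁ k₂ (π₁ := π₁) (π₂ := π₂), h, gluePart_right]

/-- The edges 0 and k₁ + 1 that join the arcs are not diagonal, hence impose no loop condition, and
every other edge lies inside one of the arcs. -/
theorem gluePart_mem_closings {x : ℕ → Bool × ℕ} (h0 : (x 0).1 = false)
    (h1 : (x (k₁ + 1)).1 = false) {π₁ π₂} (h₁ : π₁ 0 (Fin.last _)) (h₂ : π₂ 0 (Fin.last _)) :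
    gluePart k₁ k₂ π₁ π₂ ∈ closings (k₁ + k₂ + 2) x ↔
      π₁ ∈ closings k₁ (fun t => x (t + 1)) ∧ π₂ ∈ closings k₂ (fun t => x (t + (k₁ + 2))) := by
  constructor
  · rintro ⟨-, h⟩
    refine ⟨⟨h₁, fun t ht => ?_⟩, h₂, fun t ht => ?_⟩
    · rw [← gluePart_left k₁ k₂ (π₁ := π₁) (π₂ := π₂)]
      exact h ⟨t + 1, by omega⟩ ht
    · rw [← gluePart_right k₁ k₂ (π₁ := π₁) (π₂ := π₂)]
      have := h ⟨t + (k₁ + 2), by omega⟩ ht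
      rwa [show Fin.succ ⟨t + (k₁ + 2), by omega⟩ = rightPart k₁ k₂ t.succ from
        Fin.ext (by simp only [rightPart, Fin.succ_mk, Fin.val_succ]; omega)] at this
  · rintro ⟨⟨-, h⟩, -, h'⟩
    refine ⟨gluePart_zero_last k₁ k₂, fun t ht => ?_⟩
    by_cases ht0 : t.1 = 0
    · rw [ht0, h0] at ht; simp at ht
    by_cases ht1 : t.1 = k₁ + 1
    · rw [ht1, h1] at ht; simp at ht
    by_cases ht2 : t.1 < k₁ + 1
    · have := h ⟨t - 1, by omega⟩ (by
        have : t.1 - 1 + 1 = t := by omega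
        simpa only [this] using ht)
      rw [← gluePart_left k₁ k₂ (π₁ := π₁) (π₂ := π₂)] at this
      convert this using 1 <;> ext <;> simp [leftPart] <;> omega
    · have := h' ⟨t - (k₁ + 2), by omega⟩ (by
        have : t.1 - (k₁ + 2) + (k₁ + 2) = t := by omega
        simpa only [this] using ht)
      rw [← gluePart_right k₁ k₂ (π₁ := π₁) (π₂ := π₂)] at this
      convert this using 1 <;> ext <;> simp [rightPart] <;> omega

end Partitions

end Traffic

end

/-! ### Values of the injective trace on closed walks -/

noncomputable section

namespace Traffic

open TestGraph

namespace Piece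

/-- Suppressing two edges of a quotient of a path, left part. -/
def left {k₁ k₂ : ℕ} {i : ℕ → ℕ} {π : Setoid (Fin (k₁ + k₂ + 2 + 1))}
    (hcross : ∀ x y, ¬ π (leftPart k₁ k₂ x) (rightPart k₁ k₂ y))
    (hi1 : i (k₁ + 1) = i 0)
    (hi : ∀ r : Fin (k₁ + k₂ + 2), r.1 ≠ 0 → r.1 ≠ k₁ + 1 → i r ≠ i 0) :
    Piece (walkQuot k₁ (fun t => i (t + 1)) (π.comap (leftPart k₁ k₂)))
      (walkQuot (k₁ + k₂ + 2) i π) where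
  onV := Quotient.map (leftPart k₁ k₂) fun _ _ h => h
  onE := fun t : Fin k₁ => (⟨t + 1, by omega⟩ : Fin (k₁ + k₂ + 2))
  injV v w := by
    induction v using Quotient.inductionOn
    induction w using Quotient.inductionOn
    intro h
    exact Quotient.sound (Quotient.exact h : π _ _)
  injE t t' h := Fin.ext (by have := congrArg Fin.val h; simp at this; omega)
  src_eq _ := rfl
  tgt_eq _ := rfl
  star_eq _ := rfl
  var_iff _ _ := Iff.rfl
  saturated := by
    rintro (t : Fin k₁) (r : Fin (k₁ + k₂ + 2)) hv ht
    have hv : i (t + 1) = i r := hv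
    have ht0 : i (t + 1) ≠ i 0 := hi ⟨t + 1, by omega⟩ (by simp) (by simp; omega)
    by_cases hr0 : r.1 = 0
    · rw [hr0] at hv; exact absurd hv ht0
    by_cases hr1 : r.1 = k₁ + 1
    · rw [hr1, hi1] at hv; exact absurd hv ht0
    by_cases hr2 : r.1 < k₁ + 1
    · exact ⟨(⟨r - 1, by omega⟩ : Fin k₁), Fin.ext (by simp only []; omega)⟩
    -- Such an edge has both ends in the right arc, which no block connects to the left one.
    · exfalso
      have e₁ : r.castSucc = rightPart k₁ k₂ ⟨r - (k₁ + 2), by omega⟩ :=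
        Fin.ext (by simp [rightPart]; omega)
      have e₂ : r.succ = rightPart k₁ k₂ ⟨r - (k₁ + 2) + 1, by omega⟩ :=
        Fin.ext (by simp [rightPart]; omega)
      have key : ∀ x : Fin (k₁ + 1), ∀ w : Fin (k₁ + k₂ + 2 + 1), (w = r.castSucc ∨ w = r.succ) →
          (Quotient.mk π (leftPart k₁ k₂ x) : Quotient π) ≠ Quotient.mk π w := by
        rintro x w (rfl | rfl) hq
        · rw [e₁] at hq; exact hcross _ _ (Quotient.exact hq)
        · rw [e₂] at hq; exact hcross _ _ (Quotient.exact hq)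
      rcases ht with h | h | h | h
      · exact key t.castSucc _ (Or.inl rfl) h
      · exact key t.castSucc _ (Or.inr rfl) h
      · exact key t.succ _ (Or.inl rfl) h
      · exact key t.succ _ (Or.inr rfl) h

/-- Suppressing two edges of a quotient of a path, right part. -/
def right {k₁ k₂ : ℕ} {i : ℕ → ℕ} {π : Setoid (Fin (k₁ + k₂ + 2 + 1))}
    (hcross : ∀ x y, ¬ π (leftPart k₁ k₂ x) (rightPart k₁ k₂ y))
    (hi1 : i (k₁ + 1) = i 0)
    (hi : ∀ r : Fin (k₁ + k₂ + 2), r.1 ≠ 0 → r.1 ≠ k₁ + 1 → i r ≠ i 0) :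
    Piece (walkQuot k₂ (fun t => i (t + (k₁ + 2))) (π.comap (rightPart k₁ k₂)))
      (walkQuot (k₁ + k₂ + 2) i π) where
  onV := Quotient.map (rightPart k₁ k₂) fun _ _ h => h
  onE := fun t : Fin k₂ => (⟨t + (k₁ + 2), by omega⟩ : Fin (k₁ + k₂ + 2))
  injV v w := by
    induction v using Quotient.inductionOn
    induction w using Quotient.inductionOn
    intro h
    exact Quotient.sound (Quotient.exact h : π _ _)
  injE t t' h := Fin.ext (by have := congrArg Fin.val h; simp at this; omega)
  src_eq _ := rfl
  tgt_eq t := congrArg (Quotient.mk π) (Fin.ext (by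
    change Fin k₂ at t
    change t.1 + (k₁ + 2) + 1 = t.1 + 1 + (k₁ + 2)
    omega))
  star_eq _ := rfl
  var_iff _ _ := Iff.rfl
  saturated := by
    rintro (t : Fin k₂) (r : Fin (k₁ + k₂ + 2)) hv ht
    have hv : i (t + (k₁ + 2)) = i r := hv
    have ht0 : i (t + (k₁ + 2)) ≠ i 0 :=
      hi ⟨t + (k₁ + 2), by omega⟩ (by simp) (by simp only []; omega)
    by_cases hr0 : r.1 = 0
    · rw [hr0] at hv; exact absurd hv ht0
    by_cases hr1 : r.1 = k₁ + 1
    · rw [hr1, hi1] at hv; exact absurd hv ht0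
    by_cases hr2 : r.1 < k₁ + 1
    -- Here both ends lie in the left arc, and the absence of crossing blocks excludes a contact.
    · exfalso
      have e₁ : r.castSucc = leftPart k₁ k₂ ⟨r - 1, by omega⟩ :=
        Fin.ext (by simp [leftPart]; omega)
      have e₂ : r.succ = leftPart k₁ k₂ ⟨r, by omega⟩ :=
        Fin.ext (by simp [leftPart])
      have e₃ : Fin.succ (⟨t + (k₁ + 2), by omega⟩ : Fin (k₁ + k₂ + 2)) =
          rightPart k₁ k₂ t.succ :=
        Fin.ext (by simp only [rightPart, Fin.succ_mk, Fin.val_succ]; omega)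
      have key : ∀ x : Fin (k₂ + 1), ∀ w : Fin (k₁ + k₂ + 2 + 1), (w = r.castSucc ∨ w = r.succ) →
          (Quotient.mk π (rightPart k₁ k₂ x) : Quotient π) ≠ Quotient.mk π w := by
        rintro x w (rfl | rfl) hq
        · rw [e₁] at hq; exact hcross _ _ (Quotient.exact hq.symm)
        · rw [e₂] at hq; exact hcross _ _ (Quotient.exact hq.symm)
      rcases ht with h | h | h | h
      · exact key t.castSucc _ (Or.inl rfl) h
      · exact key t.castSucc _ (Or.inr rfl) h
      · exact key t.succ _ (Or.inl rfl) ((congrArg (Quotient.mk π) e₃.symm).trans h)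
      · exact key t.succ _ (Or.inr rfl) ((congrArg (Quotient.mk π) e₃.symm).trans h)
    · exact ⟨(⟨r - (k₁ + 2), by omega⟩ : Fin k₂), Fin.ext (by simp only []; omega)⟩

end Piece

namespace TrafficIID

variable {A : Type*} [Ring A] [StarRing A] [Algebra ℂ A] [StarModule ℂ A]
  {S : TrafficSpace A} {a : ℕ → A} (h : TrafficIID S a)

include h

/-- A cover by a single piece: pieces are insensitive to an injective change of colours. This leads
to bounds uniform in the colours. -/
theorem τ₀_walkQuot_congr {N : ℕ} {i i' : ℕ → ℕ} (π : Setoid (Fin (N + 1)))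
    (hi : ∀ r r' : Fin N, i r = i r' ↔ i' r = i' r') :
    S.τ₀ (walkQuot N i π) a = S.τ₀ (walkQuot N i' π) a := by
  let f : ∀ _ : Unit, Piece (walkQuot N i' π) (walkQuot N i π) := fun _ =>
    { onV := id
      onE := id
      injV := Function.injective_id
      injE := Function.injective_id
      src_eq := fun _ => rfl
      tgt_eq := fun _ => rfl
      star_eq := fun _ => rfl
      var_iff := fun e e' => hi e e'
      saturated := fun _ f _ _ => ⟨f, rfl⟩ }
  have hf : Piece.Cover f :=
    ⟨fun ⟨_, e⟩ ⟨_, e'⟩ hee => congrArg (Sigma.mk ()) hee, fun e => ⟨⟨(), e⟩, rfl⟩⟩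
  rw [h.τ₀_eq_prod_of_cover hf (by simp; rfl)]
  simp

/-- In a closed walk, the vertices up to `t` are linked to the start and the later ones to the end,
which is the same vertex. The other edges of the colour are loops, so the graph stays connected when
the colour is erased. -/
theorem τ₀_walkQuot_eq_zero {N : ℕ} {i : ℕ → ℕ} {π : Setoid (Fin (N + 1))}
    (h0 : π 0 (Fin.last N)) (t : Fin N) (hne : ¬ π t.castSucc t.succ)
    (hother : ∀ r : Fin N, r ≠ t → i r = i t → π r.castSucc r.succ) :
    S.τ₀ (walkQuot N i π) a = 0 := by
  refine h.τ₀_eq_zero_of_erase (T := walkQuot N i π) (c := i t) ?_ t rfl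
    fun heq => hne (Quotient.exact heq)
  set G := (walkQuot N i π).eraseGraph (i t)
  have hlow : ∀ v : Fin (N + 1), v.1 ≤ t → G.Linked (Quotient.mk π 0) (Quotient.mk π v) := by
    intro v hv
    have := linked_erase_walkQuot (N := N) (i := i) (π := π) (c := i t) 0 v (by omega)
      fun r _ hr => by
        by_cases hir : i r = i t
        · exact Or.inr (hother r (by rintro rfl; omega) hir)
        · exact Or.inl hir
    rwa [show (⟨0 + v, by omega⟩ : Fin (N + 1)) = v from Fin.ext (by simp)] at this
  have hhigh : ∀ v : Fin (N + 1), t.1 < v → G.Linked (Quotient.mk π 0) (Quotient.mk π v) := by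
    intro v hv
    have := linked_erase_walkQuot (N := N) (i := i) (π := π) (c := i t) v (N - v) (by omega)
      fun r hr _ => by
        by_cases hir : i r = i t
        · exact Or.inr (hother r (by rintro rfl; omega) hir)
        · exact Or.inl hir
    have e : (⟨v + (N - v), by omega⟩ : Fin (N + 1)) = Fin.last N := Fin.ext (by simp; omega)
    rw [e, ← (Quotient.sound h0 : (Quotient.mk π 0 : Quotient π) = _)] at this
    exact this.symm
  refine ⟨⟨Quotient.mk π 0⟩, fun v w => ?_⟩
  induction v using Quotient.inductionOn with | h v => ?_
  induction w using Quotient.inductionOn with | h w => ?_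
  have hall : ∀ v : Fin (N + 1), G.Linked (Quotient.mk π 0) (Quotient.mk π v) := fun v =>
    (le_or_gt v.1 t).elim (hlow v) (hhigh v)
  exact .trans _ _ _ (.symm _ _ (hall v)) (hall w)

theorem τ₀_walkQuot_of_singleton (hmean : S.τ₀ loop (fun _ => a 0) = 0) {N : ℕ} {i : ℕ → ℕ}
    {π : Setoid (Fin (N + 1))} (h0 : π 0 (Fin.last N)) (t : Fin N)
    (huniq : ∀ r : Fin N, i r = i t → r = t) : S.τ₀ (walkQuot N i π) a = 0 := by
  by_cases ht : π t.castSucc t.succ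
  · exact h.τ₀_eq_zero_of_loop (T := walkQuot N i π) t (Quotient.sound ht) rfl huniq hmean
  · exact h.τ₀_walkQuot_eq_zero h0 t ht fun r hr hir => absurd (huniq r hir) hr

section Cut

variable {k₁ k₂ : ℕ} {i : ℕ → ℕ} {π : Setoid (Fin (k₁ + k₂ + 2 + 1))}
  (h0 : π 0 (Fin.last _)) (hi1 : i (k₁ + 1) = i 0)
  (hi : ∀ r : Fin (k₁ + k₂ + 2), r.1 ≠ 0 → r.1 ≠ k₁ + 1 → i r ≠ i 0)

include h0 hi1 hi

omit hi1 in
-- Without the first colour each arc remains linked, and the crossing block links the arcs; the edge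
-- 0, which is not a loop, is then superfluous for connectedness.
theorem τ₀_walkQuot_of_cross (h1 : ¬ π 0 1) {x y}
    (hxy : π (leftPart k₁ k₂ x) (rightPart k₁ k₂ y)) :
    S.τ₀ (walkQuot (k₁ + k₂ + 2) i π) a = 0 := by
  refine h.τ₀_eq_zero_of_erase (T := walkQuot (k₁ + k₂ + 2) i π) (c := i 0) ?_
    (0 : Fin (k₁ + k₂ + 2)) rfl fun heq => h1 (Quotient.exact heq)
  set G := (walkQuot (k₁ + k₂ + 2) i π).eraseGraph (i 0)
  have hleft : ∀ v, G.Linked (Quotient.mk π (leftPart k₁ k₂ 0))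
      (Quotient.mk π (leftPart k₁ k₂ v)) := by
    intro v
    have := linked_erase_walkQuot (N := k₁ + k₂ + 2) (i := i) (π := π) (c := i 0) 1 v (by omega)
      fun r _ hr => Or.inl (hi r (by omega) (by omega))
    rwa [show (⟨1 + v, by omega⟩ : Fin (k₁ + k₂ + 2 + 1)) = leftPart k₁ k₂ v from
      Fin.ext (Nat.add_comm _ _)] at this
  have hright : ∀ v, G.Linked (Quotient.mk π (rightPart k₁ k₂ 0))
      (Quotient.mk π (rightPart k₁ k₂ v)) := by
    intro v
    have := linked_erase_walkQuot (N := k₁ + k₂ + 2) (i := i) (π := π) (c := i 0) (k₁ + 2) v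
      (by omega) fun r _ hr => Or.inl (hi r (by omega) (by omega))
    rwa [show (⟨k₁ + 2 + v, by omega⟩ : Fin (k₁ + k₂ + 2 + 1)) = rightPart k₁ k₂ v from
      Fin.ext (Nat.add_comm _ _), show (⟨k₁ + 2, by omega⟩ : Fin (k₁ + k₂ + 2 + 1)) =
      rightPart k₁ k₂ 0 from Fin.ext (by simp [rightPart])] at this
  have hlr : G.Linked (Quotient.mk π (leftPart k₁ k₂ 0)) (Quotient.mk π (rightPart k₁ k₂ 0)) := by
    refine .trans _ _ _ (hleft x) ?_
    rw [(Quotient.sound hxy : (Quotient.mk π (leftPart k₁ k₂ x) : Quotient π) = _)]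
    exact .symm _ _ (hright y)
  have hall : ∀ v, G.Linked (Quotient.mk π (leftPart k₁ k₂ 0)) (Quotient.mk π v) := by
    intro v
    rw [(Quotient.sound (rel_of_partOf k₁ k₂ h0 v) : (Quotient.mk π v : Quotient π) = _)]
    rcases partOf k₁ k₂ v with v | v
    · exact hleft v
    · exact .trans _ _ _ hlr (hright v)
  refine ⟨⟨Quotient.mk π 0⟩, fun v w => ?_⟩
  induction v using Quotient.inductionOn with | h v => ?_
  induction w using Quotient.inductionOn with | h w => ?_
  exact .trans _ _ _ (.symm _ _ (hall v)) (hall w)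

variable (hcross : ∀ x y, ¬ π (leftPart k₁ k₂ x) (rightPart k₁ k₂ y))

include hcross

omit h in
theorem bijective_onV : Function.Bijective
    (Sum.elim (Piece.left hcross hi1 hi).onV (Piece.right hcross hi1 hi).onV) := by
  constructor
  · rintro (v | v) (w | w) hvw
    · exact congrArg Sum.inl ((Piece.left hcross hi1 hi).injV hvw)
    · induction v using Quotient.inductionOn
      induction w using Quotient.inductionOn
      exact absurd (Quotient.exact hvw) (hcross _ _)
    · induction v using Quotient.inductionOn
      induction w using Quotient.inductionOn
      exact absurd (Quotient.exact hvw.symm) (hcross _ _)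
    · exact congrArg Sum.inr ((Piece.right hcross hi1 hi).injV hvw)
  · intro v
    induction v using Quotient.inductionOn with | h v => ?_
    have := rel_of_partOf k₁ k₂ h0 v
    generalize partOf k₁ k₂ v = w at this
    rcases w with w | w
    · exact ⟨Sum.inl (Quotient.mk _ w), (Quotient.sound (s := π) this).symm⟩
    · exact ⟨Sum.inr (Quotient.mk _ w), (Quotient.sound (s := π) this).symm⟩

omit h h0 in
theorem exists_onE (e : Fin (k₁ + k₂ + 2)) : i e ≠ i 0 ↔
    (∃ e', (Piece.left hcross hi1 hi).onE e' = e) ∨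
      ∃ e', (Piece.right hcross hi1 hi).onE e' = e := by
  constructor
  · intro he
    have h0' : e.1 ≠ 0 := fun h => he (by rw [h])
    have h1' : e.1 ≠ k₁ + 1 := fun h => he (by rw [h, hi1])
    by_cases h2 : e.1 < k₁ + 1
    · exact Or.inl ⟨(⟨e - 1, by omega⟩ : Fin k₁), Fin.ext (by simp only [Piece.left]; omega)⟩
    · exact Or.inr ⟨(⟨e - (k₁ + 2), by omega⟩ : Fin k₂),
        Fin.ext (by simp only [Piece.right]; omega)⟩
  · rintro (⟨e', rfl⟩ | ⟨e', rfl⟩)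
    · change Fin k₁ at e'
      exact hi ⟨e' + 1, by omega⟩ (by simp) (by simp; omega)
    · change Fin k₂ at e'
      exact hi ⟨e' + (k₁ + 2), by omega⟩ (by simp) (by simp only []; omega)

omit h h0 in
theorem left_onE_ne_right_onE (e e') :
    (Piece.left hcross hi1 hi).onE e ≠ (Piece.right hcross hi1 hi).onE e' := by
  change Fin k₁ at e
  change Fin k₂ at e'
  intro heq
  have : e.1 + 1 = e'.1 + (k₁ + 2) := congrArg Fin.val heq
  omega

/-- The edge 0 goes from the end of the right arc to the start of the left arc, and the edge k₁ + 1
from the end of the left arc to the start of the right arc. They share both ends exactly when the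
two arcs are closed. -/
theorem τ₀_walkQuot_of_not_closed
    (hnot : ¬ ((π.comap (leftPart k₁ k₂)) 0 (Fin.last _) ∧
      (π.comap (rightPart k₁ k₂)) 0 (Fin.last _))) :
    S.τ₀ (walkQuot (k₁ + k₂ + 2) i π) a = 0 := by
  refine h.τ₀_eq_zero_of_cut (T := walkQuot (k₁ + k₂ + 2) i π) (0 : Fin (k₁ + k₂ + 2))
    (⟨k₁ + 1, by omega⟩ : Fin (k₁ + k₂ + 2)) hi1 (Piece.left hcross hi1 hi)
    (Piece.right hcross hi1 hi) (bijective_onV h0 hi1 hi hcross) (exists_onE hi1 hi hcross)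
    (left_onE_ne_right_onE hi1 hi hcross) (s₀ := Quotient.mk _ (Fin.last k₂))
     (t₁ := Quotient.mk _ (0 : Fin (k₂ + 1)))
    (t₀ := Quotient.mk _ (0 : Fin (k₁ + 1))) (s₁ := Quotient.mk _ (Fin.last k₁))
    ?_ ?_ ?_ ?_ ?_
  -- The source of the edge 0 is the vertex 0, identified with the last vertex, hence with the end
  -- of the right arc.
  · refine Quotient.sound (s := π) ?_
    rw [rightPart_last]
    exact h0
  · rfl
  · rfl
  · exact congrArg (Quotient.mk π) (Fin.ext (by simp [rightPart, walk]))
  · rintro ⟨h₁, h₂⟩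
    exact hnot ⟨Quotient.exact h₁, Setoid.symm' _ (Quotient.exact h₂)⟩

theorem τ₀_walkQuot_of_closed (h₁ : (π.comap (leftPart k₁ k₂)) 0 (Fin.last _))
    (h₂ : (π.comap (rightPart k₁ k₂)) 0 (Fin.last _)) :
    S.τ₀ (walkQuot (k₁ + k₂ + 2) i π) a = S.τ₀ doubleArrow (fun _ => a 0) *
      (S.τ₀ (walkQuot k₁ (fun t => i (t + 1)) (π.comap (leftPart k₁ k₂))) a *
      S.τ₀ (walkQuot k₂ (fun t => i (t + (k₁ + 2))) (π.comap (rightPart k₁ k₂))) a) := by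
  refine h.τ₀_eq_mul_of_cut (T := walkQuot (k₁ + k₂ + 2) i π) (0 : Fin (k₁ + k₂ + 2))
    (⟨k₁ + 1, by omega⟩ : Fin (k₁ + k₂ + 2)) hi1 (Piece.left hcross hi1 hi)
    (Piece.right hcross hi1 hi) (bijective_onV h0 hi1 hi hcross) (exists_onE hi1 hi hcross)
    (left_onE_ne_right_onE hi1 hi hcross) (s₀ := Quotient.mk _ (Fin.last k₂))
     (t₁ := Quotient.mk _ (0 : Fin (k₂ + 1)))
    (t₀ := Quotient.mk _ (0 : Fin (k₁ + 1))) (s₁ := Quotient.mk _ (Fin.last k₁))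
    ?_ ?_ ?_ ?_ ?_ (fun _ => rfl) ?_ ?_
  · refine Quotient.sound (s := π) ?_
    rw [rightPart_last]
    exact h0
  · rfl
  · rfl
  · exact congrArg (Quotient.mk π) (Fin.ext (by simp [rightPart, walk]))
  · intro (e : Fin (k₁ + k₂ + 2)) he
    by_contra hcon
    push Not at hcon
    exact hi e (fun h => hcon.1 (Fin.ext h)) (fun h => hcon.2 (Fin.ext h)) he
  · exact Quotient.sound h₁
  · exact (Quotient.sound h₂).symm

end Cut

/-- All edges are loops at one vertex, so the two loops of the first colour factor out; the new
sequence of colours skips the positions 0 and m + 1. -/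
theorem τ₀_walkQuot_top {N : ℕ} {i : ℕ → ℕ} (m : ℕ) (hm : m < N + 1) (hi1 : i (m + 1) = i 0)
    (hi : ∀ r : Fin (N + 2), r.1 ≠ 0 → r.1 ≠ m + 1 → i r ≠ i 0) :
    S.τ₀ (walkQuot (N + 2) i ⊤) a = S.τ₀ doubleLoop (fun _ => a 0) *
      S.τ₀ (walkQuot N (fun t => if t < m then i (t + 1) else i (t + 2)) ⊤) a := by
  have sub : ∀ N i, Subsingleton (walkQuot N i ⊤).V := fun N i => ⟨fun v w => by
    induction v using Quotient.inductionOn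
    induction w using Quotient.inductionOn
    exact Quotient.sound trivial⟩
  have := sub (N + 2) i
  have := sub N (fun t => if t < m then i (t + 1) else i (t + 2))
  let f : Piece (walkQuot N (fun t => if t < m then i (t + 1) else i (t + 2)) ⊤)
      (walkQuot (N + 2) i ⊤) :=
    { onV := fun _ => Quotient.mk _ (0 : Fin (N + 3))
      onE := fun t : Fin N => (⟨if t.1 < m then t.1 + 1 else t.1 + 2, by split_ifs <;> omega⟩ :
        Fin (N + 2))
      injV := fun _ _ _ => Subsingleton.elim _ _
      injE := fun t t' htt => Fin.ext (by
        change Fin N at t t'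
        have htt := congrArg Fin.val htt
        dsimp only at htt
        split_ifs at htt <;> omega)
      src_eq := fun _ => Subsingleton.elim _ _
      tgt_eq := fun _ => Subsingleton.elim _ _
      star_eq := fun _ => rfl
      var_iff := by
        rintro (e : Fin N) (e' : Fin N)
        dsimp [walkQuot, walk, TestGraph.quot, StarGraph.quot]
        split_ifs <;> rfl
      saturated := by
        rintro (e : Fin N) (r : Fin (N + 2)) hv -
        have hne : i (if e.1 < m then e.1 + 1 else e.1 + 2) ≠ i 0 :=
          hi ⟨if e.1 < m then e.1 + 1 else e.1 + 2, by split_ifs <;> omega⟩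
            (by simp only []; split_ifs <;> omega) (by simp only []; split_ifs <;> omega)
        have hv : i (if e.1 < m then e.1 + 1 else e.1 + 2) = i r := hv
        rw [hv] at hne
        have hr0 : r.1 ≠ 0 := fun hr => hne (by rw [hr])
        have hr1 : r.1 ≠ m + 1 := fun hr => hne (by rw [hr, hi1])
        by_cases hr : r.1 < m + 1
        · exact ⟨(⟨r - 1, by omega⟩ : Fin N), Fin.ext (by
            simp only []; rw [if_pos (by omega)]; omega)⟩
        · exact ⟨(⟨r - 2, by omega⟩ : Fin N), Fin.ext (by
            simp only []; rw [if_neg (by omega)]; omega)⟩ }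
  refine h.τ₀_eq_mul_of_subsingleton (T := walkQuot (N + 2) i ⊤) (fun _ => rfl)
    (0 : Fin (N + 2)) (⟨m + 1, by omega⟩ : Fin (N + 2)) ?_ hi1 ?_ f ?_
  · intro heq
    have := congrArg Fin.val heq
    simp at this
  · intro (e : Fin (N + 2)) he
    by_contra hcon
    push Not at hcon
    exact hi e (fun h => hcon.1 (Fin.ext h)) (fun h => hcon.2 (Fin.ext h)) he
  · intro (r : Fin (N + 2))
    constructor
    · rintro ⟨(e : Fin N), rfl⟩
      constructor <;> intro heq <;> have heq := congrArg Fin.val heq <;>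
        simp only [f, Fin.val_zero] at heq <;> split_ifs at heq <;> omega
    · rintro ⟨h0, h1⟩
      have hr0 : r.1 ≠ 0 := fun hr => h0 (Fin.ext hr)
      have hr1 : r.1 ≠ m + 1 := fun hr => h1 (Fin.ext hr)
      by_cases hr : r.1 < m + 1
      · exact ⟨(⟨r - 1, by omega⟩ : Fin N), Fin.ext (by
          simp only [f]; rw [if_pos (by omega)]; omega)⟩
      · exact ⟨(⟨r - 2, by omega⟩ : Fin N), Fin.ext (by
          simp only [f]; rw [if_neg (by omega)]; omega)⟩

end TrafficIID

end Traffic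

end

/-! ### Words in the variables and their diagonal parts as graph evaluations -/

noncomputable section

namespace Traffic

open TestGraph

namespace TestGraph

/-- A quotient of a quotient is a quotient. -/
def quotQuotIso {J : Type} (T : TestGraph J) (ρ : Setoid T.V) (κ : Setoid (Quotient ρ)) :
    ((T.quot ρ).quot κ).toStarGraph.Iso (T.quot (κ.comap (Quotient.mk ρ))).toStarGraph where
  onV := (Equiv.ofBijective
    (Quotient.map (sa := κ.comap (Quotient.mk ρ)) (sb := κ) (Quotient.mk ρ) fun _ _ h => h) ⟨by
      intro v w
      induction v using Quotient.inductionOn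
      induction w using Quotient.inductionOn
      intro h
      exact Quotient.sound (Quotient.exact h : κ _ _), by
      intro v
      induction v using Quotient.inductionOn with | h v => ?_
      induction v using Quotient.inductionOn with | h v => ?_
      exact ⟨Quotient.mk _ v, rfl⟩⟩).symm
  onE := Equiv.refl _
  src_eq e := (Equiv.eq_symm_apply _).2 rfl
  tgt_eq e := (Equiv.eq_symm_apply _).2 rfl
  var_eq _ := rfl
  star_eq _ := rfl

end TestGraph

namespace GraphMonomial

section Plain

variable {J K : Type} {V E : Type} [Finite V] [Finite E] (src tgt : E → V) (var : E → J)

/-- A graph whose labels have no star. -/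
abbrev plainGraph : StarGraph J :=
  ⟨V, E, inferInstance, inferInstance, src, tgt, var, fun _ => false⟩

variable (conn : (plainGraph src tgt var).Connected) (inp out : V)

/-- A graph monomial whose labels have no star. -/
abbrev plain : GraphMonomial J := ⟨⟨plainGraph src tgt var, conn⟩, inp, out⟩

/-- A graph with one edge, from `inp` to `out`, whose ends may be identified. -/
def edge (k : K) (b : Bool) (σ : Setoid (Fin 2)) : GraphMonomial K where
  toTestGraph := (path [(k, b)]).toTestGraph.quot σ
  inp := Quotient.mk σ 0
  out := Quotient.mk σ 1

/-- The partition identifying the ends of the edges of a set of labels. -/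
def glueEnds (loopy : J → Prop) : Setoid V :=
  Relation.EqvGen.setoid fun v w => ∃ e, loopy (var e) ∧ src e = v ∧ tgt e = w

omit [Finite V] [Finite E] in
theorem glueEnds_le_iff (loopy : J → Prop) (π : Setoid V) :
    glueEnds src tgt var loopy ≤ π ↔ ∀ e, loopy (var e) → π (src e) (tgt e) := by
  constructor
  · intro h e he
    exact h (.rel _ _ ⟨e, he, rfl, rfl⟩)
  · intro h v w hvw
    have hvw' : Relation.EqvGen _ v w := hvw
    clear hvw
    induction hvw' with
    | rel _ _ h' => obtain ⟨e, he, rfl, rfl⟩ := h'; exact h e he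
    | refl => exact π.refl' _
    | symm _ _ _ ih => exact π.symm' ih
    | trans _ _ _ _ _ ih ih' => exact π.trans' ih ih'

/-- The result of the substitution of graphs with one edge. -/
def relabel (v : J → K) (b : J → Bool) (loopy : J → Prop) : GraphMonomial K where
  V := Quotient (glueEnds src tgt var loopy)
  E := E
  finV := inferInstance
  finE := inferInstance
  src e := Quotient.mk _ (src e)
  tgt e := Quotient.mk _ (tgt e)
  var e := v (var e)
  star e := b (var e)
  connected := ⟨conn.1.map (Quotient.mk _), fun x y => by
    induction x using Quotient.inductionOn
    induction y using Quotient.inductionOn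
    exact (conn.2 _ _).map (T := plainGraph src tgt var)
      (T' := ⟨Quotient (glueEnds src tgt var loopy), E, inferInstance,
      inferInstance, fun e => Quotient.mk _ (src e), fun e => Quotient.mk _ (tgt e),
      fun e => v (var e), fun e => b (var e)⟩) (Quotient.mk _) fun e => .rel _ _ ⟨e, rfl, rfl⟩⟩
  inp := Quotient.mk _ inp
  out := Quotient.mk _ out

/-- Substitution of graphs with one edge. -/
def relabelIso (v : J → K) (b : J → Bool) (σ : J → Setoid (Fin 2)) :
    (relabel src tgt var conn inp out v b fun j => σ j 0 1).Iso
      ((plain src tgt var conn inp out).subst fun j => edge (v j) (b j) (σ j)) :=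
  let t := plain src tgt var conn inp out
  let s := fun j => edge (v j) (b j) (σ j)
  let ρ := glueEnds src tgt var fun j => σ j 0 1
  let q : (preSubst t s).V → Quotient (Relation.EqvGen.setoid (SubstGlue t s)) := Quotient.mk _
  have hsrc : ∀ e : E, q (Sum.inl (src e)) = q (Sum.inr ⟨e, Quotient.mk (σ (var e)) 0⟩) := fun e =>
    Quotient.sound (.rel _ _ (SubstGlue.source (t := t) (s := s) e))
  have htgt : ∀ e : E, q (Sum.inl (tgt e)) = q (Sum.inr ⟨e, Quotient.mk (σ (var e)) 1⟩) := fun e =>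
    Quotient.sound (.rel _ _ (SubstGlue.target (t := t) (s := s) e))
  { onV := Equiv.ofBijective
      (Quotient.lift (s := ρ) (fun x : V => q (Sum.inl x)) (by
        intro x y h
        have h' : Relation.EqvGen _ x y := h
        clear h
        induction h' with
        | rel x y h =>
          obtain ⟨e, he, rfl, rfl⟩ := h
          rw [hsrc, htgt, (Quotient.sound he : (Quotient.mk (σ (var e)) 0) = _)]
        | refl => rfl
        | symm _ _ _ ih => exact ih.symm
        | trans _ _ _ _ _ ih ih' => exact ih.trans ih'))
      ⟨by
        -- The map backwards, which sends the ends 0 and 1 of the copy attached to an edge to the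
        -- source and the target of that edge. It respects `σ`, since `ρ` glues the ends wherever
        -- `σ` does.
        let g : (preSubst t s).V → Quotient ρ := Sum.elim (Quotient.mk ρ) fun z =>
          Quotient.lift (s := σ (var z.1))
            (fun i : Fin 2 => Quotient.mk ρ (if i = 0 then src z.1 else tgt z.1)) (by
              intro i j hij
              have h01 : ∀ h : σ (var z.1) 0 1, Quotient.mk ρ (src z.1) = Quotient.mk ρ (tgt z.1) :=
                fun h => Quotient.sound (.rel _ _ ⟨z.1, h, rfl, rfl⟩)
              fin_cases i <;> fin_cases j
              · rfl
              · exact h01 hij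
              · exact (h01 (Setoid.symm' _ hij)).symm
              · rfl) z.2
        have hg : ∀ x y, Relation.EqvGen (SubstGlue t s) x y → g x = g y := by
          intro x y h
          induction h with
          | rel x y h => cases h <;> rfl
          | refl => rfl
          | symm _ _ _ ih => exact ih.symm
          | trans _ _ _ _ _ ih ih' => exact ih.trans ih'
        intro x y
        induction x using Quotient.inductionOn
        induction y using Quotient.inductionOn
        intro h
        exact hg _ _ (Quotient.exact h), by
        intro z
        induction z using Quotient.inductionOn with | h z => ?_
        rcases z with x | ⟨e, z⟩
        · exact ⟨Quotient.mk _ x, rfl⟩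
        · change Quotient (σ (var e)) at z
          induction z using Quotient.inductionOn with | h i => ?_
          change Fin 2 at i
          fin_cases i
          · exact ⟨Quotient.mk _ (src e), hsrc e⟩
          · exact ⟨Quotient.mk _ (tgt e), htgt e⟩⟩
    onE := Equiv.ofBijective (fun e : E => (⟨e, (0 : Fin 1)⟩ : Σ _ : E, Fin 1))
      ⟨fun e e' h => congrArg Sigma.fst h, fun ⟨e, i⟩ => ⟨e, congrArg (Sigma.mk e)
        (Subsingleton.elim (0 : Fin 1) i :)⟩⟩
    src_eq := fun e => (hsrc e).symm
    tgt_eq := fun e => (htgt e).symm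
    var_eq := fun _ => rfl
    star_eq := fun _ => rfl
    inp_eq := rfl
    out_eq := rfl }

end Plain

end GraphMonomial

open GraphMonomial

namespace TrafficSpace

variable {A : Type*} [Ring A] [StarRing A] [Algebra ℂ A] [StarModule ℂ A] (S : TrafficSpace A)

/-- The diagonal part of an element: the evaluation of a loop. -/
def diag (x : A) : A := S.ev (loop.rooted ()) fun _ => x

theorem ev_edge_bot {K : Type} (k : K) (b : Bool) (a : K → A) :
    S.ev (edge k b ⊥) a = starPow (a k) b := by
  have : S.ev (path [(k, b)]) a = starPow (a k) b := by
    rw [S.ev_path]; simp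
  rw [← this]
  refine (S.ev_iso (path [(k, b)]) (edge k b ⊥) ?_ a).symm
  exact
    { onV := Equiv.ofBijective (Quotient.mk ⊥)
        ⟨fun _ _ h => Quotient.exact h, Quotient.mk_surjective⟩
      onE := Equiv.refl _
      src_eq := fun _ => rfl
      tgt_eq := fun _ => rfl
      var_eq := fun _ => rfl
      star_eq := fun _ => rfl
      inp_eq := rfl
      out_eq := rfl }

theorem ev_edge_top {K : Type} (k : K) (a : K → A) :
    S.ev (edge k false ⊤) a = S.diag (a k) := by
  have : S.diag (a k) = S.ev ((loop.rooted ()).rename fun _ => k) a := by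
    rw [S.ev_rename]; rfl
  rw [this]
  have u : ∀ x y : Quotient (⊤ : Setoid (Fin 2)), x = y := fun x y => by
    induction x using Quotient.inductionOn
    induction y using Quotient.inductionOn
    exact Quotient.sound trivial
  exact S.ev_iso _ _
    { onV := ⟨fun _ => (), fun _ => Quotient.mk _ (0 : Fin 2), fun _ => u _ _, fun _ => rfl⟩
      onE := Equiv.ofUnique (Fin 1) Unit
      src_eq := fun _ => rfl
      tgt_eq := fun _ => rfl
      var_eq := fun e => by
        change Fin 1 at e
        rw [Subsingleton.elim e 0]; rfl
      star_eq := fun e => by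
        change Fin 1 at e
        rw [Subsingleton.elim e 0]; rfl
      inp_eq := rfl
      out_eq := rfl } a

/-- Substituting an edge with separate or merged ends for each variable handles letters, adjoints
and diagonal parts at once. -/
theorem ev_relabel {J K : Type} {V E : Type} [Finite V] [Finite E] (src tgt : E → V) (var : E → J)
    (conn : (plainGraph src tgt var).Connected) (inp out : V) (v : J → K) (b : J → Bool)
    (σ : J → Setoid (Fin 2)) (a : K → A) :
    S.ev (relabel src tgt var conn inp out v b fun j => σ j 0 1) a =
      S.ev (plain src tgt var conn inp out) fun j => S.ev (edge (v j) (b j) (σ j)) a := by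
  rw [S.ev_iso _ _ (relabelIso src tgt var conn inp out v b σ), S.ev_subst]

/-- Reversing a loop leaves its shape unchanged, so taking the adjoint only stars the label. This
makes the diagonal part of a self-adjoint element self-adjoint, as needed for positivity. -/
theorem star_diag (x : A) : star (S.diag x) = S.diag (star x) := by
  have h := S.ev_relabel (J := Unit) (fun _ : Unit => ()) (fun _ : Unit => ()) (fun _ => ())
    loop.connected () () (fun _ => ()) (fun _ => true) (fun _ => ⊥) (fun _ => x)
  simp only [S.ev_edge_bot, starPow] at h
  have h₂ : S.diag (star x) = S.ev (plain (fun _ : Unit => ()) (fun _ : Unit => ()) (fun _ => ())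
    loop.connected () ()) (fun _ : Unit => star x) := rfl
  rw [h₂, ← h, diag, ← S.ev_adjoint]
  refine S.ev_iso _ _ ?_ _
  exact
    { onV := Equiv.ofBijective (fun _ => Quotient.mk _ ()) ⟨fun _ _ _ => rfl, fun x => by
        induction x using Quotient.inductionOn; exact ⟨(), rfl⟩⟩
      onE := Equiv.refl _
      src_eq := fun _ => rfl
      tgt_eq := fun _ => rfl
      var_eq := fun _ => rfl
      star_eq := fun _ => rfl
      inp_eq := rfl
      out_eq := rfl }

/-- Partitions of the quotient by `ρ` correspond to the partitions of the vertices of `T` coarser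
than `ρ`. -/
theorem τ_quot_eq_sum {J : Type} (T : TestGraph J) {ρ : Setoid T.V} (a : J → A)
    [Fintype (Setoid T.V)] : S.τ (T.quot ρ) a =
      open Classical in ∑ π : Setoid T.V, if ρ ≤ π then S.τ₀ (T.quot π) a else 0 := by
  classical
  have : Fintype (Setoid (Quotient ρ)) := Fintype.ofFinite _
  rw [S.τ_eq_sum]
  change ∑ᶠ κ : Setoid (Quotient ρ), S.τ₀ ((T.quot ρ).quot κ) a = _
  rw [finsum_eq_sum_of_fintype]
  refine Fintype.sum_of_injective
    (fun κ : Setoid (Quotient ρ) => κ.comap (Quotient.mk ρ)) ?_ _ _ ?_ ?_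
  · intro κ κ' h
    ext x y
    induction x using Quotient.inductionOn with | h x => ?_
    induction y using Quotient.inductionOn with | h y => ?_
    have := congrArg (fun π : Setoid T.V => π x y) h
    exact iff_of_eq this
  · intro π hπ
    rw [if_neg]
    intro hle
    refine hπ ⟨Setoid.correspondence ρ ⟨π, hle⟩, ?_⟩
    ext x y
    exact Iff.rfl
  · intro κ
    rw [if_pos, S.τ₀_iso _ _ (T.quotQuotIso ρ κ)]
    intro x y hxy
    rw [Setoid.comap_rel, (Quotient.sound hxy : Quotient.mk ρ x = _)]

/-- A letter of a word: `(false, i)` stands for `a i` and `(true, i)` for its diagonal part. -/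
def letter (a : ℕ → A) (x : Bool × ℕ) : A := bif x.1 then S.diag (a x.2) else a x.2

/-- The product of the first `N` letters. -/
def word (a : ℕ → A) (N : ℕ) (x : ℕ → Bool × ℕ) : A :=
  (List.ofFn fun t : Fin N => S.letter a (x t)).prod

theorem ev_plain_path {N : ℕ} (conn) (y : Fin N → A) :
    S.ev (plain (Fin.castSucc (n := N)) Fin.succ id conn 0 (Fin.last N)) y =
      (List.ofFn y).prod := by
  have hp := S.ev_path (List.ofFn fun j : Fin N => (j, false)) y
  rw [List.map_ofFn] at hp
  have hy : (List.ofFn ((fun x : Fin N × Bool => starPow (y x.1) x.2) ∘ fun j => (j, false))) =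
    List.ofFn y := rfl
  rw [hy] at hp
  rw [← hp]
  have hl : (List.ofFn fun j : Fin N => (j, false)).length = N := List.length_ofFn
  refine S.ev_iso _ _ ?_ _
  exact
    { onV := finCongr (by rw [hl])
      onE := finCongr hl.symm
      src_eq := fun e => rfl
      tgt_eq := fun e => rfl
      var_eq := fun e => by simp [path]; rfl
      star_eq := fun e => by simp [path]
      inp_eq := Fin.ext (by simp [path]; rfl)
      out_eq := Fin.ext (by simp [path]; rfl) }

/-- The word is a path whose diagonal edges have merged ends, and the state merges input and output.
The two identifications make one quotient of the path, and the partitions coarser than it are the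
`closings`. -/
theorem Φ_word (a : ℕ → A) (N : ℕ) (x : ℕ → Bool × ℕ) : S.Φ (S.word a N x) =
    open Classical in ∑ π : Setoid (Fin (N + 1)), if π ∈ closings N x then
      S.τ₀ (walkQuot N (fun t => (x t).2) π) a else 0 := by
  classical
  have conn : (plainGraph (Fin.castSucc (n := N)) Fin.succ id).Connected :=
    ⟨⟨0⟩, fun v w => ((walk N id).connected.2 v w).map (T := (walk N id).toStarGraph)
      (T' := plainGraph (Fin.castSucc (n := N)) Fin.succ id) id fun e => .rel _ _ ⟨e, rfl, rfl⟩⟩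
  have h := S.ev_relabel (Fin.castSucc (n := N)) Fin.succ id conn 0 (Fin.last N)
    (fun j => (x j).2) (fun _ => false) (fun j => if (x j).1 then ⊤ else ⊥) a
  rw [S.ev_plain_path] at h
  have hw : S.word a N x = (List.ofFn fun j : Fin N =>
      S.ev (edge (x j).2 false (if (x j).1 then ⊤ else ⊥)) a).prod := by
    unfold word
    congr 2
    funext j
    rcases hj : (x j).1 with _ | _
    · simp [letter, hj, S.ev_edge_bot, starPow]
    · simp [letter, hj, S.ev_edge_top]
  rw [hw, ← h, S.state_ev]
  set loopy : Fin N → Prop := fun j => (if (x j).1 then ⊤ else ⊥ : Setoid (Fin 2)) 0 1 with hloopy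
  have hl : ∀ j, loopy j ↔ (x j).1 = true := fun j => by
    have hσ : ∀ b : Bool, (if b then ⊤ else ⊥ : Setoid (Fin 2)) 0 1 ↔ b = true := by
      rintro (_ | _)
      · exact ⟨fun h => absurd (h : (0 : Fin 2) = 1) zero_ne_one, fun h => by simp at h⟩
      · exact ⟨fun _ => rfl, fun _ => trivial⟩
    exact hσ _
  let ρ := glueEnds (Fin.castSucc (n := N)) Fin.succ id loopy
  let κ : Setoid (Quotient ρ) := Relation.EqvGen.setoid fun v w =>
    v = Quotient.mk ρ 0 ∧ w = Quotient.mk ρ (Fin.last N)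
  have hτ : S.τ (relabel (Fin.castSucc (n := N)) Fin.succ id conn 0 (Fin.last N)
      (fun j => (x j).2) (fun _ => false) loopy).close a =
      S.τ ((walk N fun t => (x t).2).quot (κ.comap (Quotient.mk ρ))) a :=
    S.τ_iso _ _ ((walk N fun t => (x t).2).quotQuotIso ρ κ) a
  refine hτ.trans ?_
  let _ : Fintype (Setoid (walk N fun t => (x t).2).V) :=
    inferInstanceAs (Fintype (Setoid (Fin (N + 1))))
  rw [S.τ_quot_eq_sum]
  refine Fintype.sum_equiv (Equiv.refl _) _ _ fun π => ?_
  have hmem : κ.comap (Quotient.mk ρ) ≤ π ↔ π ∈ closings N x := by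
    change Setoid (Fin (N + 1)) at π
    constructor
    · intro hle
      refine ⟨hle (.rel _ _ ⟨rfl, rfl⟩), fun t ht => hle ?_⟩
      rw [Setoid.comap_rel]
      have : (Quotient.mk ρ t.castSucc) = Quotient.mk ρ t.succ :=
        Quotient.sound (.rel _ _ ⟨t, (hl t).2 ht, rfl, rfl⟩)
      rw [this]
    · rintro ⟨h0, h1⟩
      have hρ : ρ ≤ π := (glueEnds_le_iff _ _ _ _ _).2 fun e he => h1 e ((hl e).1 he)
      intro v w hvw
      have hvw : Relation.EqvGen _ (Quotient.mk ρ v) (Quotient.mk ρ w) := hvw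
      have key : ∀ v w : Quotient ρ, Relation.EqvGen (fun v w : Quotient ρ =>
          v = Quotient.mk ρ 0 ∧ w = Quotient.mk ρ (Fin.last N)) v w →
          (Setoid.correspondence ρ ⟨π, hρ⟩) v w := by
        intro v w h
        induction h with
        | rel _ _ h => rw [h.1, h.2]; exact h0
        | refl => exact Setoid.refl' _ _
        | symm _ _ _ ih => exact Setoid.symm' _ ih
        | trans _ _ _ _ _ ih ih' => exact Setoid.trans' _ ih ih'
      exact key _ _ hvw
  exact if_congr hmem rfl rfl

end TrafficSpace

end Traffic

end

/-! ### Reduction of words by the first letter -/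

noncomputable section

namespace Traffic

open TestGraph

namespace TrafficIID

variable {A : Type*} [Ring A] [StarRing A] [Algebra ℂ A] [StarModule ℂ A]
  {S : TrafficSpace A} {a : ℕ → A}

theorem word_congr {N : ℕ} {x y : ℕ → Bool × ℕ} (hxy : ∀ t < N, x t = y t) :
    S.word a N x = S.word a N y := by
  unfold TrafficSpace.word
  congr 2
  funext t
  rw [hxy t t.2]

theorem word_zero (x : ℕ → Bool × ℕ) : S.word a 0 x = 1 := by
  simp [TrafficSpace.word]

theorem Φ_word_zero (x : ℕ → Bool × ℕ) : S.Φ (S.word a 0 x) = 1 := by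
  rw [word_zero, S.map_one]

-- Making the first letter diagonal adds the condition that 0 and 1 be equivalent, so the terms left
-- over are those where the first edge is not a loop.
open Classical in
theorem Φ_word_sub {N : ℕ} {x x' : ℕ → Bool × ℕ} (h0 : (x 0).1 = false)
    (h0' : x' 0 = (true, (x 0).2)) (hx : ∀ t < N, x' (t + 1) = x (t + 1)) :
    S.Φ (S.word a (N + 1) x) - S.Φ (S.word a (N + 1) x') =
      ∑ π : Setoid (Fin (N + 2)), if π ∈ closings (N + 1) x ∧ ¬ π 0 1 then
        S.τ₀ (walkQuot (N + 1) (fun t => (x t).2) π) a else 0 := by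
  rw [S.Φ_word, S.Φ_word, ← Finset.sum_sub_distrib]
  refine Finset.sum_congr rfl fun π _ => ?_
  have hmem : π ∈ closings (N + 1) x' ↔ π ∈ closings (N + 1) x ∧ π 0 1 := by
    constructor
    · rintro ⟨h₁, h₂⟩
      refine ⟨⟨h₁, fun t ht => h₂ t ?_⟩, h₂ 0 (by simp [h0'])⟩
      induction t using Fin.cases with
      | zero => simp [h0] at ht
      | succ t => rw [Fin.val_succ, hx t t.2]; exact ht
    · rintro ⟨⟨h₁, h₂⟩, h₃⟩
      refine ⟨h₁, fun t ht => ?_⟩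
      induction t using Fin.cases with
      | zero => exact h₃
      | succ t => rw [Fin.val_succ, hx t t.2] at ht; exact h₂ t.succ ht
  have hcol : S.τ₀ (walkQuot (N + 1) (fun t => (x' t).2) π) a =
      S.τ₀ (walkQuot (N + 1) (fun t => (x t).2) π) a := by
    refine S.τ₀_iso (walkQuot (N + 1) (fun t => (x' t).2) π)
      (walkQuot (N + 1) (fun t => (x t).2) π)
      ⟨Equiv.refl _, Equiv.refl _, fun _ => rfl, fun _ => rfl, ?_, fun _ => rfl⟩ a
    intro (t : Fin (N + 1))
    induction t using Fin.cases with
    | zero => exact (congrArg Prod.snd h0').symm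
    | succ t => exact (congrArg Prod.snd (hx t t.2)).symm
  rw [hcol]
  simp only [hmem]
  by_cases h₁ : π ∈ closings (N + 1) x <;> by_cases h₂ : π 0 1 <;> simp [h₁, h₂]

variable (h : TrafficIID S a)
include h

theorem Φ_word_of_singleton (hmean : S.τ₀ loop (fun _ => a 0) = 0) {N : ℕ} {x : ℕ → Bool × ℕ}
    {t : ℕ} (ht : t < N) (huniq : ∀ r < N, (x r).2 = (x t).2 → r = t) :
    S.Φ (S.word a N x) = 0 := by
  rw [S.Φ_word]
  refine Finset.sum_eq_zero fun π _ => ?_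
  split_ifs with hπ
  · exact h.τ₀_walkQuot_of_singleton hmean hπ.1 ⟨t, ht⟩ fun r hr => Fin.ext (huniq r r.2 hr)
  · rfl

/-- Every other edge of the first colour is diagonal, hence a loop in each term, while the first
edge is not: `τ₀_walkQuot_eq_zero` kills all terms. -/
theorem Φ_word_sub_eq_zero {N : ℕ} {x x' : ℕ → Bool × ℕ} (h0 : (x 0).1 = false)
    (h0' : x' 0 = (true, (x 0).2)) (hx : ∀ t < N, x' (t + 1) = x (t + 1))
    (hother : ∀ t < N, (x (t + 1)).2 = (x 0).2 → (x (t + 1)).1 = true) :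
    S.Φ (S.word a (N + 1) x) - S.Φ (S.word a (N + 1) x') = 0 := by
  rw [Φ_word_sub h0 h0' hx]
  refine Finset.sum_eq_zero fun π _ => ?_
  split_ifs with hπ
  · refine h.τ₀_walkQuot_eq_zero hπ.1.1 0 hπ.2 fun r hr hir => hπ.1.2 r ?_
    induction r using Fin.cases with
    | zero => exact absurd rfl hr
    | succ r => exact hother r r.2 hir
  · rfl

/-- Partitions with a block across the two arcs contribute zero, the others are pairs of partitions
of the arcs, and a pair contributes only if both arcs are closed. The double sum is then a product
of two instances of `Φ_word`. -/
theorem Φ_word_sub_eq_mul {k₁ k₂ : ℕ} {x x' : ℕ → Bool × ℕ} (h0 : (x 0).1 = false)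
    (h0' : x' 0 = (true, (x 0).2)) (hx : ∀ t < k₁ + k₂ + 1, x' (t + 1) = x (t + 1))
    (h1 : (x (k₁ + 1)).1 = false) (hi1 : (x (k₁ + 1)).2 = (x 0).2)
    (hi : ∀ r < k₁ + k₂ + 2, r ≠ 0 → r ≠ k₁ + 1 → (x r).2 ≠ (x 0).2) :
    S.Φ (S.word a (k₁ + k₂ + 2) x) - S.Φ (S.word a (k₁ + k₂ + 2) x') =
      S.τ₀ doubleArrow (fun _ => a 0) * (S.Φ (S.word a k₁ fun t => x (t + 1)) *
        S.Φ (S.word a k₂ fun t => x (t + (k₁ + 2)))) := by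
  classical
  rw [Φ_word_sub h0 h0' hx, S.Φ_word, S.Φ_word, Fintype.sum_mul_sum, ← Fintype.sum_prod_type',
    Finset.mul_sum]
  symm
  have hi' : ∀ r : Fin (k₁ + k₂ + 2), r.1 ≠ 0 → r.1 ≠ k₁ + 1 → (x r).2 ≠ (x 0).2 :=
    fun r => hi r r.2
  refine Fintype.sum_of_injective _ (gluePart_injective k₁ k₂) _ _ ?_ ?_
  · intro π hπ
    split_ifs with hmem
    · by_cases hcross : ∀ x y, ¬ π (leftPart k₁ k₂ x) (rightPart k₁ k₂ y)
      · exact absurd ⟨(_, _), (eq_gluePart k₁ k₂ hmem.1.1 hcross).symm⟩ hπ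
      · push Not at hcross
        obtain ⟨v, w, hvw⟩ := hcross
        exact h.τ₀_walkQuot_of_cross hmem.1.1 (i := fun t => (x t).2) hi' hmem.2 hvw
    · rfl
  · rintro ⟨π₁, π₂⟩
    dsimp only
    set π := gluePart k₁ k₂ π₁ π₂ with hπ
    have e₁ : π.comap (leftPart k₁ k₂) = π₁ := Setoid.ext fun x y => by
      rw [Setoid.comap_rel, hπ, gluePart_left]
    have e₂ : π.comap (rightPart k₁ k₂) = π₂ := Setoid.ext fun x y => by
      rw [Setoid.comap_rel, hπ, gluePart_right]
    have hcross : ∀ x y, ¬ π (leftPart k₁ k₂ x) (rightPart k₁ k₂ y) := fun _ _ =>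
      gluePart_left_right k₁ k₂ _ _
    -- The vertex 0 belongs with the last one to the right arc, and 1 starts the left arc.
    have h01 : ¬ π 0 1 := fun hh => by
      refine hcross 0 (Fin.last _) ?_
      rw [rightPart_last]
      exact π.trans' (π.symm' hh) (gluePart_zero_last k₁ k₂)
    by_cases hc : π₁ 0 (Fin.last _) ∧ π₂ 0 (Fin.last _)
    · have hmem : π ∈ closings (k₁ + k₂ + 1 + 1) x ↔ _ :=
        gluePart_mem_closings k₁ k₂ h0 h1 hc.1 hc.2
      have hmul := h.τ₀_walkQuot_of_closed (i := fun t => (x t).2) (π := π)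
        (gluePart_zero_last k₁ k₂) hi1 hi' hcross (by rw [e₁]; exact hc.1) (by rw [e₂]; exact hc.2)
      rw [e₁, e₂] at hmul
      rw [hmul]
      by_cases c₁ : π₁ ∈ closings k₁ fun t => x (t + 1) <;>
      by_cases c₂ : π₂ ∈ closings k₂ fun t => x (t + (k₁ + 2)) <;>
      simp [c₁, c₂, hmem, h01]
    · have hzero := h.τ₀_walkQuot_of_not_closed (i := fun t => (x t).2) (π := π)
        (gluePart_zero_last k₁ k₂) hi1 hi' hcross (by rw [e₁, e₂]; exact hc)
      rw [hzero, ite_self]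
      by_cases c₁ : π₁ ∈ closings k₁ fun t => x (t + 1)
      · have c₂ : π₂ ∉ closings k₂ fun t => x (t + (k₁ + 2)) := fun c₂ => hc ⟨c₁.1, c₂.1⟩
        simp [c₂]
      · simp [c₁]

omit h in
-- If every step must be a loop, only the partition with one block remains.
theorem Φ_word_diag {N : ℕ} {x : ℕ → Bool × ℕ} (hx : ∀ t < N, (x t).1 = true) :
    S.Φ (S.word a N x) = S.τ₀ (walkQuot N (fun t => (x t).2) ⊤) a := by
  classical
  rw [S.Φ_word, Finset.sum_eq_single ⊤]
  · exact if_pos ⟨trivial, fun _ _ => trivial⟩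
  · intro π _ hπ
    rw [if_neg]
    rintro ⟨-, hmem⟩
    refine hπ (Setoid.eq_top_iff.2 ?_)
    have : ∀ v : Fin (N + 1), π 0 v := by
      intro v
      induction v using Fin.induction with
      | zero => exact π.refl' _
      | succ t ih => exact π.trans' ih (hmem t (hx t t.2))
    exact fun v w => π.trans' (π.symm' (this v)) (this w)
  · simp

theorem Φ_word_diag_eq_mul {N : ℕ} {x : ℕ → Bool × ℕ} (hx : ∀ t < N + 2, (x t).1 = true)
    {m : ℕ} (hm : m < N + 1) (hi1 : (x (m + 1)).2 = (x 0).2)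
    (hi : ∀ r < N + 2, r ≠ 0 → r ≠ m + 1 → (x r).2 ≠ (x 0).2) :
    S.Φ (S.word a (N + 2) x) = S.τ₀ doubleLoop (fun _ => a 0) *
      S.Φ (S.word a N fun t => if t < m then x (t + 1) else x (t + 2)) := by
  rw [Φ_word_diag hx, Φ_word_diag fun t ht => by split_ifs <;> exact hx _ (by omega),
    h.τ₀_walkQuot_top (i := fun t => (x t).2) m hm hi1 fun r => hi r r.2]
  congr 3
  funext t
  split_ifs <;> rfl

/-- The state of a word depends only on which letters are diagonal and which colours agree, so it
takes finitely many values for a given length. -/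
theorem exists_norm_Φ_word_le (N : ℕ) : ∃ C : ℝ, 0 ≤ C ∧ ∀ x, ‖S.Φ (S.word a N x)‖ ≤ C := by
  classical
  let ext : (Fin N → Bool × Fin N) → ℕ → Bool × ℕ := fun y t =>
    if ht : t < N then ((y ⟨t, ht⟩).1, (y ⟨t, ht⟩).2.1) else (false, 0)
  refine ⟨∑ y : Fin N → Bool × Fin N, ‖S.Φ (S.word a N (ext y))‖,
    Finset.sum_nonneg fun _ _ => norm_nonneg _, fun x => ?_⟩
  have hex : ∀ t : Fin N, ∃ r, (x r).2 = (x t).2 := fun t => ⟨t, rfl⟩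
  -- Each colour is renamed as the first position where it occurs, which is below `N`.
  let first : Fin N → ℕ := fun t => Nat.find (hex t)
  have hle : ∀ t, first t ≤ t := fun t => Nat.find_min' (hex t) rfl
  have hspec : ∀ t, (x (first t)).2 = (x t).2 := fun t => Nat.find_spec (hex t)
  have hiff : ∀ t t' : Fin N, first t = first t' ↔ (x t).2 = (x t').2 := by
    intro t t'
    constructor
    · intro hh
      rw [← hspec t, ← hspec t', hh]
    · intro hh
      refine le_antisymm (Nat.find_min' _ ?_) (Nat.find_min' _ ?_)
      · rw [hh]; exact hspec t'
      · rw [← hh]; exact hspec t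
  let y : Fin N → Bool × Fin N := fun t => ((x t).1, ⟨first t, (hle t).trans_lt t.2⟩)
  have hy : ∀ t : Fin N, ext y t = ((x t).1, first t) := fun t => by
    simp [ext, y]
  have : S.Φ (S.word a N x) = S.Φ (S.word a N (ext y)) := by
    rw [S.Φ_word, S.Φ_word]
    refine Finset.sum_congr rfl fun π _ => if_congr ?_ (h.τ₀_walkQuot_congr π fun r r' => ?_) rfl
    · simp only [closings, Set.mem_ofPred_eq, hy]
    · simp only [hy, hiff]
  rw [this]
  exact Finset.single_le_sum (f := fun y => ‖S.Φ (S.word a N (ext y))‖)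
    (fun _ _ => norm_nonneg _) (Finset.mem_univ y)

end TrafficIID

end Traffic

end

/-! ### Exact identities for colourings that are not crowded, and the parameter p -/

noncomputable section

namespace Traffic

open TestGraph

/-- The colours of `N` edges such that no colour is used once, and the colour of the first edge
is used at least three times. -/
def Crowded (N : ℕ) (i : ℕ → ℕ) : Prop :=
  (∀ t < N, ∃ r < N, r ≠ t ∧ i r = i t) ∧
    ∃ r < N, ∃ r' < N, r ≠ 0 ∧ r' ≠ 0 ∧ r ≠ r' ∧ i r = i 0 ∧ i r' = i 0

/-- Either some colour occurs once, or the first colour occurs exactly twice; in the latter case its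
second position is written m + 1. -/
theorem cases_of_not_crowded {N : ℕ} {i : ℕ → ℕ} (hi : ¬ Crowded (N + 1) i) :
    (∃ t < N + 1, ∀ r < N + 1, i r = i t → r = t) ∨
      ∃ m < N, i (m + 1) = i 0 ∧ ∀ r < N + 1, r ≠ 0 → r ≠ m + 1 → i r ≠ i 0 := by
  by_cases hs : ∀ t < N + 1, ∃ r < N + 1, r ≠ t ∧ i r = i t
  · right
    obtain ⟨r, hr, hr0, hir⟩ := hs 0 (by omega)
    refine ⟨r - 1, by omega, by rwa [Nat.sub_add_cancel (by omega)], fun r' hr' hr'0 hne h => ?_⟩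
    exact hi ⟨hs, r, hr, r', hr', hr0, hr'0, by omega, hir, h⟩
  · left
    push Not at hs
    obtain ⟨t, ht, hs⟩ := hs
    exact ⟨t, ht, fun r hr hir => by_contra fun hne => hs r hr hne hir⟩

namespace TrafficIID

variable {A : Type*} [Ring A] [StarRing A] [Algebra ℂ A] [StarModule ℂ A]
  {S : TrafficSpace A} {a : ℕ → A} (h : TrafficIID S a)

include h in
theorem τ₀_law (T : TestGraph Unit) (n : ℕ) : S.τ₀ T (fun _ => a n) = S.τ₀ T fun _ => a 0 := by
  unfold TrafficSpace.τ₀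
  congr 1
  exact funext fun T' => h.law n 0 T'

theorem word_two (x : ℕ → Bool × ℕ) :
    S.word a 2 x = S.letter a (x 0) * S.letter a (x 1) := by
  simp [TrafficSpace.word, List.ofFn_succ]

theorem word_one (x : ℕ → Bool × ℕ) : S.word a 1 x = S.letter a (x 0) := by
  simp [TrafficSpace.word, List.ofFn_succ]

/-- For a single letter, closing the path already makes its edge a loop. -/
theorem Φ_diag (n : ℕ) : S.Φ (S.diag (a n)) = S.Φ (a n) := by
  have hs := Φ_word_sub (S := S) (a := a) (N := 0) (x := fun _ => (false, n))
    (x' := fun _ => (true, n)) rfl rfl fun t ht => absurd ht (Nat.not_lt_zero _)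
  rw [Finset.sum_eq_zero fun π _ => if_neg fun hh => hh.2 hh.1.1, word_one, word_one] at hs
  exact (sub_eq_zero.1 hs).symm

theorem τ₀_loop (n : ℕ) : S.τ₀ loop (fun _ => a n) = S.Φ (a n) := by
  have : Subsingleton loop.V := inferInstanceAs (Subsingleton Unit)
  rw [S.τ₀_eq_τ_of_subsingleton, S.τ_eq_Φ_rooted loop (), ← Φ_diag]
  rfl

include h

theorem Φ_diag_mul_diag : S.Φ (S.diag (a 0) * S.diag (a 0)) = S.τ₀ doubleLoop fun _ => a 0 := by
  have := h.Φ_word_diag_eq_mul (N := 0) (x := fun _ => (true, 0)) (fun _ _ => rfl) (m := 0)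
    (by omega) rfl fun r _ _ _ => by omega
  rw [word_two, Φ_word_zero, mul_one] at this
  exact this

theorem Φ_mul_diag : S.Φ (a 0 * S.diag (a 0)) = S.τ₀ doubleLoop fun _ => a 0 := by
  have := h.Φ_word_sub_eq_zero (N := 1) (x := fun t => (decide (0 < t), 0))
    (x' := fun _ => (true, 0)) rfl rfl (fun _ _ => by simp) (fun _ _ _ => by simp)
  rw [word_two, word_two, sub_eq_zero] at this
  rw [← h.Φ_diag_mul_diag]
  exact this

theorem Φ_diag_mul : S.Φ (S.diag (a 0) * a 0) = S.τ₀ doubleLoop fun _ => a 0 := by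
  rw [S.tracial, h.Φ_mul_diag]

theorem Φ_mul_self : S.Φ (a 0 * a 0) =
    (S.τ₀ doubleLoop fun _ => a 0) + S.τ₀ doubleArrow fun _ => a 0 := by
  have := h.Φ_word_sub_eq_mul (k₁ := 0) (k₂ := 0) (x := fun _ => (false, 0))
    (x' := fun t => (decide (t = 0), 0)) rfl rfl (fun _ _ => by simp) rfl rfl
    fun r _ _ _ => by omega
  rw [Φ_word_zero, mul_one, mul_one] at this
  rw [← h.Φ_diag_mul, ← this]
  rw [show S.word a (0 + 0 + 2) (fun _ => (false, 0)) = a 0 * a 0 from word_two _,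
    show S.word a (0 + 0 + 2) (fun t => (decide (t = 0), 0)) = S.diag (a 0) * a 0 from word_two _]
  ring

/-- With Δ the diagonal part of `a 0`, the double loop has value Φ(Δ²) and the double arrow Φ((a -
Δ)²), both nonnegative because Δ is self-adjoint; their sum is the variance 1. -/
theorem exists_param (hsa : IsSelfAdjoint (a 0)) (hvar : S.Φ (a 0 ^ 2) = 1) :
    ∃ p : ℝ, 0 ≤ p ∧ p ≤ 1 ∧ (S.τ₀ doubleLoop fun _ => a 0) = (p : ℂ) ∧
      (S.τ₀ doubleArrow fun _ => a 0) = ((1 - p : ℝ) : ℂ) := by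
  have hd : star (S.diag (a 0)) = S.diag (a 0) := by rw [S.star_diag, hsa.star_eq]
  have h₁ := S.nonneg (S.diag (a 0))
  rw [hd, h.Φ_diag_mul_diag] at h₁
  have h₂ := S.nonneg (a 0 - S.diag (a 0))
  rw [star_sub, hd, hsa.star_eq, sub_mul, mul_sub, mul_sub, map_sub, map_sub, map_sub, h.Φ_mul_self,
    h.Φ_mul_diag, h.Φ_diag_mul, h.Φ_diag_mul_diag] at h₂
  rw [pow_two, h.Φ_mul_self] at hvar
  generalize (S.τ₀ doubleLoop fun _ => a 0) = x at *
  generalize (S.τ₀ doubleArrow fun _ => a 0) = y at *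
  have hy : y = 1 - x := by rw [← hvar]; ring
  have h₂' : 0 ≤ y := by
    refine h₂.trans_eq ?_
    ring
  have hx : x = (x.re : ℂ) := (Complex.eq_re_of_ofReal_le (r := 0) (by simpa using h₁))
  refine ⟨x.re, (Complex.nonneg_iff.1 h₁).1, ?_, hx, ?_⟩
  · have := (Complex.nonneg_iff.1 h₂').1
    rw [hy] at this
    simpa using this
  · rw [hy]
    push_cast
    rw [← hx]

omit h

/-- Words made of variables followed by diagonal parts, the first `k` letters being variables. -/
def shape (k : ℕ) (i : ℕ → ℕ) : ℕ → Bool × ℕ := fun t => (decide (k ≤ t), i t)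

/-- The same when the first letter is replaced by its diagonal part. -/
def shapeDiag (k : ℕ) (i : ℕ → ℕ) : ℕ → Bool × ℕ := fun t => (decide (t = 0 ∨ k ≤ t), i t)

variable (S a) in
/-- The value of the state on a word. -/
def val (k N : ℕ) (i : ℕ → ℕ) : ℂ := S.Φ (S.word a N (shape k i))

theorem val_congr {k N : ℕ} {i i' : ℕ → ℕ} (hi : ∀ t < N, i t = i' t) :
    val S a k N i = val S a k N i' := by
  unfold val
  rw [word_congr fun t ht => ?_]
  simp [shape, hi t ht]

include h

theorem val_of_singleton (hmean : S.τ₀ loop (fun _ => a 0) = 0) {k N : ℕ} {i : ℕ → ℕ}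
    {t : ℕ} (ht : t < N) (huniq : ∀ r < N, i r = i t → r = t) : val S a k N i = 0 :=
  h.Φ_word_of_singleton hmean ht huniq

/-- The sum over m, with an indicator, runs over the possible partners m + 1 of the first letter
among the variables; here at most one term is nonzero. In this form the identity can be summed over
all colourings. -/
theorem val_sub_eq_sum (hmean : S.τ₀ loop (fun _ => a 0) = 0) {k N : ℕ} (hk : k ≤ N)
    {i : ℕ → ℕ} (hi : ¬ Crowded (N + 1) i) :
    val S a (k + 1) (N + 1) i - S.Φ (S.word a (N + 1) (shapeDiag (k + 1) i)) =
      ∑ m ∈ Finset.range k, if i (m + 1) = i 0 then (S.τ₀ doubleArrow fun _ => a 0) *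
        (val S a m m (fun t => i (t + 1)) *
          val S a (k - (m + 1)) (N - (m + 1)) fun t => i (t + (m + 2))) else 0 := by
  rcases cases_of_not_crowded hi with ⟨t, ht, huniq⟩ | ⟨m, hm, hi1, huniq⟩
  · rw [h.val_of_singleton hmean ht huniq, h.Φ_word_of_singleton hmean ht huniq, sub_zero]
    symm
    refine Finset.sum_eq_zero fun m hm => ?_
    rw [Finset.mem_range] at hm
    split_ifs with him
    -- A colour used once is neither at 0 nor at m + 1. It therefore survives in one of the two
    -- shorter words, at position t - 1 or t - (m + 2), and is still alone there.
    · have ht0 : t ≠ 0 := fun h0 => by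
        subst h0
        have := huniq (m + 1) (by omega) him
        omega
      have htm : t ≠ m + 1 := fun h0 => by
        subst h0
        have := huniq 0 (by omega) him.symm
        omega
      by_cases htm' : t < m + 1
      · rw [h.val_of_singleton hmean (N := m) (t := t - 1) (by omega) fun r hr hir => ?_]
        · ring
        · rw [Nat.sub_add_cancel (by omega)] at hir
          have := huniq (r + 1) (by omega) hir
          omega
      · rw [h.val_of_singleton hmean (N := N - (m + 1)) (t := t - (m + 2)) (by omega)
          fun r hr hir => ?_]
        · ring
        · rw [Nat.sub_add_cancel (by omega)] at hir
          have := huniq (r + (m + 2)) (by omega) hir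
          omega
    · rfl
  · by_cases hmk : m < k
    · rw [Finset.sum_eq_single m]
      · rw [if_pos hi1]
        obtain ⟨k₂, rfl⟩ := Nat.exists_eq_add_of_lt hm
        have := h.Φ_word_sub_eq_mul (k₁ := m) (k₂ := k₂) (x := shape (k + 1) i)
          (x' := shapeDiag (k + 1) i) (by simp [shape]) (by simp [shape, shapeDiag])
          (fun t _ => by simp [shape, shapeDiag]) (by simp [shape]; omega) hi1
          (fun r hr hr0 hrm => huniq r (by omega) hr0 hrm)
        unfold val
        rw [show m + k₂ + 1 - (m + 1) = k₂ by omega]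
        refine Eq.trans this ?_
        congr 2
        · refine congrArg _ (word_congr fun t ht => ?_)
          simp only [shape, Prod.mk.injEq, and_true, decide_eq_decide]
          omega
        · refine congrArg _ (word_congr fun t ht => ?_)
          simp only [shape, Prod.mk.injEq, and_true, decide_eq_decide]
          omega
      · intro m' hm' hne
        rw [Finset.mem_range] at hm'
        exact if_neg (huniq (m' + 1) (by omega) (by omega) (by omega))
      · intro hm'
        exact absurd (Finset.mem_range.2 hmk) hm'
    -- The partner of the first letter is now diagonal, so the left side vanishes, and no index
    -- below `k` satisfies the indicator.
    · rw [Finset.sum_eq_zero fun m' hm' => if_neg (huniq (m' + 1)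
        (by rw [Finset.mem_range] at hm'; omega) (by omega)
        (by rw [Finset.mem_range] at hm'; omega))]
      refine h.Φ_word_sub_eq_zero (by simp [shape]) (by simp [shape, shapeDiag])
        (fun t _ => by simp [shape, shapeDiag]) fun t ht hit => ?_
      by_contra hcon
      simp only [shape, decide_eq_true_eq] at hcon hit
      exact huniq (t + 1) (by omega) (by omega) (by omega) hit

/-- All letters are diagonal, so the partner of the first letter may sit anywhere and the pair of
loops factors out. -/
theorem val_eq_sum (hmean : S.τ₀ loop (fun _ => a 0) = 0) {N : ℕ}
    {i : ℕ → ℕ} (hi : ¬ Crowded (N + 2) i) :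
    val S a 0 (N + 2) i =
      ∑ m ∈ Finset.range (N + 1), if i (m + 1) = i 0 then (S.τ₀ doubleLoop fun _ => a 0) *
        val S a 0 N (fun t => if t < m then i (t + 1) else i (t + 2)) else 0 := by
  rcases cases_of_not_crowded hi with ⟨t, ht, huniq⟩ | ⟨m, hm, hi1, huniq⟩
  · rw [h.val_of_singleton hmean ht huniq]
    symm
    refine Finset.sum_eq_zero fun m hm => ?_
    rw [Finset.mem_range] at hm
    split_ifs with him
    · have ht0 : t ≠ 0 := fun h0 => by
        subst h0
        have := huniq (m + 1) (by omega) him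
        omega
      have htm : t ≠ m + 1 := fun h0 => by
        subst h0
        have := huniq 0 (by omega) him.symm
        omega
      rw [h.val_of_singleton hmean (N := N) (t := if t < m + 1 then t - 1 else t - 2)
        (by split_ifs <;> omega) fun r hr hir => ?_, mul_zero]
      have e : (if (if t < m + 1 then t - 1 else t - 2) < m then
          i ((if t < m + 1 then t - 1 else t - 2) + 1)
          else i ((if t < m + 1 then t - 1 else t - 2) + 2)) = i t := by
        by_cases h1 : t < m + 1
        · rw [if_pos h1, if_pos (by omega), Nat.sub_add_cancel (by omega)]
        · rw [if_neg h1, if_neg (by omega), Nat.sub_add_cancel (by omega)]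
      rw [e] at hir
      split_ifs at hir ⊢ with h1 h2 h2
      all_goals
        first
        | have := huniq (r + 1) (by omega) hir; omega
        | have := huniq (r + 2) (by omega) hir; omega
    · rfl
  · rw [Finset.sum_eq_single m]
    · rw [if_pos hi1]
      unfold val
      rw [h.Φ_word_diag_eq_mul (fun _ _ => by simp [shape]) hm hi1 huniq]
      congr 2
      refine word_congr fun t ht => ?_
      split_ifs <;> simp [shape, *]
    · intro m' hm' hne
      rw [Finset.mem_range] at hm'
      exact if_neg (huniq (m' + 1) (by omega) (by omega) (by omega))
    · intro hm'
      exact absurd (Finset.mem_range.2 hm) hm'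

end TrafficIID

end Traffic

end

noncomputable section

namespace Traffic

/-! ### Sums over colourings -/

/-- A finite sequence of colours, extended by zero. -/
def extend {N n : ℕ} (i : Fin N → Fin n) (t : ℕ) : ℕ := if h : t < N then i ⟨t, h⟩ else 0

/-- Prepend a colour. -/
def consSeq (c : ℕ) (i : ℕ → ℕ) : ℕ → ℕ
  | 0 => c
  | t + 1 => i t

/-- Insert a colour in position `m`. -/
def insertSeq : ℕ → ℕ → (ℕ → ℕ) → ℕ → ℕ
  | 0, c, i => consSeq c i
  | m + 1, c, i => consSeq (i 0) (insertSeq m c fun t => i (t + 1))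

theorem insertSeq_consSeq (m c c' : ℕ) (i : ℕ → ℕ) :
    insertSeq (m + 1) c (consSeq c' i) = consSeq c' (insertSeq m c i) := rfl

theorem insertSeq_self (m c : ℕ) (i : ℕ → ℕ) : insertSeq m c i m = c := by
  induction m generalizing i with
  | zero => rfl
  | succ m ih => exact ih _

theorem insertSeq_of_lt (m c : ℕ) (i : ℕ → ℕ) {t : ℕ} (ht : t < m) :
    insertSeq m c i t = i t := by
  induction m generalizing i t with
  | zero => omega
  | succ m ih =>
    cases t with
    | zero => rfl
    | succ t => exact ih (fun t => i (t + 1)) (by omega)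

theorem insertSeq_of_ge (m c : ℕ) (i : ℕ → ℕ) {t : ℕ} (ht : m ≤ t) :
    insertSeq m c i (t + 1) = i t := by
  induction m generalizing i t with
  | zero => rfl
  | succ m ih =>
    obtain ⟨t, rfl⟩ : ∃ t', t = t' + 1 := ⟨t - 1, by omega⟩
    exact ih (fun t => i (t + 1)) (by omega)

section ColourSum

variable {M : Type*} [AddCommMonoid M]

/-- The sum over the colourings of `N` edges by `n` colours. -/
def colourSum (n N : ℕ) (F : (ℕ → ℕ) → M) : M := ∑ i : Fin N → Fin n, F (extend i)

theorem colourSum_zero (n : ℕ) (F : (ℕ → ℕ) → M) : colourSum n 0 F = F fun _ => 0 := by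
  simp only [colourSum, Finset.univ_unique, Finset.sum_singleton]
  exact congrArg F (funext fun t => dif_neg (by omega))

theorem colourSum_succ (n N : ℕ) (F : (ℕ → ℕ) → M) :
    colourSum n (N + 1) F = ∑ c ∈ Finset.range n, colourSum n N fun i => F (consSeq c i) := by
  unfold colourSum
  rw [← (Fin.consEquiv fun _ : Fin (N + 1) => Fin n).sum_comp, Fintype.sum_prod_type,
    Finset.sum_range]
  refine Finset.sum_congr rfl fun c _ => Finset.sum_congr rfl fun i _ => congrArg F ?_
  funext t
  cases t with
  | zero => rfl
  | succ t =>
    by_cases ht : t < N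
    · rw [extend, dif_pos (by omega)]
      change _ = extend i t
      rw [extend, dif_pos ht]
      rfl
    · rw [extend, dif_neg (by omega)]
      change _ = extend i t
      rw [extend, dif_neg ht]

/-- The colour of any chosen position can be summed separately: peel the first colours one by one
and exchange the sums. -/
theorem colourSum_insert (n : ℕ) {m N : ℕ} (hm : m ≤ N) (F : (ℕ → ℕ) → M) :
    colourSum n (N + 1) F =
      ∑ c ∈ Finset.range n, colourSum n N fun i => F (insertSeq m c i) := by
  induction m generalizing N F with
  | zero => exact colourSum_succ n N F
  | succ m ih =>
    obtain ⟨N, rfl⟩ : ∃ N', N = N' + 1 := ⟨N - 1, by omega⟩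
    rw [colourSum_succ, Finset.sum_congr rfl fun c _ => ih (show m ≤ N by omega) _,
      Finset.sum_comm]
    refine Finset.sum_congr rfl fun c _ => ?_
    rw [colourSum_succ]
    simp only [insertSeq_consSeq]

theorem colourSum_sum {ι : Type*} (n N : ℕ) (s : Finset ι) (F : ι → (ℕ → ℕ) → M) :
    (colourSum n N fun i => ∑ m ∈ s, F m i) = ∑ m ∈ s, colourSum n N (F m) :=
  Finset.sum_comm

theorem map_colourSum {M' : Type*} [AddCommMonoid M'] {G : Type*} [FunLike G M M']
    [AddMonoidHomClass G M M'] (f : G) (n N : ℕ) (F : (ℕ → ℕ) → M) :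
    f (colourSum n N F) = colourSum n N fun i => f (F i) := map_sum _ _ _

end ColourSum

theorem colourSum_sub (n N : ℕ) (F G : (ℕ → ℕ) → ℂ) :
    (colourSum n N fun i => F i - G i) = colourSum n N F - colourSum n N G :=
  Finset.sum_sub_distrib _ _

theorem colourSum_const_mul (n N : ℕ) (q : ℂ) (F : (ℕ → ℕ) → ℂ) :
    (colourSum n N fun i => q * F i) = q * colourSum n N F :=
  (Finset.mul_sum _ _ _).symm

theorem colourSum_add_mul (n : ℕ) {m r : ℕ} {f g : (ℕ → ℕ) → ℂ}
    (hf : ∀ i i' : ℕ → ℕ, (∀ t < m, i t = i' t) → f i = f i') :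
    (colourSum n (m + r) fun i => f i * g fun t => i (t + m)) =
      colourSum n m f * colourSum n r g := by
  induction m generalizing f with
  | zero =>
    rw [colourSum_zero, ← colourSum_const_mul, Nat.zero_add]
    congr 1
    funext i
    rw [hf i (fun _ => 0) fun t ht => by omega]
    rfl
  | succ m ih =>
    rw [Nat.succ_add, colourSum_succ, colourSum_succ, Finset.sum_mul]
    refine Finset.sum_congr rfl fun c _ => ?_
    rw [← ih fun i i' hi => hf _ _ fun t ht => ?_]
    · rfl
    · cases t with
      | zero => rfl
      | succ t => exact hi t (by omega)

/-- The common colour of the edges 0 and m + 1 has n possible values, and the summand does not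
depend on it. Once the edge 0 is removed, its partner is at position m. -/
theorem colourSum_ite_eq (n : ℕ) {m N : ℕ} (hm : m ≤ N) (F : (ℕ → ℕ) → ℂ) (G : (ℕ → ℕ) → ℂ)
    (hFG : ∀ c i, F (consSeq c (insertSeq m c i)) = G i) :
    (colourSum n (N + 2) fun i => if i (m + 1) = i 0 then F i else 0) =
      n * colourSum n N G := by
  rw [colourSum_succ]
  have : ∀ c ∈ Finset.range n, (colourSum n (N + 1) fun i =>
      if consSeq c i (m + 1) = consSeq c i 0 then F (consSeq c i) else 0) = colourSum n N G := by
    intro c hc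
    rw [colourSum_insert n hm, Finset.sum_eq_single c]
    · unfold colourSum
      refine Finset.sum_congr rfl fun i _ => ?_
      exact (if_pos (insertSeq_self _ _ _)).trans (hFG _ _)
    · intro c' _ hne
      unfold colourSum
      refine Finset.sum_eq_zero fun i _ => if_neg ?_
      exact fun h => hne ((insertSeq_self m c' _).symm.trans h)
    · exact fun h => absurd hc h
  rw [Finset.sum_congr rfl this, Finset.sum_const, Finset.card_range, nsmul_eq_mul]

/-! ### Crowded colourings are negligible -/

/-- The first colour uses at least three of the N + 1 edges and each other colour at least two, so 3
+ 2 (#colours - 1) ≤ N + 1. -/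
theorem card_image_le_of_crowded {N n : ℕ} {i : Fin (N + 1) → Fin n}
    (hi : Crowded (N + 1) (extend i)) : (Finset.univ.image i).card ≤ N / 2 := by
  have hext : ∀ t : Fin (N + 1), extend i t = i t := fun t => dif_pos t.2
  obtain ⟨h₁, r, hr, r', hr', hr0, hr'0, hne, hir, hir'⟩ := hi
  have key := Finset.card_eq_sum_card_image i Finset.univ
  rw [Finset.card_univ, Fintype.card_fin] at key
  have h0 : i 0 ∈ Finset.univ.image i := Finset.mem_image_of_mem _ (Finset.mem_univ _)
  rw [← Finset.add_sum_erase _ _ h0] at key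
  have h3 : 3 ≤ (Finset.univ.filter fun t => i t = i 0).card := by
    have hsub : ({0, ⟨r, hr⟩, ⟨r', hr'⟩} : Finset (Fin (N + 1))) ⊆
        Finset.univ.filter fun t => i t = i 0 := by
      intro t ht
      simp only [Finset.mem_insert, Finset.mem_singleton] at ht
      rw [Finset.mem_filter]
      refine ⟨Finset.mem_univ _, ?_⟩
      rcases ht with rfl | rfl | rfl
      · rfl
      · rw [Fin.ext_iff, ← hext, ← hext]; exact hir
      · rw [Fin.ext_iff, ← hext, ← hext]; exact hir'
    refine le_trans ?_ (Finset.card_le_card hsub)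
    rw [Finset.card_eq_three.2 ⟨_, _, _, ?_, ?_, ?_, rfl⟩]
    · exact fun h => hr0 (congrArg Fin.val h).symm
    · exact fun h => hr'0 (congrArg Fin.val h).symm
    · exact fun h => hne (congrArg Fin.val h)
  have h2 : ((Finset.univ.image i).erase (i 0)).card • 2 ≤
      ∑ v ∈ (Finset.univ.image i).erase (i 0), (Finset.univ.filter fun t => i t = v).card := by
    refine Finset.card_nsmul_le_sum _ _ _ fun v hv => ?_
    obtain ⟨t, -, rfl⟩ := Finset.mem_image.1 (Finset.mem_of_mem_erase hv)
    obtain ⟨u, hu, hut, hiu⟩ := h₁ t t.2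
    refine Finset.one_lt_card.2 ⟨t, by simp, ⟨u, hu⟩, ?_, fun h => hut (congrArg Fin.val h).symm⟩
    rw [Finset.mem_filter]
    exact ⟨Finset.mem_univ _, by rw [Fin.ext_iff, ← hext, ← hext]; exact hiu⟩
  have hcard := Finset.card_erase_add_one h0
  rw [smul_eq_mul] at h2
  omega

/-- A map with at most r values factors through `Fin r`. -/
theorem card_filter_card_image_le (N n r : ℕ) (hN : 0 < N) :
    (Finset.univ.filter fun i : Fin N → Fin n => (Finset.univ.image i).card ≤ r).card ≤
      r ^ N * n ^ r := by
  have hsub : (Finset.univ.filter fun i : Fin N → Fin n => (Finset.univ.image i).card ≤ r) ⊆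
      (Finset.univ : Finset ((Fin N → Fin r) × (Fin r → Fin n))).image fun p => p.2 ∘ p.1 := by
    intro i hi
    rw [Finset.mem_filter] at hi
    have : Nonempty (Finset.univ.image i) :=
      ⟨⟨i ⟨0, hN⟩, Finset.mem_image_of_mem _ (Finset.mem_univ _)⟩⟩
    obtain ⟨e⟩ : Nonempty ((Finset.univ.image i) ↪ Fin r) :=
      Function.Embedding.nonempty_of_card_le
        (by rw [Fintype.card_coe, Fintype.card_fin]; exact hi.2)
    refine Finset.mem_image.2 ⟨(fun t => e ⟨i t, Finset.mem_image_of_mem _ (Finset.mem_univ _)⟩,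
      fun q => (Function.invFun e q).1), Finset.mem_univ _, funext fun t => ?_⟩
    simp [Function.leftInverse_invFun e.injective _]
  refine (Finset.card_le_card hsub).trans (Finset.card_image_le.trans ?_)
  simp

open Filter Topology

/-- There are O(n^(N/2)) crowded colourings, each with a bounded term, against a normalization
n^(-(N+1)/2): a factor n^(-1/2) remains. -/
theorem tendsto_colourSum_of_crowded {N : ℕ} {F : (ℕ → ℕ) → ℂ}
    (hF : F =O[⊤] fun _ => (1 : ℝ)) (h0 : ∀ i, ¬ Crowded (N + 1) i → F i = 0) :
    Tendsto (fun n : ℕ => ((1 / Real.sqrt n : ℝ) : ℂ) ^ (N + 1) * colourSum n (N + 1) F)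
      atTop (𝓝 0) := by
  obtain ⟨C, hC⟩ := Asymptotics.isBigO_top.1 hF
  simp only [norm_one, mul_one] at hC
  have hC0 : 0 ≤ C := (norm_nonneg _).trans (hC fun _ => 0)
  have hlim : Tendsto (fun n : ℕ => C * ((N / 2 : ℕ) : ℝ) ^ (N + 1) * (1 / Real.sqrt n)) atTop
      (𝓝 0) := by
    rw [← mul_zero (C * ((N / 2 : ℕ) : ℝ) ^ (N + 1))]
    refine Tendsto.const_mul _ ?_
    simp_rw [one_div]
    exact tendsto_inv_atTop_zero.comp (Real.tendsto_sqrt_atTop.comp tendsto_natCast_atTop_atTop)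
  refine squeeze_zero_norm' ?_ hlim
  filter_upwards [eventually_ge_atTop 1] with n hn
  have hs : 1 ≤ Real.sqrt n := by
    rw [Real.one_le_sqrt]
    exact_mod_cast hn
  have hcs : ‖colourSum n (N + 1) F‖ ≤ C * (((N / 2 : ℕ) : ℝ) ^ (N + 1) * Real.sqrt n ^ N) := by
    classical
    unfold colourSum
    rw [← Finset.sum_filter_of_ne (p := fun i : Fin (N + 1) → Fin n =>
      (Finset.univ.image i).card ≤ N / 2)]
    · refine (norm_sum_le_of_le _ fun i _ => hC _).trans ?_
      rw [Finset.sum_const, nsmul_eq_mul, mul_comm]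
      refine mul_le_mul_of_nonneg_left ?_ hC0
      refine (Nat.cast_le.2 (card_filter_card_image_le (N + 1) n (N / 2) N.succ_pos)).trans ?_
      push_cast
      refine mul_le_mul_of_nonneg_left ?_ (by positivity)
      calc (n : ℝ) ^ (N / 2) = Real.sqrt n ^ (2 * (N / 2)) := by
            rw [pow_mul, Real.sq_sqrt (Nat.cast_nonneg _)]
        _ ≤ Real.sqrt n ^ N := pow_le_pow_right₀ hs (by omega)
    · intro i _ hi
      refine card_image_le_of_crowded (by_contra fun h => hi (h0 _ h))
  rw [norm_mul, norm_pow, Complex.norm_real, Real.norm_of_nonneg (by positivity)]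
  calc (1 / Real.sqrt n) ^ (N + 1) * ‖colourSum n (N + 1) F‖
      ≤ (1 / Real.sqrt n) ^ (N + 1) * (C * (((N / 2 : ℕ) : ℝ) ^ (N + 1) * Real.sqrt n ^ N)) :=
        mul_le_mul_of_nonneg_left hcs (by positivity)
    _ = C * ((N / 2 : ℕ) : ℝ) ^ (N + 1) * (1 / Real.sqrt n) := by
        have : (1 / Real.sqrt n) ^ N * Real.sqrt n ^ N = 1 := by
          rw [← mul_pow, one_div_mul_cancel (by positivity), one_pow]
        linear_combination C * ((N / 2 : ℕ) : ℝ) ^ (N + 1) * (1 / Real.sqrt n) * this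

end Traffic

end

/-! ### Asymptotic recursion for the mixed moments -/

noncomputable section

namespace Traffic

open TestGraph Filter Topology

namespace TrafficIID

variable {A : Type*} [Ring A] [StarRing A] [Algebra ℂ A] [StarModule ℂ A]
  {S : TrafficSpace A} {a : ℕ → A}

theorem word_succ (N : ℕ) (x : ℕ → Bool × ℕ) :
    S.word a (N + 1) x = S.letter a (x 0) * S.word a N fun t => x (t + 1) := by
  simp [TrafficSpace.word, List.ofFn_succ]

variable (S a) in
/-- The normalized sum of `n` variables. -/
def mean (n : ℕ) : A := ((1 / Real.sqrt n : ℝ) : ℂ) • ∑ c ∈ Finset.range n, a c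

variable (S a) in
/-- The normalized sum of the diagonal parts of `n` variables. -/
def meanDiag (n : ℕ) : A := ((1 / Real.sqrt n : ℝ) : ℂ) • ∑ c ∈ Finset.range n, S.diag (a c)

omit [StarRing A] [Algebra ℂ A] [StarModule ℂ A] in
theorem colourSum_const_mul_left (b : A) (n N : ℕ) (F : (ℕ → ℕ) → A) :
    (colourSum n N fun i => b * F i) = b * colourSum n N F :=
  (Finset.mul_sum _ _ _).symm

theorem colourSum_word_shape_zero (n j : ℕ) :
    (colourSum n j fun i => S.word a j (shape 0 i)) =
      (∑ c ∈ Finset.range n, S.diag (a c)) ^ j := by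
  induction j with
  | zero => rw [colourSum_zero, word_zero, pow_zero]
  | succ j ih =>
    rw [colourSum_succ, pow_succ', Finset.sum_mul]
    refine Finset.sum_congr rfl fun c _ => ?_
    rw [← ih, ← colourSum_const_mul_left]
    simp_rw [word_succ]
    rfl

theorem shape_succ_consSeq (k c : ℕ) (i : ℕ → ℕ) :
    (fun t => shape (k + 1) (consSeq c i) (t + 1)) = shape k i := by
  funext t
  simp [shape, consSeq]

theorem colourSum_word_shape (n k j : ℕ) :
    (colourSum n (k + j) fun i => S.word a (k + j) (shape k i)) =
      (∑ c ∈ Finset.range n, a c) ^ k * (∑ c ∈ Finset.range n, S.diag (a c)) ^ j := by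
  induction k with
  | zero => rw [Nat.zero_add, colourSum_word_shape_zero, pow_zero, one_mul]
  | succ k ih =>
    rw [Nat.succ_add, colourSum_succ, pow_succ', mul_assoc, Finset.sum_mul]
    refine Finset.sum_congr rfl fun c _ => ?_
    rw [← ih, ← colourSum_const_mul_left]
    simp_rw [word_succ, shape_succ_consSeq]
    rfl

theorem colourSum_word_shapeDiag (n k j : ℕ) :
    (colourSum n (k + j + 1) fun i => S.word a (k + j + 1) (shapeDiag (k + 1) i)) =
      (∑ c ∈ Finset.range n, S.diag (a c)) * ((∑ c ∈ Finset.range n, a c) ^ k *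
        (∑ c ∈ Finset.range n, S.diag (a c)) ^ j) := by
  rw [colourSum_succ, Finset.sum_mul]
  refine Finset.sum_congr rfl fun c _ => ?_
  rw [← colourSum_word_shape, ← colourSum_const_mul_left]
  simp_rw [word_succ]
  congr 1
  funext i
  congr 2
  funext t
  simp [shape, shapeDiag, consSeq]

variable (S a) in
/-- Mixed moments of the normalized sum and of the normalized sum of the diagonal parts. -/
def moment (k j n : ℕ) : ℂ := S.Φ (mean a n ^ k * meanDiag S a n ^ j)

theorem moment_eq (k j n : ℕ) : moment S a k j n =
    ((1 / Real.sqrt n : ℝ) : ℂ) ^ (k + j) * colourSum n (k + j) (val S a k (k + j)) := by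
  unfold moment mean meanDiag val
  rw [smul_pow, smul_pow, smul_mul_smul_comm, map_smul, smul_eq_mul, ← pow_add,
    ← colourSum_word_shape, map_colourSum]

/-- By traciality, a diagonal letter at the front may be moved to the end, which keeps the family of
moments closed under the reduction. -/
theorem moment_diag_eq (k j n : ℕ) : moment S a k (j + 1) n =
    ((1 / Real.sqrt n : ℝ) : ℂ) ^ (k + j + 1) * colourSum n (k + j + 1)
      fun i => S.Φ (S.word a (k + j + 1) (shapeDiag (k + 1) i)) := by
  unfold moment mean meanDiag
  rw [← map_colourSum, colourSum_word_shapeDiag, smul_pow, smul_pow, smul_mul_smul_comm, map_smul,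
    smul_eq_mul, ← pow_add, S.tracial (∑ c ∈ Finset.range n, S.diag (a c)), mul_assoc, ← pow_succ,
    ← add_assoc]

theorem isBigO_ite {F : (ℕ → ℕ) → ℂ} (P : (ℕ → ℕ) → Prop) [DecidablePred P]
    (hF : F =O[⊤] fun _ => (1 : ℝ)) :
    (fun i => if P i then F i else 0) =O[⊤] fun _ => (1 : ℝ) := by
  refine (Asymptotics.IsBigO.of_norm_le fun i => ?_).trans hF.norm_left
  split_ifs
  · exact le_rfl
  · simp

theorem sq_mul_natCast {n : ℕ} (hn : 1 ≤ n) : ((1 / Real.sqrt n : ℝ) : ℂ) ^ 2 * n = 1 := by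
  have hn' : (n : ℝ) ≠ 0 := by positivity
  have : (1 / Real.sqrt n : ℝ) ^ 2 * n = 1 := by
    rw [div_pow, Real.sq_sqrt (Nat.cast_nonneg _), one_pow, one_div_mul_cancel hn']
  exact_mod_cast this

variable (h : TrafficIID S a)

include h

theorem isBigO_Φ_word (N : ℕ) (x : (ℕ → ℕ) → ℕ → Bool × ℕ) :
    (fun i => S.Φ (S.word a N (x i))) =O[⊤] fun _ => (1 : ℝ) := by
  obtain ⟨C, -, hC⟩ := h.exists_norm_Φ_word_le N
  exact Asymptotics.isBigO_top.2 ⟨C, fun i => by simpa using hC _⟩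

/-- The expression is the normalized sum over colourings of the defect in `val_sub_eq_sum`, which is
bounded and vanishes unless the colouring is crowded. -/
theorem tendsto_moment_sub (hmean : S.τ₀ loop (fun _ => a 0) = 0) (k j : ℕ) :
    Tendsto (fun n => moment S a (k + 1) j n - moment S a k (j + 1) n -
      (S.τ₀ doubleArrow fun _ => a 0) * ∑ m ∈ Finset.range k,
        moment S a m 0 n * moment S a (k - (m + 1)) j n) atTop (𝓝 0) := by
  set q := S.τ₀ doubleArrow fun _ => a 0 with hq
  let G : ℕ → (ℕ → ℕ) → ℂ := fun m i => if i (m + 1) = i 0 then q *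
        (val S a m m (fun t => i (t + 1)) *
          val S a (k - (m + 1)) (k + j - (m + 1)) fun t => i (t + (m + 2))) else 0
  let F : (ℕ → ℕ) → ℂ := fun i => val S a (k + 1) (k + j + 1) i -
    S.Φ (S.word a (k + j + 1) (shapeDiag (k + 1) i)) - ∑ m ∈ Finset.range k, G m i
  have hF : F =O[⊤] fun _ => (1 : ℝ) := by
    refine ((h.isBigO_Φ_word _ _).sub (h.isBigO_Φ_word _ _)).sub
      (Asymptotics.IsBigO.fun_sum fun m _ => isBigO_ite _ ?_)
    refine Asymptotics.IsBigO.const_mul_left ?_ _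
    exact ((h.isBigO_Φ_word _ _).mul (h.isBigO_Φ_word _ _)).congr_right fun _ => mul_one 1
  have hF0 : ∀ i, ¬ Crowded (k + j + 1) i → F i = 0 := fun i hi =>
    sub_eq_zero.2 (h.val_sub_eq_sum hmean (Nat.le_add_right _ _) hi)
  refine (tendsto_colourSum_of_crowded hF hF0).congr' ?_
  filter_upwards [eventually_ge_atTop 1] with n hn
  simp only [F]
  rw [colourSum_sub, colourSum_sub, mul_sub, mul_sub, ← moment_diag_eq, moment_eq (k + 1),
    colourSum_sum, Nat.succ_add]
  congr 1
  rw [Finset.mul_sum, Finset.mul_sum]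
  refine Finset.sum_congr rfl fun m hm => ?_
  rw [Finset.mem_range] at hm
  obtain ⟨k, rfl⟩ := Nat.exists_eq_add_of_lt hm
  have e₁ : m + k + 1 - (m + 1) = k := by omega
  have e₂ : m + k + 1 + j - (m + 1) = k + j := by omega
  have e₃ : m + k + 1 + j + 1 = m + (k + j) + 2 := by omega
  have hsum : colourSum n (m + (k + j) + 2) (G m) =
      n * (q * (colourSum n m (val S a m m) * colourSum n (k + j) (val S a k (k + j)))) := by
    rw [← colourSum_add_mul n (fun i i' hi => val_congr hi), ← colourSum_const_mul]
    refine colourSum_ite_eq n (Nat.le_add_right _ _) _ _ fun c i => ?_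
    rw [e₁, e₂]
    congr 2
    · exact val_congr fun t ht => insertSeq_of_lt m c i ht
    · refine val_congr fun t ht => ?_
      exact insertSeq_of_ge m c i (Nat.le_add_left m t)
  rw [e₃, hsum, moment_eq, moment_eq, e₁, add_zero]
  -- The n choices of the common colour absorb the two normalizing factors of the suppressed
  -- letters.
  linear_combination (q * ((1 / Real.sqrt n : ℝ) : ℂ) ^ (m + (k + j)) *
    (colourSum n m (val S a m m) * colourSum n (k + j) (val S a k (k + j)))) * sq_mul_natCast hn

/-- The first diagonal letter has j + 1 possible partners, and each of them leads to the same sum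
over the remaining colours. -/
theorem tendsto_moment_diag (hmean : S.τ₀ loop (fun _ => a 0) = 0) (j : ℕ) :
    Tendsto (fun n => moment S a 0 (j + 2) n -
      (j + 1) * (S.τ₀ doubleLoop fun _ => a 0) * moment S a 0 j n) atTop (𝓝 0) := by
  set q := S.τ₀ doubleLoop fun _ => a 0 with hq
  let G : ℕ → (ℕ → ℕ) → ℂ := fun m i => if i (m + 1) = i 0 then q *
        val S a 0 j (fun t => if t < m then i (t + 1) else i (t + 2)) else 0
  let F : (ℕ → ℕ) → ℂ := fun i => val S a 0 (j + 2) i - ∑ m ∈ Finset.range (j + 1), G m i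
  have hF : F =O[⊤] fun _ => (1 : ℝ) := by
    refine (h.isBigO_Φ_word _ _).sub (Asymptotics.IsBigO.fun_sum fun m _ => isBigO_ite _ ?_)
    exact (h.isBigO_Φ_word _ _).const_mul_left _
  have hF0 : ∀ i, ¬ Crowded (j + 1 + 1) i → F i = 0 := fun i hi =>
    sub_eq_zero.2 (h.val_eq_sum hmean hi)
  refine (tendsto_colourSum_of_crowded hF hF0).congr' ?_
  filter_upwards [eventually_ge_atTop 1] with n hn
  simp only [F]
  rw [colourSum_sub, mul_sub, moment_eq, moment_eq, colourSum_sum, Nat.zero_add, Nat.zero_add]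
  congr 1
  have hsum : ∀ m ∈ Finset.range (j + 1), colourSum n (j + 2) (G m) =
      n * (q * colourSum n j (val S a 0 j)) := by
    intro m hm
    rw [Finset.mem_range] at hm
    rw [← colourSum_const_mul]
    refine colourSum_ite_eq n (show m ≤ j by omega) _ _ fun c i => ?_
    congr 1
    refine val_congr fun t ht => ?_
    split_ifs with htm
    · exact insertSeq_of_lt m c i htm
    · exact insertSeq_of_ge m c i (by omega)
  rw [Finset.sum_congr rfl hsum, Finset.sum_const, Finset.card_range, nsmul_eq_mul, Nat.cast_add,
    Nat.cast_one]
  linear_combination ((j + 1) * q * ((1 / Real.sqrt n : ℝ) : ℂ) ^ j *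
    colourSum n j (val S a 0 j)) * sq_mul_natCast hn

/-- The recursion lowers k but may raise j, so the induction on k is made for all j together; the
row k = 0 is a two-step induction on j. -/
theorem tendsto_moment (hmean : ∀ n, S.Φ (a n) = 0) {W : ℕ → ℕ → ℂ} (hW00 : W 0 0 = 1)
    (hW01 : W 0 1 = 0)
    (hW0 : ∀ j, W 0 (j + 2) = (j + 1) * (S.τ₀ doubleLoop fun _ => a 0) * W 0 j)
    (hW : ∀ k j, W (k + 1) j = W k (j + 1) + (S.τ₀ doubleArrow fun _ => a 0) *
      ∑ m ∈ Finset.range k, W m 0 * W (k - (m + 1)) j) (k j : ℕ) :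
    Tendsto (moment S a k j) atTop (𝓝 (W k j)) := by
  have hmean' : S.τ₀ loop (fun _ => a 0) = 0 := by rw [τ₀_loop, hmean]
  induction k using Nat.strong_induction_on generalizing j with
  | _ k ih =>
    rcases k with _ | k
    · induction j using Nat.strong_induction_on with
      | _ j ihj =>
        rcases j with _ | _ | j
        · rw [hW00]
          refine tendsto_const_nhds.congr fun n => ?_
          rw [moment, pow_zero, pow_zero, mul_one, S.map_one]
        · rw [hW01]
          refine tendsto_const_nhds.congr fun n => ?_
          rw [moment, pow_zero, zero_add, pow_one, one_mul, meanDiag, map_smul, map_sum,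
            Finset.sum_eq_zero fun c _ => (Φ_diag c).trans (hmean c), smul_zero]
        · rw [hW0, ← zero_add (_ * W 0 j)]
          refine ((h.tendsto_moment_diag hmean' j).add
            ((ihj j (by omega)).const_mul _)).congr fun n => ?_
          ring
    · have key := (h.tendsto_moment_sub hmean' k j).add ((ih k (by omega) (j + 1)).add
        ((tendsto_finsetSum (Finset.range k) fun m hm =>
          (ih m (by rw [Finset.mem_range] at hm; omega) 0).mul
            (ih (k - (m + 1)) (by omega) j)).const_mul (S.τ₀ doubleArrow fun _ => a 0)))
      rw [hW, ← zero_add (W k (j + 1) + _)]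
      refine key.congr fun n => ?_
      ring

end TrafficIID

end Traffic

end

noncomputable section

namespace Traffic

/-! ### A Fock space -/

/-- The algebraic Fock space, where the basis vector `(n, [n₁, …, n_k])` stands for the tensor
`h_n ⊗ h_{n₁} ⊗ ⋯ ⊗ h_{n_k}` of normalized Hermite polynomials. -/
abbrev Fock : Type := (ℕ × List ℕ) →₀ ℂ

namespace Fock

/-- The basis vectors. -/
def e (i : ℕ × List ℕ) : Fock := Finsupp.single i 1

/-- The vacuum vector. -/
def vac : ℕ × List ℕ := (0, [])

/-- The Hermitian form for which the basis is orthonormal. -/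
def pair (x y : Fock) : ℂ := x.sum fun i c => star c * y i

theorem pair_zero_left (y : Fock) : pair 0 y = 0 := Finsupp.sum_zero_index

theorem pair_add_left (x x' y : Fock) : pair (x + x') y = pair x y + pair x' y :=
  Finsupp.sum_add_index' (fun _ => by simp) fun _ _ _ => by rw [star_add, add_mul]

theorem pair_smul_left (c : ℂ) (x y : Fock) : pair (c • x) y = star c * pair x y := by
  unfold pair
  rw [Finsupp.sum_smul_index (by simp), Finsupp.mul_sum]
  simp_rw [star_mul', mul_assoc]

theorem pair_zero_right (x : Fock) : pair x 0 = 0 := by simp [pair]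

theorem pair_add_right (x y y' : Fock) : pair x (y + y') = pair x y + pair x y' := by
  unfold pair
  rw [← Finsupp.sum_add]
  simp_rw [Finsupp.add_apply, mul_add]

theorem pair_smul_right (c : ℂ) (x y : Fock) : pair x (c • y) = c * pair x y := by
  unfold pair
  rw [Finsupp.mul_sum]
  simp_rw [Finsupp.smul_apply, smul_eq_mul, mul_left_comm]

theorem pair_e_left (i : ℕ × List ℕ) (y : Fock) : pair (e i) y = y i := by
  simp [pair, e]

theorem pair_self_nonneg (x : Fock) : 0 ≤ pair x x :=
  Finset.sum_nonneg fun i _ => star_mul_self_nonneg (x i)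

theorem induction_e {p : Fock → Prop} (x : Fock) (h0 : p 0)
    (hadd : ∀ x y, p x → p y → p (x + y)) (he : ∀ (c : ℂ) i, p (c • e i)) : p x := by
  induction x using Finsupp.induction_linear with
  | zero => exact h0
  | add x y hx hy => exact hadd x y hx hy
  | single i c => simpa [e] using he c i

theorem pair_comm (x y : Fock) : star (pair x y) = pair y x := by
  induction x using induction_e with
  | h0 => simp [pair_zero_left, pair_zero_right]
  | hadd x x' hx hx' => rw [pair_add_left, pair_add_right, star_add, hx, hx']
  | he c i =>
    rw [pair_smul_left, pair_smul_right, star_mul', star_star, pair_e_left]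
    congr 1
    induction y using induction_e with
    | h0 => simp [pair_zero_left]
    | hadd y y' hy hy' => rw [pair_add_left, Finsupp.add_apply, star_add, hy, hy']
    | he c' j =>
      rw [pair_smul_left, pair_e_left, Finsupp.smul_apply, smul_eq_mul, star_mul']
      congr 1
      by_cases hij : i = j
      · simp [hij, e]
      · simp [e, hij, Ne.symm hij]

/-- `T'` is a formal adjoint of `T`. -/
def IsAdj (T T' : Module.End ℂ Fock) : Prop := ∀ x y, pair (T x) y = pair x (T' y)

theorem IsAdj.unique {T T₁ T₂ : Module.End ℂ Fock} (h₁ : IsAdj T T₁) (h₂ : IsAdj T T₂) :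
    T₁ = T₂ := by
  refine LinearMap.ext fun y => Finsupp.ext fun i => ?_
  rw [← pair_e_left, ← pair_e_left, ← h₁, ← h₂]

theorem IsAdj.symm {T T' : Module.End ℂ Fock} (h : IsAdj T T') : IsAdj T' T := fun x y => by
  rw [← pair_comm, ← h, pair_comm]

theorem IsAdj.add {T₁ T₁' T₂ T₂' : Module.End ℂ Fock} (h₁ : IsAdj T₁ T₁') (h₂ : IsAdj T₂ T₂') :
    IsAdj (T₁ + T₂) (T₁' + T₂') := fun x y => by
  rw [LinearMap.add_apply, LinearMap.add_apply, pair_add_left, pair_add_right, h₁, h₂]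

theorem IsAdj.mul {T₁ T₁' T₂ T₂' : Module.End ℂ Fock} (h₁ : IsAdj T₁ T₁') (h₂ : IsAdj T₂ T₂') :
    IsAdj (T₁ * T₂) (T₂' * T₁') := fun x y => by
  rw [Module.End.mul_apply, Module.End.mul_apply, h₁, h₂]

theorem IsAdj.smul (c : ℂ) {T T' : Module.End ℂ Fock} (h : IsAdj T T') :
    IsAdj (c • T) (star c • T') := fun x y => by
  rw [LinearMap.smul_apply, LinearMap.smul_apply, pair_smul_left, pair_smul_right, h]

theorem IsAdj.one : IsAdj 1 1 := fun _ _ => rfl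

theorem isAdj_of_basis {T T' : Module.End ℂ Fock}
    (h : ∀ i j, star (T (e i) j) = T' (e j) i) : IsAdj T T' := by
  intro x y
  induction x using induction_e with
  | h0 => simp [pair_zero_left]
  | hadd x x' hx hx' => rw [map_add, pair_add_left, pair_add_left, hx, hx']
  | he c i =>
    rw [map_smul, pair_smul_left, pair_smul_left, pair_e_left]
    congr 1
    induction y using induction_e with
    | h0 => simp [pair_zero_right]
    | hadd y y' hy hy' => rw [map_add, pair_add_right, hy, hy', Finsupp.add_apply]
    | he c' j =>
      rw [map_smul, pair_smul_right, Finsupp.smul_apply, smul_eq_mul, ← pair_comm, pair_e_left, h]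

/-- The linear map with prescribed values on the basis. -/
def ofBasis (f : ℕ × List ℕ → Fock) : Module.End ℂ Fock := Finsupp.linearCombination ℂ f

theorem ofBasis_e (f : ℕ × List ℕ → Fock) (i : ℕ × List ℕ) : ofBasis f (e i) = f i := by
  simp [ofBasis, e]

theorem ext_e {M : Type*} [AddCommMonoid M] [Module ℂ M] {T T' : Fock →ₗ[ℂ] M}
    (h : ∀ i, T (e i) = T' (e i)) : T = T' :=
  Finsupp.lhom_ext' fun i => LinearMap.ext_ring (h i)

/-- The square root, as a complex number. -/
def root (n : ℕ) : ℂ := (Real.sqrt n : ℝ)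

theorem root_mul_self (n : ℕ) : root n * root n = n := by
  unfold root
  exact_mod_cast congrArg (Complex.ofReal) (Real.mul_self_sqrt (Nat.cast_nonneg n))

theorem root_zero : root 0 = 0 := by simp [root]

theorem star_root (n : ℕ) : star (root n) = root n := Complex.conj_ofReal _

/-- The creation operator on the first tensor. -/
def up : Module.End ℂ Fock := ofBasis fun i => root (i.1 + 1) • e (i.1 + 1, i.2)

/-- The annihilation operator on the first tensor. -/
def down : Module.End ℂ Fock := ofBasis fun i => root i.1 • e (i.1 - 1, i.2)

/-- The operator that appends a tensor on the left. -/
def push : Module.End ℂ Fock := ofBasis fun i => e (0, i.1 :: i.2)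

/-- The adjoint of `push`. -/
def pop : Module.End ℂ Fock := ofBasis fun
  | (0, n :: M) => e (n, M)
  | _ => 0

/-- The operator that removes a tensor on the right. -/
def popRight : Module.End ℂ Fock := ofBasis fun i =>
  if i.2.getLast? = some 0 then e (i.1, i.2.dropLast) else 0

/-- The Gaussian operator. -/
def gauss : Module.End ℂ Fock := up + down

/-- The semicircular operator. -/
def semi : Module.End ℂ Fock := push + pop

theorem up_e (n : ℕ) (M : List ℕ) : up (e (n, M)) = root (n + 1) • e (n + 1, M) :=
  ofBasis_e _ _

theorem down_e_succ (n : ℕ) (M : List ℕ) : down (e (n + 1, M)) = root (n + 1) • e (n, M) :=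
  ofBasis_e _ _

theorem down_e_zero (M : List ℕ) : down (e (0, M)) = 0 :=
  (ofBasis_e _ _).trans (by simp [root_zero])

theorem push_e (n : ℕ) (M : List ℕ) : push (e (n, M)) = e (0, n :: M) := ofBasis_e _ _

theorem pop_e_cons (n : ℕ) (M : List ℕ) : pop (e (0, n :: M)) = e (n, M) := ofBasis_e _ _

theorem pop_e_nil (n : ℕ) : pop (e (n, [])) = 0 := by
  cases n <;> exact ofBasis_e _ _

theorem pop_e_succ (n : ℕ) (M : List ℕ) : pop (e (n + 1, M)) = 0 := ofBasis_e _ _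

theorem popRight_e_nil (n : ℕ) : popRight (e (n, [])) = 0 := (ofBasis_e _ _).trans (by simp)

theorem popRight_e_zero (n : ℕ) (M : List ℕ) : popRight (e (n, M ++ [0])) = e (n, M) :=
  (ofBasis_e _ _).trans (by simp)

theorem popRight_e_succ (n m : ℕ) (M : List ℕ) : popRight (e (n, M ++ [m + 1])) = 0 :=
  (ofBasis_e _ _).trans (by simp)

theorem e_apply (i j : ℕ × List ℕ) : e i j = if i = j then 1 else 0 := Finsupp.single_apply

theorem isAdj_up_down : IsAdj up down := by
  refine isAdj_of_basis ?_
  rintro ⟨n, M⟩ ⟨m, L⟩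
  rw [up_e]
  cases m with
  | zero => simp [down_e_zero, e_apply]
  | succ m =>
    rw [down_e_succ]
    simp only [Finsupp.smul_apply, smul_eq_mul, star_mul', star_root, e_apply, Prod.mk.injEq,
      Nat.add_right_cancel_iff]
    by_cases h : n = m ∧ M = L
    · rw [if_pos h, if_pos ⟨h.1.symm, h.2.symm⟩, h.1, star_one]
    · rw [if_neg h, if_neg fun h' => h ⟨h'.1.symm, h'.2.symm⟩, star_zero, mul_zero, mul_zero]

theorem isAdj_push_pop : IsAdj push pop := by
  refine isAdj_of_basis ?_
  rintro ⟨n, M⟩ ⟨m, L⟩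
  rw [push_e]
  rcases m with _ | m
  · rcases L with _ | ⟨m, L⟩
    · simp [pop_e_nil, e_apply]
    · rw [pop_e_cons]
      simp only [e_apply, Prod.mk.injEq, true_and, List.cons.injEq]
      by_cases h : n = m ∧ M = L
      · rw [if_pos h, if_pos ⟨h.1.symm, h.2.symm⟩, star_one]
      · rw [if_neg h, if_neg fun h' => h ⟨h'.1.symm, h'.2.symm⟩, star_zero]
  · simp [pop_e_succ, e_apply]

theorem isAdj_gauss : IsAdj gauss gauss := by
  have h := isAdj_up_down.add isAdj_up_down.symm
  rwa [add_comm down up] at h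

theorem isAdj_semi : IsAdj semi semi := by
  have h := isAdj_push_pop.add isAdj_push_pop.symm
  rwa [add_comm pop push] at h

/-- The canonical commutation relation, with the square-root weights of normalized Hermite
polynomials. -/
theorem down_mul_gauss : down * gauss = gauss * down + 1 := by
  refine ext_e ?_
  rintro ⟨n, M⟩
  simp only [gauss, Module.End.mul_apply, LinearMap.add_apply, Module.End.one_apply, map_add,
    up_e, map_smul, down_e_succ, smul_smul, root_mul_self]
  rcases n with _ | _ | n
  · simp [down_e_zero]
  · simp only [zero_add, down_e_succ, map_smul, down_e_zero, up_e, smul_smul, add_zero,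
      smul_zero, root_mul_self]
    push_cast
    module
  · simp only [down_e_succ, map_smul, up_e, smul_smul, root_mul_self]
    push_cast
    module

/-- The projection on the vacuum vector. -/
def projVac : Module.End ℂ Fock := ofBasis fun i => if i = vac then e vac else 0

theorem projVac_apply (x : Fock) : projVac x = x vac • e vac := by
  induction x using induction_e with
  | h0 => simp
  | hadd x y hx hy => rw [map_add, hx, hy, Finsupp.add_apply, add_smul]
  | he c i =>
    rw [map_smul, projVac, ofBasis_e, Finsupp.smul_apply, e_apply, smul_eq_mul, mul_smul]
    split_ifs <;> simp

/-- One operator acts on the last tensor of the list, the other on the tensor outside the list. -/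
theorem popRight_mul_gauss : popRight * gauss = gauss * popRight := by
  refine ext_e ?_
  rintro ⟨n, M⟩
  simp only [gauss, Module.End.mul_apply, LinearMap.add_apply, map_add, up_e, map_smul]
  rcases List.eq_nil_or_concat M with rfl | ⟨M, m, rfl⟩
  · rcases n with _ | n <;> simp [popRight_e_nil, down_e_zero, down_e_succ]
  · rcases m with _ | m <;> rcases n with _ | n <;>
      simp [popRight_e_zero, popRight_e_succ, down_e_zero, down_e_succ, up_e]

/-- Actions on the left and on the right commute except on the vacuum, where the tensor pushed on
the left is also the last one on the right. This rank one defect produces the product of moments in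
the Schwinger-Dyson equation. -/
theorem popRight_mul_semi : popRight * semi = semi * popRight + projVac := by
  refine ext_e ?_
  rintro ⟨n, M⟩
  rw [LinearMap.add_apply, projVac_apply]
  simp only [semi, Module.End.mul_apply, LinearMap.add_apply, map_add, push_e]
  rcases List.eq_nil_or_concat M with rfl | ⟨M, m, rfl⟩
  · rw [popRight_e_nil, pop_e_nil]
    rcases n with _ | n
    · rw [show ([0] : List ℕ) = [] ++ [0] from rfl, popRight_e_zero]
      simp [vac, e_apply]
    · rw [show ([n + 1] : List ℕ) = [] ++ [n + 1] from rfl, popRight_e_succ]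
      simp [vac, e_apply]
  · have h0 : e (n, M.concat m) vac = 0 := by simp [vac, e_apply]
    rw [h0, List.concat_eq_append, ← List.cons_append]
    rcases m with _ | m
    · rw [popRight_e_zero, popRight_e_zero, push_e]
      rcases n with _ | n
      · rcases M with _ | ⟨k, M⟩
        · simp [pop_e_cons, popRight_e_nil, pop_e_nil]
        · rw [List.cons_append, pop_e_cons, pop_e_cons, popRight_e_zero]
          simp
      · simp [pop_e_succ]
    · rw [popRight_e_succ, popRight_e_succ]
      rcases n with _ | n
      · rcases M with _ | ⟨k, M⟩
        · simp [pop_e_cons, popRight_e_nil]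
        · rw [List.cons_append, pop_e_cons, popRight_e_succ]
          simp
      · simp [pop_e_succ]

theorem gauss_apply_vac (x : Fock) : gauss x vac = down x vac := by
  refine LinearMap.congr_fun (f := Finsupp.lapply vac ∘ₗ gauss) (g := Finsupp.lapply vac ∘ₗ down)
    (ext_e ?_) x
  rintro ⟨n, M⟩
  simp [gauss, up_e, vac, e_apply]

/-- Both sides read the coefficient of `(0, [0])`, the only basis vector from which a removal on
either side reaches the vacuum. -/
theorem semi_apply_vac (x : Fock) : semi x vac = popRight x vac := by
  refine LinearMap.congr_fun (f := Finsupp.lapply vac ∘ₗ semi)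
    (g := Finsupp.lapply vac ∘ₗ popRight) (ext_e ?_) x
  rintro ⟨n, M⟩
  simp only [semi, LinearMap.comp_apply, LinearMap.add_apply, push_e, map_add, Finsupp.lapply_apply]
  rw [show e (0, n :: M) vac = 0 by simp [vac, e_apply], zero_add]
  rcases List.eq_nil_or_concat M with rfl | ⟨M, m, rfl⟩
  · rw [pop_e_nil, popRight_e_nil]
  · rw [List.concat_eq_append]
    rcases n with _ | n
    · rcases M with _ | ⟨k, M⟩
      · rw [List.nil_append, pop_e_cons]
        rcases m with _ | m
        · rw [show ([0] : List ℕ) = [] ++ [0] from rfl, popRight_e_zero]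
        · rw [show ([m + 1] : List ℕ) = [] ++ [m + 1] from rfl, popRight_e_succ]
          simp [vac, e_apply]
      · rcases m with _ | m
        · rw [popRight_e_zero, List.cons_append, pop_e_cons]
          simp [vac, e_apply]
        · rw [popRight_e_succ, List.cons_append, pop_e_cons]
          simp [vac, e_apply]
    · rw [pop_e_succ]
      rcases m with _ | m
      · rw [popRight_e_zero]
        simp [vac, e_apply]
      · rw [popRight_e_succ]

/-! ### Moments in the vacuum state -/

theorem gauss_pow_apply_vac (k : ℕ) :
    (gauss ^ (k + 2)) (e vac) vac = (k + 1) * (gauss ^ k) (e vac) vac := by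
  have key : ∀ k : ℕ, down ((gauss ^ (k + 1)) (e vac)) = ((k : ℂ) + 1) • (gauss ^ k) (e vac) := by
    intro k
    induction k with
    | zero =>
      rw [zero_add, pow_one, ← Module.End.mul_apply, down_mul_gauss, LinearMap.add_apply,
        Module.End.mul_apply, vac, down_e_zero]
      simp
    | succ k ih =>
      rw [pow_succ', Module.End.mul_apply, ← Module.End.mul_apply, down_mul_gauss,
        LinearMap.add_apply, Module.End.mul_apply, ih, map_smul, ← Module.End.mul_apply,
        ← pow_succ', Module.End.one_apply]
      push_cast
      module
  rw [pow_succ', Module.End.mul_apply, gauss_apply_vac, key, Finsupp.smul_apply, smul_eq_mul]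

theorem gauss_apply_e_vac : gauss (e vac) vac = 0 := by
  rw [gauss_apply_vac, vac, down_e_zero, Finsupp.zero_apply]

/-- A Schwinger-Dyson equation. -/
theorem semi_mul_pow_apply_vac (α β : ℂ) (k j : ℕ) :
    (semi * ((α • gauss + β • semi) ^ k * gauss ^ j)) (e vac) vac =
      β * ∑ m ∈ Finset.range k, ((α • gauss + β • semi) ^ m) (e vac) vac *
        ((α • gauss + β • semi) ^ (k - (m + 1)) * gauss ^ j) (e vac) vac := by
  set T := α • gauss + β • semi with hT
  have hcomm : popRight * T = T * popRight + β • projVac := by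
    rw [hT, mul_add, add_mul, mul_smul_comm, mul_smul_comm, popRight_mul_gauss, popRight_mul_semi,
      smul_mul_assoc, smul_mul_assoc, smul_add, add_assoc]
  have hg : ∀ j : ℕ, popRight ((gauss ^ j) (e vac)) = 0 := by
    intro j
    induction j with
    | zero => exact popRight_e_nil 0
    | succ j ih =>
      rw [pow_succ', Module.End.mul_apply, ← Module.End.mul_apply, popRight_mul_gauss,
        Module.End.mul_apply, ih, map_zero]
  -- As `popRight` moves to the right through the powers of `T`, each factor leaves a vacuum
  -- projection that splits the product in two; finally it annihilates the Gaussian vectors, whose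
  -- list is empty.
  have key : ∀ k : ℕ, popRight ((T ^ k * gauss ^ j) (e vac)) =
      β • ∑ m ∈ Finset.range k, ((T ^ (k - (m + 1)) * gauss ^ j) (e vac) vac) •
        (T ^ m) (e vac) := by
    intro k
    induction k with
    | zero => simpa using hg j
    | succ k ih =>
      rw [pow_succ', mul_assoc, Module.End.mul_apply, ← Module.End.mul_apply, hcomm,
        LinearMap.add_apply, Module.End.mul_apply, ih, LinearMap.smul_apply, projVac_apply,
        Finset.sum_range_succ', map_smul, map_sum, ← smul_add]
      congr 2
      · refine Finset.sum_congr rfl fun m hm => ?_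
        rw [map_smul, ← Module.End.mul_apply, ← pow_succ', Nat.add_sub_add_right]
  rw [Module.End.mul_apply, semi_apply_vac, key, Finsupp.smul_apply, Finsupp.finsetSum_apply,
    smul_eq_mul]
  congr 1
  refine Finset.sum_congr rfl fun m _ => ?_
  rw [Finsupp.smul_apply, smul_eq_mul, mul_comm]

end Fock

end Traffic

end

noncomputable section

namespace Traffic

open Polynomial

/-! ### Freeness of elements with respect to a linear form -/

section Free

variable {I : Type} {B : Type*} [Ring B] [Algebra ℂ B]

/-- The product of polynomials in the elements `x i`. -/
def polyProd (x : I → B) (l : List (I × ℂ[X])) : B :=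
  (l.map fun p => aeval (x p.1) p.2).prod

/-- An alternating list of centred polynomials. -/
structure IsReduced (φ : B →ₗ[ℂ] ℂ) (x : I → B) (l : List (I × ℂ[X])) : Prop where
  chain : (l.map Prod.fst).IsChain (· ≠ ·)
  centred : ∀ p ∈ l, φ (aeval (x p.1) p.2) = 0

/-- Freeness of the elements `x i` for the linear form `φ`. -/
def IsFree (φ : B →ₗ[ℂ] ℂ) (x : I → B) : Prop :=
  ∀ l : List (I × ℂ[X]), l ≠ [] → IsReduced φ x l → φ (polyProd x l) = 0

variable {φ : B →ₗ[ℂ] ℂ} {x : I → B}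

theorem polyProd_nil : polyProd x [] = 1 := rfl

theorem polyProd_cons (p : I × ℂ[X]) (l : List (I × ℂ[X])) :
    polyProd x (p :: l) = aeval (x p.1) p.2 * polyProd x l := List.prod_cons

theorem polyProd_concat (p : I × ℂ[X]) (l : List (I × ℂ[X])) :
    polyProd x (l ++ [p]) = polyProd x l * aeval (x p.1) p.2 := by
  simp [polyProd]

theorem isReduced_nil : IsReduced φ x [] := ⟨List.IsChain.nil, fun p hp => by simp at hp⟩

theorem map_aeval_sub_C (hφ : φ 1 = 1) (i : I) (P : ℂ[X]) :
    φ (aeval (x i) (P - C (φ (aeval (x i) P)))) = 0 := by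
  rw [map_sub, aeval_C, Algebra.algebraMap_eq_smul_one, map_sub, map_smul, hφ, smul_eq_mul,
    mul_one, sub_self]

theorem aeval_mul_eq (i : I) (P : ℂ[X]) (c : ℂ) (b : B) :
    aeval (x i) P * b = c • b + aeval (x i) (P - C c) * b := by
  rw [map_sub, aeval_C, sub_mul, Algebra.smul_def]
  abel

theorem mul_aeval_eq (i : I) (P : ℂ[X]) (c : ℂ) (b : B) :
    b * aeval (x i) P = c • b + b * aeval (x i) (P - C c) := by
  rw [map_sub, aeval_C, mul_sub, Algebra.smul_def, Algebra.commutes]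
  abel

variable (φ x) in
/-- The span of the products of alternating centred polynomials. -/
def reducedSpan : Submodule ℂ B := Submodule.span ℂ {b | ∃ l, IsReduced φ x l ∧ polyProd x l = b}

theorem IsReduced.cons {i : I} {P : ℂ[X]} {l : List (I × ℂ[X])} (hl : IsReduced φ x l)
    (hi : ∀ j ∈ (l.map Prod.fst).head?, i ≠ j) (hP : φ (aeval (x i) P) = 0) :
    IsReduced φ x ((i, P) :: l) := by
  refine ⟨?_, ?_⟩
  · rw [List.map_cons, List.isChain_cons]
    exact ⟨hi, hl.chain⟩
  · intro p hp
    rcases List.mem_cons.1 hp with rfl | hp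
    · exact hP
    · exact hl.centred p hp

theorem aeval_mul_polyProd_mem (hφ : φ 1 = 1) {i : I} (P : ℂ[X]) {l : List (I × ℂ[X])}
    (hl : IsReduced φ x l) (hi : ∀ j ∈ (l.map Prod.fst).head?, i ≠ j) :
    aeval (x i) P * polyProd x l ∈ reducedSpan φ x := by
  rw [aeval_mul_eq i P (φ (aeval (x i) P))]
  refine add_mem (Submodule.smul_mem _ _ (Submodule.subset_span ⟨l, hl, rfl⟩))
    (Submodule.subset_span ⟨_, hl.cons hi (map_aeval_sub_C hφ i P), polyProd_cons _ _⟩)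

theorem IsReduced.tail {p : I × ℂ[X]} {l : List (I × ℂ[X])} (h : IsReduced φ x (p :: l)) :
    IsReduced φ x l ∧ ∀ j ∈ (l.map Prod.fst).head?, p.1 ≠ j := by
  have hc := h.chain
  rw [List.map_cons, List.isChain_cons] at hc
  exact ⟨⟨hc.2, fun q hq => h.centred q (List.mem_cons_of_mem _ hq)⟩, hc.1⟩

theorem mul_polyProd_cons (i : I) (P : ℂ[X]) (l : List (I × ℂ[X])) :
    x i * polyProd x ((i, P) :: l) = aeval (x i) (X * P) * polyProd x l := by
  rw [polyProd_cons, map_mul, aeval_X, mul_assoc]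

/-- A new generator either merges with the first factor or becomes a new one; subtracting its mean
restores centring at the cost of a shorter reduced product. -/
theorem mul_mem_reducedSpan (hφ : φ 1 = 1) (i : I) {b : B} (hb : b ∈ reducedSpan φ x) :
    x i * b ∈ reducedSpan φ x := by
  induction hb using Submodule.span_induction with
  | mem b hb =>
    obtain ⟨l, hl, rfl⟩ := hb
    rcases l with _ | ⟨⟨j, P⟩, l⟩
    · have := aeval_mul_polyProd_mem hφ (i := i) X hl (by simp)
      rwa [aeval_X] at this
    · by_cases hij : i = j
      · subst hij
        rw [mul_polyProd_cons]
        exact aeval_mul_polyProd_mem hφ _ hl.tail.1 hl.tail.2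
      · have := aeval_mul_polyProd_mem hφ (i := i) X hl (by simpa using hij)
        rwa [aeval_X] at this
  | zero => rw [mul_zero]; exact zero_mem _
  | add b b' _ _ hb hb' => rw [mul_add]; exact add_mem hb hb'
  | smul c b _ hb => rw [mul_smul_comm]; exact Submodule.smul_mem _ _ hb

theorem lift_mem_reducedSpan (hφ : φ 1 = 1) (w : FreeAlgebra ℂ I) :
    FreeAlgebra.lift ℂ x w ∈ reducedSpan φ x := by
  suffices h : ∀ b ∈ reducedSpan φ x, FreeAlgebra.lift ℂ x w * b ∈ reducedSpan φ x by
    simpa using h 1 (Submodule.subset_span ⟨[], isReduced_nil, rfl⟩)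
  induction w with
  | grade0 r =>
    intro b hb
    rw [AlgHom.commutes, ← Algebra.smul_def]
    exact Submodule.smul_mem _ _ hb
  | grade1 i =>
    intro b hb
    rw [FreeAlgebra.lift_ι_apply]
    exact mul_mem_reducedSpan hφ i hb
  | mul w w' hw hw' =>
    intro b hb
    rw [map_mul, mul_assoc]
    exact hw _ (hw' _ hb)
  | add w w' hw hw' =>
    intro b hb
    rw [map_add, add_mul]
    exact add_mem (hw _ hb) (hw' _ hb)

/-- With at least two factors, even after a merger and centring, the remaining reduced products are
nonempty, so freeness gives zero. -/
theorem IsFree.map_mul_eq_zero (h : IsFree φ x) (hφ : φ 1 = 1) (hx : ∀ i, φ (x i) = 0) (i : I)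
    {p q : I × ℂ[X]} {l : List (I × ℂ[X])} (hl : IsReduced φ x (p :: q :: l)) :
    φ (x i * polyProd x (p :: q :: l)) = 0 := by
  obtain ⟨j, P⟩ := p
  by_cases hij : i = j
  · subst hij
    rw [mul_polyProd_cons, aeval_mul_eq i _ (φ (aeval (x i) (X * P))), map_add, map_smul,
      h _ (List.cons_ne_nil _ _) hl.tail.1, smul_zero, zero_add]
    exact h ((i, _) :: q :: l) (List.cons_ne_nil _ _)
      (hl.tail.1.cons hl.tail.2 (map_aeval_sub_C hφ i _))
  · have := h ((i, X) :: (j, P) :: q :: l) (List.cons_ne_nil _ _)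
      (hl.cons (by simpa using hij) (by simpa using hx i))
    rwa [polyProd_cons, aeval_X] at this

theorem IsReduced.concat_iff {j : I} {P : ℂ[X]} {l : List (I × ℂ[X])} :
    IsReduced φ x (l ++ [(j, P)]) ↔ IsReduced φ x l ∧
      (∀ k ∈ (l.map Prod.fst).getLast?, k ≠ j) ∧ φ (aeval (x j) P) = 0 := by
  constructor
  · intro h
    have hc := h.chain
    rw [List.map_append, List.isChain_append] at hc
    exact ⟨⟨hc.1, fun p hp => h.centred p (by simp [hp])⟩,
      fun k hk => hc.2.2 k hk j (by simp), h.centred (j, P) (by simp)⟩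
  · rintro ⟨h, hl, hP⟩
    refine ⟨?_, ?_⟩
    · rw [List.map_append, List.isChain_append]
      refine ⟨h.chain, List.IsChain.singleton _, fun k hk j' hj' => ?_⟩
      simp only [List.map_cons, List.map_nil, List.head?_cons, Option.mem_some_iff] at hj'
      exact hj' ▸ hl k hk
    · intro p hp
      rcases List.mem_append.1 hp with hp | hp
      · exact h.centred p hp
      · rw [List.mem_singleton.1 hp]
        exact hP

theorem IsFree.map_mul_eq_zero' (h : IsFree φ x) (hφ : φ 1 = 1) (hx : ∀ i, φ (x i) = 0) (i : I)
    {p : I × ℂ[X]} {l : List (I × ℂ[X])} (hl0 : l ≠ []) (hl : IsReduced φ x (l ++ [p])) :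
    φ (polyProd x (l ++ [p]) * x i) = 0 := by
  obtain ⟨j, P⟩ := p
  have hl' := IsReduced.concat_iff.1 hl
  by_cases hij : i = j
  · subst hij
    have e : polyProd x (l ++ [(i, P)]) * x i = polyProd x l * aeval (x i) (P * X) := by
      rw [polyProd_concat, map_mul, aeval_X, mul_assoc]
    rw [e, mul_aeval_eq i _ (φ (aeval (x i) (P * X))), map_add, map_smul, h _ hl0 hl'.1, smul_zero,
      zero_add, ← polyProd_concat (i, _)]
    exact h _ (by simp) (IsReduced.concat_iff.2 ⟨hl'.1, hl'.2.1, map_aeval_sub_C hφ i _⟩)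
  · have := h (l ++ [(j, P)] ++ [(i, X)]) (by simp)
      (IsReduced.concat_iff.2 ⟨hl, by simpa using Ne.symm hij, by simpa using hx i⟩)
    rwa [polyProd_concat, aeval_X] at this

/-- It suffices to move one generator across a reduced product. With two or more factors, or one
factor of another index, both sides vanish; with one factor of the same index the elements commute.
-/
theorem IsFree.map_mul_comm (h : IsFree φ x) (hφ : φ 1 = 1) (hx : ∀ i, φ (x i) = 0)
    (w w' : FreeAlgebra ℂ I) :
    φ (FreeAlgebra.lift ℂ x w * FreeAlgebra.lift ℂ x w') =
      φ (FreeAlgebra.lift ℂ x w' * FreeAlgebra.lift ℂ x w) := by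
  have key : ∀ i, ∀ b ∈ reducedSpan φ x, φ (x i * b) = φ (b * x i) := by
    intro i b hb
    induction hb using Submodule.span_induction with
    | mem b hb =>
      obtain ⟨l, hl, rfl⟩ := hb
      rcases l with _ | ⟨⟨j, P⟩, _ | ⟨q, l⟩⟩
      · rw [polyProd_nil, mul_one, one_mul]
      · by_cases hij : i = j
        · subst hij
          have e : polyProd x [(i, P)] = aeval (x i) P := by simp [polyProd]
          rw [e]
          congr 1
          have : Commute (aeval (x i) (X : ℂ[X])) (aeval (x i) P) := by
            rw [Commute, SemiconjBy, ← map_mul, ← map_mul, mul_comm]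
          rwa [aeval_X] at this
        · have e₁ := h [(i, X), (j, P)] (by simp)
            (hl.cons (by simpa using hij) (by simpa using hx i))
          have e₂ := h ([(j, P)] ++ [(i, X)]) (by simp)
            (IsReduced.concat_iff.2 ⟨hl, by simpa using Ne.symm hij, by simpa using hx i⟩)
          rw [polyProd_cons, aeval_X] at e₁
          rw [polyProd_concat, aeval_X] at e₂
          rw [e₁, e₂]
      · rw [h.map_mul_eq_zero hφ hx i hl]
        obtain ⟨l', p', hl'⟩ := List.eq_nil_or_concat (q :: l) |>.resolve_left (by simp)
        rw [hl', List.concat_eq_append, ← List.cons_append] at hl ⊢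
        rw [h.map_mul_eq_zero' hφ hx i (List.cons_ne_nil _ _) hl]
    | zero => simp
    | add b b' _ _ hb hb' => rw [mul_add, add_mul, map_add, map_add, hb, hb']
    | smul c b _ hb => rw [mul_smul_comm, smul_mul_assoc, map_smul, map_smul, hb]
  induction w generalizing w' with
  | grade0 r => rw [AlgHom.commutes, Algebra.commutes]
  | grade1 i => rw [FreeAlgebra.lift_ι_apply]; exact key i _ (lift_mem_reducedSpan hφ w')
  | mul w₁ w₂ h₁ h₂ =>
    have e₁ := h₁ (w₂ * w')
    have e₂ := h₂ (w' * w₁)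
    rw [map_mul (FreeAlgebra.lift ℂ x)] at e₁ e₂
    rw [map_mul (FreeAlgebra.lift ℂ x), mul_assoc, e₁, mul_assoc, e₂, mul_assoc]
  | add w₁ w₂ h₁ h₂ => rw [map_add, add_mul, mul_add, map_add, map_add, h₁, h₂]

theorem lift_polyProd (x : I → B) (l : List (I × ℂ[X])) :
    FreeAlgebra.lift ℂ x (polyProd (FreeAlgebra.ι ℂ) l) = polyProd x l := by
  rw [polyProd, polyProd, map_list_prod, List.map_map]
  congr 2
  funext p
  rw [Function.comp_apply, ← aeval_algHom_apply, FreeAlgebra.lift_ι_apply]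

/-- Joint moments of free elements are determined by the moments of each element. -/
theorem IsFree.map_lift_eq {B' : Type*} [Ring B'] [Algebra ℂ B'] {φ' : B' →ₗ[ℂ] ℂ} {x' : I → B'}
    (h : IsFree φ x) (h' : IsFree φ' x') (hφ : φ 1 = 1) (hφ' : φ' 1 = 1)
    (hx : ∀ i k, φ (x i ^ k) = φ' (x' i ^ k)) (w : FreeAlgebra ℂ I) :
    φ (FreeAlgebra.lift ℂ x w) = φ' (FreeAlgebra.lift ℂ x' w) := by
  have hpoly : ∀ i (P : ℂ[X]), φ (aeval (x i) P) = φ' (aeval (x' i) P) := by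
    intro i P
    induction P using Polynomial.induction_on' with
    | add P Q hP hQ => rw [map_add, map_add, map_add, map_add, hP, hQ]
    | monomial n c =>
      rw [aeval_monomial, aeval_monomial, ← Algebra.smul_def, ← Algebra.smul_def, map_smul,
        map_smul, hx]
  -- The decomposition into reduced products is made in the free algebra, for the pulled-back form,
  -- so that the same combination can be evaluated on both sides.
  have hw := lift_mem_reducedSpan (φ := φ ∘ₗ (FreeAlgebra.lift ℂ x).toLinearMap)
    (x := FreeAlgebra.ι ℂ) (by simpa using hφ) w
  rw [show FreeAlgebra.lift ℂ (FreeAlgebra.ι ℂ) = AlgHom.id ℂ (FreeAlgebra ℂ I) from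
    FreeAlgebra.hom_ext (by ext; simp), AlgHom.id_apply] at hw
  induction hw using Submodule.span_induction with
  | mem w hw =>
    obtain ⟨l, hl, rfl⟩ := hw
    have hc : ∀ p ∈ l, φ (aeval (x p.1) p.2) = 0 := fun p hp => by
      have := hl.centred p hp
      rwa [LinearMap.comp_apply, AlgHom.toLinearMap_apply, ← aeval_algHom_apply,
        FreeAlgebra.lift_ι_apply] at this
    rw [lift_polyProd, lift_polyProd]
    by_cases hl0 : l = []
    · rw [hl0, polyProd_nil, polyProd_nil, hφ, hφ']
    · rw [h l hl0 ⟨hl.chain, hc⟩, h' l hl0 ⟨hl.chain, fun p hp => (hpoly _ _).symm.trans (hc p hp)⟩]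
  | zero => simp
  | add w w' _ _ hw hw' => rw [map_add, map_add, map_add, map_add, hw, hw']
  | smul c w _ hw => rw [map_smul, map_smul, map_smul, map_smul, hw]

end Free

end Traffic

end

/-! ### The vacuum state: freeness, traciality and positivity -/

noncomputable section

namespace Traffic

open Polynomial

namespace Fock

/-- The vacuum state. -/
def vacState : Module.End ℂ Fock →ₗ[ℂ] ℂ := Finsupp.lapply vac ∘ₗ LinearMap.applyₗ (e vac)

theorem vacState_apply (T : Module.End ℂ Fock) : vacState T = T (e vac) vac := rfl

theorem vacState_one : vacState 1 = 1 := by simp [vacState_apply, e_apply]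

/-- If `T` acts on the index n uniformly in the parameter v, so does every polynomial in `T`: the
span of the functions `F n` is invariant. -/
theorem exists_coeff {ι : Type*} {T : Module.End ℂ Fock} {F : ℕ → ι → Fock}
    (hT : ∀ n, ∃ c : ℕ →₀ ℂ, ∀ v, T (F n v) = Finsupp.linearCombination ℂ (fun k => F k v) c)
    (P : ℂ[X]) :
    ∃ c : ℕ →₀ ℂ, ∀ v, aeval T P (F 0 v) = Finsupp.linearCombination ℂ (fun k => F k v) c := by
  have hsum : ∀ (c : ℕ →₀ ℂ) v, Finsupp.linearCombination ℂ F c v =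
      Finsupp.linearCombination ℂ (fun k => F k v) c := by
    intro c v
    rw [Finsupp.linearCombination_apply, Finsupp.sum, Finset.sum_apply]
    rfl
  have hinv : ∀ f ∈ Submodule.span ℂ (Set.range F),
      (fun v => T (f v)) ∈ Submodule.span ℂ (Set.range F) := by
    intro f hf
    induction hf using Submodule.span_induction with
    | mem f hf =>
      obtain ⟨n, rfl⟩ := hf
      obtain ⟨c, hc⟩ := hT n
      exact (Finsupp.mem_span_range_iff_exists_finsupp).2
        ⟨c, funext fun v => (hsum c v).trans (hc v).symm⟩
    | zero => convert Submodule.zero_mem (Submodule.span ℂ (Set.range F)) using 1; ext1 v; simp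
    | add f g _ _ hf hg => convert add_mem hf hg using 1; ext1 v; simp
    | smul r f _ hf => convert Submodule.smul_mem _ r hf using 1; ext1 v; simp
  have hP : ∀ f ∈ Submodule.span ℂ (Set.range F),
      (fun v => aeval T P (f v)) ∈ Submodule.span ℂ (Set.range F) := by
    induction P using Polynomial.induction_on with
    | C r => exact fun f hf => by convert Submodule.smul_mem _ r hf using 1; ext1 v; simp
    | add P Q hP hQ =>
      intro f hf
      convert add_mem (hP f hf) (hQ f hf) using 1
      ext1 v
      simp
    | monomial n r h =>
      intro f hf
      have := h _ (hinv f hf)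
      rw [pow_succ, ← mul_assoc]
      simpa using this
  obtain ⟨c, hc⟩ := Finsupp.mem_span_range_iff_exists_finsupp.1
    (hP (F 0) (Submodule.subset_span ⟨0, rfl⟩))
  exact ⟨c, fun v => by rw [← hsum, Finsupp.linearCombination_apply, hc]⟩

/-- The coefficient on `F 0` does not depend on v and is, at `v₀`, the vacuum expectation, hence
zero for a centred polynomial. -/
theorem aeval_mem_of_centred {ι : Type*} {T : Module.End ℂ Fock} {F : ℕ → ι → Fock}
    (hT : ∀ n, ∃ c : ℕ →₀ ℂ, ∀ v, T (F n v) = Finsupp.linearCombination ℂ (fun k => F k v) c)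
    {v₀ : ι} (h0 : F 0 v₀ = e vac) (h1 : ∀ n, F (n + 1) v₀ vac = 0) {P : ℂ[X]}
    (hP : vacState (aeval T P) = 0) {K : Submodule ℂ Fock} {v : ι} (hK : ∀ n, F (n + 1) v ∈ K) :
    aeval T P (F 0 v) ∈ K := by
  obtain ⟨c, hc⟩ := exists_coeff hT P
  have hc0 : c 0 = 0 := by
    rw [vacState_apply, ← h0, hc, Finsupp.linearCombination_apply, Finsupp.sum,
      Finsupp.finsetSum_apply] at hP
    rw [← hP, Finset.sum_eq_single 0]
    · simp [h0, e_apply]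
    · intro n _ hn
      obtain ⟨n, rfl⟩ := Nat.exists_eq_succ_of_ne_zero hn
      simp [h1]
    · intro h
      simp [Finsupp.notMem_support_iff.1 h]
  rw [hc, Finsupp.linearCombination_apply]
  refine Submodule.sum_mem _ fun n hn => Submodule.smul_mem _ _ ?_
  rcases n with _ | n
  · exact absurd hc0 (Finsupp.mem_support_iff.1 hn)
  · exact hK n

/-- The span of the vectors whose first tensor is not constant. -/
def gaussPart : Submodule ℂ Fock :=
  Submodule.span ℂ (Set.range fun i : ℕ × List ℕ => e (i.1 + 1, i.2))

theorem aeval_gauss_mem {P : ℂ[X]} (hP : vacState (aeval gauss P) = 0) {x : Fock}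
    (hx : x ∈ Submodule.span ℂ (Set.range fun M : List ℕ => e (0, M))) :
    aeval gauss P x ∈ gaussPart := by
  induction hx using Submodule.span_induction with
  | mem x hx =>
    obtain ⟨M, rfl⟩ := hx
    refine aeval_mem_of_centred (F := fun n M => e (n, M)) (v₀ := []) (fun n => ?_) rfl
      (fun n => by simp [e_apply, vac]) hP fun n => Submodule.subset_span ⟨(n, M), rfl⟩
    refine ⟨Finsupp.single (n + 1) (root (n + 1)) + Finsupp.single (n - 1) (root n), fun M => ?_⟩
    rw [map_add, Finsupp.linearCombination_single, Finsupp.linearCombination_single, gauss,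
      LinearMap.add_apply, up_e]
    congr 1
    exact ofBasis_e _ _
  | zero => rw [map_zero]; exact zero_mem _
  | add x y _ _ hx hy => rw [map_add]; exact add_mem hx hy
  | smul r x _ hx => rw [map_smul]; exact Submodule.smul_mem _ _ hx

theorem pop_push (x : Fock) : pop (push x) = x := by
  refine LinearMap.congr_fun (f := pop * push) (g := 1) (ext_e ?_) x
  rintro ⟨n, M⟩
  rw [Module.End.mul_apply, push_e, pop_e_cons, Module.End.one_apply]

theorem push_apply_vac (x : Fock) : push x vac = 0 := by
  refine LinearMap.congr_fun (f := Finsupp.lapply vac ∘ₗ push) (g := 0) (ext_e ?_) x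
  rintro ⟨n, M⟩
  simp [push_e, e_apply, vac]

/-- On the powers of `push` applied to a vector killed by `pop`, `semi` acts by the Chebyshev
recursion, in the same way as on the vacuum. -/
theorem aeval_semi_mem {P : ℂ[X]} (hP : vacState (aeval semi P) = 0) {x : Fock}
    (hx : pop x = 0) : aeval semi P x ∈ LinearMap.range push := by
  refine aeval_mem_of_centred (ι := {x : Fock // pop x = 0}) (F := fun n x => (push ^ n) x)
    (v₀ := ⟨e vac, pop_e_nil 0⟩) (v := ⟨x, hx⟩) (fun n => ?_) rfl (fun n => ?_) hP fun n => ?_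
  · rcases n with _ | n
    · refine ⟨Finsupp.single 1 1, fun v => ?_⟩
      rw [Finsupp.linearCombination_single]
      simp [semi, v.2]
    · refine ⟨Finsupp.single (n + 2) 1 + Finsupp.single n 1, fun v => ?_⟩
      rw [map_add, Finsupp.linearCombination_single, Finsupp.linearCombination_single, one_smul,
        one_smul, pow_succ' push (n + 1), pow_succ' push n]
      simp [semi, pop_push]
  · rw [pow_succ', Module.End.mul_apply, push_apply_vac]
  · rw [pow_succ']
    exact ⟨_, rfl⟩

theorem range_push_le : LinearMap.range push ≤
    Submodule.span ℂ (Set.range fun M : List ℕ => e (0, M)) := by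
  rintro _ ⟨x, rfl⟩
  induction x using induction_e with
  | h0 => rw [map_zero]; exact zero_mem _
  | hadd x y hx hy => rw [map_add]; exact add_mem hx hy
  | he c i => rw [map_smul, push_e]; exact Submodule.smul_mem _ _ (Submodule.subset_span ⟨_, rfl⟩)

theorem gaussPart_le : gaussPart ≤ LinearMap.ker pop := by
  refine Submodule.span_le.2 ?_
  rintro _ ⟨i, rfl⟩
  exact pop_e_succ _ _

theorem gaussPart_apply_vac {x : Fock} (hx : x ∈ gaussPart) : x vac = 0 := by
  have : gaussPart ≤ LinearMap.ker (Finsupp.lapply (R := ℂ) vac) := by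
    refine Submodule.span_le.2 ?_
    rintro _ ⟨i, rfl⟩
    simp [e_apply, vac]
  exact this hx

/-- By induction, a reduced product sends the vacuum into `gaussPart` or into the range of `push`,
according to its leading letter. Each space is a legitimate input for the other operator, and
neither has a vacuum component. -/
theorem isFree : IsFree vacState ![gauss, semi] := by
  have key : ∀ (l : List (Fin 2 × ℂ[X])), IsReduced vacState ![gauss, semi] l →
      (∀ p ∈ l.head?, p.1 = 0 → polyProd ![gauss, semi] l (e vac) ∈ gaussPart) ∧
      (∀ p ∈ l.head?, p.1 = 1 → polyProd ![gauss, semi] l (e vac) ∈ LinearMap.range push) := by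
    intro l
    induction l with
    | nil => exact fun _ => ⟨fun p hp => by simp at hp, fun p hp => by simp at hp⟩
    | cons p l ih =>
      intro hl
      have hp := hl.centred p (by simp)
      obtain ⟨hl', hne⟩ := hl.tail
      obtain ⟨i, P⟩ := p
      obtain ⟨ih₀, ih₁⟩ := ih hl'
      refine ⟨fun p' hp' h => ?_, fun p' hp' h => ?_⟩
      · obtain rfl : (i, P) = p' := by simpa using hp'
        obtain rfl : i = 0 := h
        rw [polyProd_cons, Module.End.mul_apply]
        refine aeval_gauss_mem hp ?_
        rcases l with _ | ⟨⟨j, Q⟩, l⟩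
        · exact Submodule.subset_span ⟨[], rfl⟩
        · have hj : j = 1 := by
            have : (0 : Fin 2) ≠ j := by simpa using hne
            omega
          exact range_push_le (ih₁ (j, Q) (by simp) hj)
      · obtain rfl : (i, P) = p' := by simpa using hp'
        obtain rfl : i = 1 := h
        rw [polyProd_cons, Module.End.mul_apply]
        refine aeval_semi_mem hp ?_
        rcases l with _ | ⟨⟨j, Q⟩, l⟩
        · exact pop_e_nil 0
        · have hj : j = 0 := by
            have : (1 : Fin 2) ≠ j := by simpa using hne
            omega
          exact gaussPart_le (ih₀ (j, Q) (by simp) hj)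
  intro l hl0 hl
  obtain ⟨h₀, h₁⟩ := key l hl
  rcases l with _ | ⟨⟨i, P⟩, l⟩
  · exact absurd rfl hl0
  · rcases (by fin_cases i <;> simp : i = 0 ∨ i = 1) with hi | hi
    · exact gaussPart_apply_vac (h₀ (i, P) (by simp) hi)
    · obtain ⟨y, hy⟩ := h₁ (i, P) (by simp) hi
      rw [vacState_apply, ← hy, push_apply_vac]

/-- The algebra generated by the Gaussian and the semicircular operators. -/
def algebra : Subalgebra ℂ (Module.End ℂ Fock) := (FreeAlgebra.lift ℂ ![gauss, semi]).range

/-- The elements of the algebra generated by the Gaussian and the semicircular operators. -/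
def Alg : Type := algebra

instance : Ring Alg :=
  (@Subalgebra.toRing ℂ (Module.End ℂ Fock) _ _ _ algebra : Ring algebra)

instance : Algebra ℂ Alg :=
  (algebra.algebra : @Algebra ℂ algebra _
    (@Subalgebra.toRing ℂ (Module.End ℂ Fock) _ _ _ algebra).toSemiring)

/-- The inclusion in the algebra of operators. -/
def Alg.val : Alg →ₐ[ℂ] Module.End ℂ Fock where
  toFun b := b.1
  map_one' := rfl
  map_mul' _ _ := rfl
  map_zero' := rfl
  map_add' _ _ := rfl
  commutes' _ := rfl

theorem Alg.val_injective : Function.Injective Alg.val := fun _ _ h => Subtype.ext h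

theorem Alg.exists_lift_eq (b : Alg) : ∃ w, FreeAlgebra.lift ℂ ![gauss, semi] w = b.val := b.2

/-- The Gaussian operator, as an element of the algebra. -/
def gaussElt : Alg := ⟨gauss, FreeAlgebra.ι ℂ 0, by simp⟩

/-- The semicircular operator, as an element of the algebra. -/
def semiElt : Alg := ⟨semi, FreeAlgebra.ι ℂ 1, by simp⟩

theorem val_generator (i : Fin 2) : (![gaussElt, semiElt] i).val = ![gauss, semi] i := by
  fin_cases i <;> rfl

/-- The generators are their own formal adjoints, so the algebra they generate is stable under
adjoints. By `IsAdj.unique`, choosing one defines a genuine involution. -/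
theorem exists_isAdj (b : Alg) : ∃ b' : Alg, IsAdj b.val b'.val := by
  obtain ⟨w, hw⟩ := b.exists_lift_eq
  rw [← hw]
  clear hw
  induction w with
  | grade0 r =>
    refine ⟨algebraMap ℂ Alg (star r), ?_⟩
    rw [AlgHom.commutes, AlgHom.commutes]
    have := IsAdj.one.smul r
    rwa [← Algebra.algebraMap_eq_smul_one, ← Algebra.algebraMap_eq_smul_one] at this
  | grade1 i =>
    refine ⟨![gaussElt, semiElt] i, ?_⟩
    rw [FreeAlgebra.lift_ι_apply, val_generator]
    fin_cases i
    · exact isAdj_gauss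
    · exact isAdj_semi
  | mul w w' hw hw' =>
    obtain ⟨b, hb⟩ := hw
    obtain ⟨b', hb'⟩ := hw'
    exact ⟨b' * b, by rw [map_mul, map_mul]; exact hb.mul hb'⟩
  | add w w' hw hw' =>
    obtain ⟨b, hb⟩ := hw
    obtain ⟨b', hb'⟩ := hw'
    exact ⟨b + b', by rw [map_add, map_add]; exact hb.add hb'⟩

instance : Star Alg := ⟨fun b => (exists_isAdj b).choose⟩

theorem isAdj_star (b : Alg) : IsAdj b.val (star b).val := (exists_isAdj b).choose_spec

theorem star_eq_of_isAdj {b b' : Alg} (h : IsAdj b.val b'.val) : star b = b' :=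
  Alg.val_injective ((isAdj_star b).unique h)

instance : StarRing Alg where
  star_involutive b := star_eq_of_isAdj (isAdj_star b).symm
  star_mul b b' := star_eq_of_isAdj (by
    rw [map_mul, map_mul]
    exact (isAdj_star b).mul (isAdj_star b'))
  star_add b b' := star_eq_of_isAdj (by
    rw [map_add, map_add]
    exact (isAdj_star b).add (isAdj_star b'))

instance : StarModule ℂ Alg where
  star_smul c b := star_eq_of_isAdj (by
    rw [map_smul, map_smul]
    exact (isAdj_star b).smul c)

theorem vacState_generator (i : Fin 2) : vacState (![gauss, semi] i) = 0 := by
  fin_cases i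
  · exact gauss_apply_e_vac
  · change semi (e vac) vac = 0
    rw [semi_apply_vac, vac, popRight_e_nil, Finsupp.zero_apply]

/-- The vacuum state on the algebra generated by the operators. -/
def state : TracialState Alg where
  Φ := vacState ∘ₗ Alg.val.toLinearMap
  map_one := vacState_one
  -- Traciality needs no computation with operators: it follows from freeness and from the vanishing
  -- means of the generators.
  tracial b b' := by
    obtain ⟨w, hw⟩ := b.exists_lift_eq
    obtain ⟨w', hw'⟩ := b'.exists_lift_eq
    rw [LinearMap.comp_apply, LinearMap.comp_apply, AlgHom.toLinearMap_apply,
      AlgHom.toLinearMap_apply, map_mul Alg.val, map_mul Alg.val, ← hw, ← hw']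
    exact isFree.map_mul_comm vacState_one vacState_generator w w'
  nonneg b := by
    rw [LinearMap.comp_apply, AlgHom.toLinearMap_apply, map_mul Alg.val, vacState_apply,
      Module.End.mul_apply, ← pair_e_left, ← isAdj_star]
    exact pair_self_nonneg _

theorem state_apply (b : Alg) : state.Φ b = b.val (e vac) vac := rfl

theorem isSelfAdjoint_gaussElt : IsSelfAdjoint gaussElt := star_eq_of_isAdj isAdj_gauss

theorem isSelfAdjoint_semiElt : IsSelfAdjoint semiElt := star_eq_of_isAdj isAdj_semi

theorem isFree_state : IsFree state.Φ ![gaussElt, semiElt] := by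
  have haeval : ∀ i (P : ℂ[X]), (aeval (![gaussElt, semiElt] i) P).val =
      aeval (![gauss, semi] i) P := by
    intro i P
    rw [← val_generator]
    exact (aeval_algHom_apply Alg.val _ P).symm
  intro l hl0 hl
  have hprod : (polyProd ![gaussElt, semiElt] l).val = polyProd ![gauss, semi] l := by
    rw [polyProd, polyProd, map_list_prod, List.map_map]
    congr 2
    funext p
    exact haeval p.1 p.2
  change vacState (polyProd ![gaussElt, semiElt] l).val = 0
  rw [hprod]
  refine isFree l hl0 ⟨hl.chain, fun p hp => ?_⟩
  rw [← haeval]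
  exact hl.centred p hp

end Fock

end Traffic

end

noncomputable section

namespace Traffic

open MeasureTheory ProbabilityTheory Real

/-! ### Moments of the Gaussian and of the semicircular laws -/

theorem integrable_pow_mul_exp (k : ℕ) :
    Integrable fun x : ℝ => x ^ k * rexp (-(1 / 2) * x ^ 2) := by
  have := integrable_rpow_mul_exp_neg_mul_sq (b := 1 / 2) (by norm_num) (s := k)
    (by have : (0 : ℝ) ≤ k := Nat.cast_nonneg k
        linarith)
  simpa only [rpow_natCast] using this

/-- Integration by parts, x exp(-x²/2) being the derivative of -exp(-x²/2). -/
theorem integral_pow_mul_exp (k : ℕ) :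
    ∫ x : ℝ, x ^ (k + 2) * rexp (-(1 / 2) * x ^ 2) =
      (k + 1) * ∫ x : ℝ, x ^ k * rexp (-(1 / 2) * x ^ 2) := by
  have hu : ∀ x : ℝ, HasDerivAt (fun x : ℝ => x ^ (k + 1)) ((k + 1) * x ^ k) x := fun x => by
    simpa using hasDerivAt_pow (k + 1) x
  have hv : ∀ x : ℝ, HasDerivAt (fun x : ℝ => -rexp (-(1 / 2) * x ^ 2))
      (x * rexp (-(1 / 2) * x ^ 2)) x := fun x => by
    have := (((hasDerivAt_pow 2 x).const_mul (-(1 / 2 : ℝ))).exp).neg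
    refine this.congr_deriv ?_
    push_cast
    ring
  have := integral_mul_deriv_eq_deriv_mul_of_integrable (fun x _ => hu x) (fun x _ => hv x)
    ((integrable_pow_mul_exp (k + 2)).congr (Filter.Eventually.of_forall fun x => ?_))
    (((integrable_pow_mul_exp k).const_mul (-((k : ℝ) + 1))).congr
      (Filter.Eventually.of_forall fun x => ?_))
    ((integrable_pow_mul_exp (k + 1)).neg.congr (Filter.Eventually.of_forall fun x => ?_))
  · rw [← integral_neg] at this
    rw [← integral_const_mul]
    calc ∫ x : ℝ, x ^ (k + 2) * rexp (-(1 / 2) * x ^ 2)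
        = ∫ x : ℝ, x ^ (k + 1) * (x * rexp (-(1 / 2) * x ^ 2)) := by
          congr 1
          funext x
          ring
      _ = _ := this
      _ = _ := by
          congr 1
          funext x
          ring
  · simp only [Pi.mul_apply]
    ring
  · simp only [Pi.mul_apply]
    ring
  · simp only [Pi.mul_apply, Pi.neg_apply]
    ring

theorem integral_pow_gaussianReal (k : ℕ) :
    ∫ t, t ^ (k + 2) ∂(gaussianReal 0 1) = (k + 1) * ∫ t, t ^ k ∂(gaussianReal 0 1) := by
  have h : ∀ k : ℕ, ∫ t, t ^ k ∂(gaussianReal 0 1) =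
      (√(2 * π))⁻¹ * ∫ x : ℝ, x ^ k * rexp (-(1 / 2) * x ^ 2) := by
    intro k
    rw [integral_gaussianReal_eq_integral_smul one_ne_zero, ← integral_const_mul]
    congr 1
    funext x
    simp only [gaussianPDFReal, smul_eq_mul, NNReal.coe_one, mul_one, sub_zero]
    rw [show -x ^ 2 / 2 = -(1 / 2) * x ^ 2 by ring]
    ring
  rw [h, h, integral_pow_mul_exp]
  ring

/-- The moments of the semicircular law. -/
def semicircleMoment (k : ℕ) : ℝ :=
  ∫ t in (-2 : ℝ)..2, t ^ k * (1 / (2 * π) * √(4 - t ^ 2))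

theorem continuous_pow_mul_sqrt (k : ℕ) :
    Continuous fun t : ℝ => t ^ k * (1 / (2 * π) * √(4 - t ^ 2)) := by fun_prop

/-- Integrate the derivative of t^k (4 - t²)^(3/2), a function that vanishes at both ends. For k = 0
the truncated exponent k - 1 is multiplied by zero. -/
theorem semicircleMoment_rec (k : ℕ) :
    k * (4 * semicircleMoment (k - 1)) = (k + 3) * semicircleMoment (k + 1) := by
  have hii : ∀ k : ℕ, IntervalIntegrable (fun t : ℝ => t ^ k * (1 / (2 * π) * √(4 - t ^ 2)))
      volume (-2) 2 := fun k => (continuous_pow_mul_sqrt k).intervalIntegrable _ _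
  have key := intervalIntegral.integral_eq_sub_of_hasDerivAt_of_le (a := (-2 : ℝ)) (b := 2)
    (f := fun t => t ^ k * (1 / (2 * π) * ((4 - t ^ 2) * √(4 - t ^ 2))))
    (f' := fun t => k * (4 * (t ^ (k - 1) * (1 / (2 * π) * √(4 - t ^ 2)))) -
      (k + 3) * (t ^ (k + 1) * (1 / (2 * π) * √(4 - t ^ 2)))) (by norm_num)
    (by fun_prop) (fun t ht => ?_)
    ((((hii _).const_mul _).const_mul _).sub ((hii _).const_mul _))
  · rw [intervalIntegral.integral_sub (((hii _).const_mul _).const_mul _) ((hii _).const_mul _),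
      intervalIntegral.integral_const_mul, intervalIntegral.integral_const_mul,
      intervalIntegral.integral_const_mul] at key
    have e2 : (4 : ℝ) - 2 ^ 2 = 0 := by norm_num
    rw [neg_sq, e2, zero_mul, mul_zero, mul_zero, mul_zero, sub_zero] at key
    exact sub_eq_zero.1 key
  · have hpos : 0 < 4 - t ^ 2 := by nlinarith [ht.1, ht.2]
    have h₁ : HasDerivAt (fun t : ℝ => 4 - t ^ 2) (-(2 * t)) t := by
      simpa using (hasDerivAt_pow 2 t).const_sub 4
    have h₂ := (hasDerivAt_pow k t).mul ((h₁.mul (h₁.sqrt hpos.ne')).const_mul (1 / (2 * π)))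
    refine h₂.congr_deriv ?_
    have hs : √(4 - t ^ 2) * √(4 - t ^ 2) = 4 - t ^ 2 := mul_self_sqrt hpos.le
    have hs0 : √(4 - t ^ 2) ≠ 0 := (sqrt_pos.2 hpos).ne'
    have e : (4 - t ^ 2) * (-(2 * t) / (2 * √(4 - t ^ 2))) = -t * √(4 - t ^ 2) := by
      field_simp
      linear_combination t * hs
    rw [e, Pi.mul_apply]
    rcases k with _ | k
    · simp
      ring
    · simp only [Nat.add_sub_cancel]
      push_cast
      ring

theorem semicircleMoment_zero : semicircleMoment 0 = 1 := by
  have h := integral_sqrt_one_sub_sq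
  have hs := intervalIntegral.integral_comp_mul_left (a := -1) (b := 1)
    (fun t : ℝ => √(4 - t ^ 2)) (c := 2) two_ne_zero
  have e : ∀ x : ℝ, √(4 - (2 * x) ^ 2) = 2 * √(1 - x ^ 2) := fun x => by
    rw [show 4 - (2 * x) ^ 2 = 2 ^ 2 * (1 - x ^ 2) by ring, sqrt_mul (by norm_num),
      sqrt_sq (by norm_num)]
  simp_rw [e] at hs
  rw [intervalIntegral.integral_const_mul, h, smul_eq_mul] at hs
  norm_num at hs
  unfold semicircleMoment
  simp only [pow_zero, one_mul]
  rw [intervalIntegral.integral_const_mul]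
  rw [show ∫ t in (-2 : ℝ)..2, √(4 - t ^ 2) = 2 * π by linarith]
  field_simp

theorem semicircleMoment_odd (n : ℕ) : semicircleMoment (2 * n + 1) = 0 := by
  induction n with
  | zero => simpa using (semicircleMoment_rec 0).symm
  | succ n ih =>
    have h := semicircleMoment_rec (2 * n + 2)
    rw [show 2 * n + 2 - 1 = 2 * n + 1 by omega, ih] at h
    rcases mul_eq_zero.1 ((by simpa using h.symm :
      (((2 * n + 2 : ℕ) : ℝ) + 3) * semicircleMoment (2 * n + 2 + 1) = 0)) with h' | h'
    · exact absurd h' (by positivity)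
    · exact h'

/-- The recursion becomes (n + 2) C_{n+1} = 2 (2n + 1) C_n, obtained for the Catalan numbers from
central binomial coefficients. -/
theorem semicircleMoment_even (n : ℕ) : semicircleMoment (2 * n) = catalan n := by
  induction n with
  | zero => simpa using semicircleMoment_zero
  | succ n ih =>
    have h := semicircleMoment_rec (2 * n + 1)
    rw [Nat.add_sub_cancel, ih] at h
    have h₁ := succ_mul_catalan_eq_centralBinom n
    have h₂ := succ_mul_catalan_eq_centralBinom (n + 1)
    have h₃ := Nat.succ_mul_centralBinom_succ n
    rw [← h₁, ← h₂] at h₃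
    have h₄ : (n + 1 + 1) * catalan (n + 1) = 2 * (2 * n + 1) * catalan n :=
      Nat.eq_of_mul_eq_mul_left n.succ_pos (by rw [Nat.succ_eq_add_one, h₃]; ring)
    have h₅ : ((n : ℝ) + 1 + 1) * catalan (n + 1) = 2 * (2 * n + 1) * catalan n := by
      exact_mod_cast h₄
    have hn : (n : ℝ) + 1 + 1 ≠ 0 := by positivity
    refine mul_left_cancel₀ hn ?_
    rw [h₅, show 2 * (n + 1) = 2 * n + 1 + 1 by ring]
    push_cast at h
    linarith

theorem sum_range_two_mul_add_one (g : ℕ → ℂ) (hg : ∀ j, g (2 * j + 1) = 0) (n : ℕ) :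
    ∑ m ∈ Finset.range (2 * n + 1), g m = ∑ j ∈ Finset.range (n + 1), g (2 * j) := by
  induction n with
  | zero => simp
  | succ n ih =>
    rw [Finset.sum_range_succ _ (n + 1), ← ih, show 2 * (n + 1) + 1 = 2 * n + 1 + 1 + 1 by ring,
      Finset.sum_range_succ, Finset.sum_range_succ _ (2 * n + 1), hg, add_zero,
      show 2 * n + 1 + 1 = 2 * (n + 1) by ring]

/-- A sequence that satisfies the recursion of the Catalan numbers. -/
theorem eq_semicircleMoment {f : ℕ → ℂ} (h0 : f 0 = 1)
    (h : ∀ k, f (k + 1) = ∑ m ∈ Finset.range k, f m * f (k - (m + 1))) (k : ℕ) :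
    f k = (semicircleMoment k : ℝ) := by
  have key : ∀ n, f (2 * n) = catalan n ∧ f (2 * n + 1) = 0 := by
    intro n
    induction n using Nat.strong_induction_on with
    | _ n ih =>
      have heven : f (2 * n) = catalan n := by
        rcases n with _ | n
        · simpa using h0
        · rw [show 2 * (n + 1) = 2 * n + 1 + 1 by ring, h]
          -- Odd indices contribute zero, and for even m the complementary index 2n - m is even, so
          -- the sum is the Catalan convolution.
          have hsum : ∀ m ∈ Finset.range (2 * n + 1), f m * f (2 * n + 1 - (m + 1)) =
              if Even m then (catalan (m / 2) : ℂ) * catalan (n - m / 2) else 0 := by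
            intro m hm
            rw [Finset.mem_range] at hm
            rcases Nat.even_or_odd' m with ⟨j, rfl | rfl⟩
            · rw [if_pos (even_two_mul j), (ih j (by omega)).1, Nat.mul_div_cancel_left _ two_pos,
                show 2 * n + 1 - (2 * j + 1) = 2 * (n - j) by omega, (ih (n - j) (by omega)).1]
            · rw [if_neg (by simp), (ih j (by omega)).2, zero_mul]
          rw [Finset.sum_congr rfl hsum, sum_range_two_mul_add_one _ (fun j => if_neg (by simp)),
            catalan_succ', Finset.Nat.sum_antidiagonal_eq_sum_range_succ
              (fun x y => catalan x * catalan y)]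
          push_cast
          refine Finset.sum_congr rfl fun j _ => ?_
          rw [if_pos (even_two_mul j), Nat.mul_div_cancel_left _ two_pos]
      refine ⟨heven, ?_⟩
      rw [h]
      refine Finset.sum_eq_zero fun m hm => ?_
      rw [Finset.mem_range] at hm
      rcases Nat.even_or_odd' m with ⟨j, rfl | rfl⟩
      · rw [show 2 * n - (2 * j + 1) = 2 * (n - j - 1) + 1 by omega, (ih (n - j - 1) (by omega)).2,
          mul_zero]
      · rw [(ih j (by omega)).2, zero_mul]
  rcases Nat.even_or_odd' k with ⟨n, rfl | rfl⟩
  · rw [(key n).1, semicircleMoment_even]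
    simp
  · rw [(key n).2, semicircleMoment_odd]
    simp

end Traffic

end

/-! ### From moments to convergence in `*`-distribution -/

noncomputable section

namespace Traffic

open Polynomial Filter Topology

section StarProbability

variable {B : Type*} [Ring B] [StarRing B] [Algebra ℂ B]

/-- The polynomial obtained from a `*`-polynomial by identifying the variable and its adjoint. -/
def StarPoly.toPolynomial : StarPoly Unit →ₐ[ℂ] ℂ[X] := FreeAlgebra.lift ℂ fun _ => X

theorem StarPoly.eval_eq_aeval {b : B} (hb : IsSelfAdjoint b) (P : StarPoly Unit) :
    StarPoly.eval (fun _ => b) P = aeval b P.toPolynomial := by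
  refine AlgHom.congr_fun (φ₁ := StarPoly.eval fun _ => b)
    (φ₂ := (aeval b).comp StarPoly.toPolynomial) (FreeAlgebra.hom_ext (funext ?_)) P
  rintro ⟨u, _ | _⟩
  · simp [StarPoly.eval, StarPoly.toPolynomial, starPow]
  · simp [StarPoly.eval, StarPoly.toPolynomial, starPow, hb.star_eq]

/-- A polynomial, as a `*`-polynomial. -/
def StarPoly.ofPolynomial (P : ℂ[X]) : StarPoly Unit := aeval (FreeAlgebra.ι ℂ ((), false)) P

theorem StarPoly.eval_ofPolynomial (b : B) (P : ℂ[X]) :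
    StarPoly.eval (fun _ => b) (StarPoly.ofPolynomial P) = aeval b P := by
  rw [StarPoly.ofPolynomial, ← aeval_algHom_apply, StarPoly.eval, FreeAlgebra.lift_ι_apply]
  rfl

/-- For self-adjoint elements, `*`-polynomials evaluate like ordinary polynomials, so only the
passage between lists and families on `Fin` is at stake. -/
theorem TracialState.starFree_iff {I : Type} (S : TracialState B) {x : I → B}
    (hx : ∀ i, IsSelfAdjoint (x i)) :
    S.StarFree (fun i (_ : Unit) => x i) ↔ IsFree S.Φ x := by
  constructor
  · intro h l hl0 hl
    rcases l with _ | ⟨p, l⟩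
    · exact absurd rfl hl0
    · have key := h l.length (fun k => ((p :: l).get k).1)
        (fun k => StarPoly.ofPolynomial ((p :: l).get k).2) (fun k => ?_) (fun k => ?_)
      · simp_rw [StarPoly.eval_ofPolynomial] at key
        have e : (List.ofFn fun k : Fin (l.length + 1) =>
            aeval (x ((p :: l).get k).1) ((p :: l).get k).2) =
              (p :: l).map fun p => aeval (x p.1) p.2 := by
          conv_rhs => rw [← List.ofFn_get (p :: l)]
          rw [List.map_ofFn]
          rfl
        rwa [e] at key
      · have hc := (List.isChain_map _).1 hl.chain
        exact List.isChain_iff_getElem.1 hc k (by simp)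
      · rw [StarPoly.eval_ofPolynomial]
        exact hl.centred _ (List.get_mem _ _)
  · intro h n i P hi hP
    simp_rw [StarPoly.eval_eq_aeval (hx _)] at hP ⊢
    have key := h (List.ofFn fun k => (i k, (P k).toPolynomial)) (by simp) ⟨?_, ?_⟩
    · rwa [polyProd, List.map_ofFn] at key
    · rw [List.map_ofFn, List.isChain_iff_getElem]
      intro k hk
      simp only [List.getElem_ofFn, Function.comp_apply]
      rw [List.length_ofFn] at hk
      exact hi ⟨k, by omega⟩
    · intro p hp
      obtain ⟨k, rfl⟩ := (List.mem_ofFn' _ _).1 hp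
      exact hP k

theorem TracialState.starDistribution_eq_sum (S : TracialState B) {b : B} (hb : IsSelfAdjoint b)
    (P : StarPoly Unit) : S.starDistribution (fun _ => b) P =
      ∑ k ∈ Finset.range (P.toPolynomial.natDegree + 1),
        P.toPolynomial.coeff k * S.Φ (b ^ k) := by
  rw [TracialState.starDistribution, LinearMap.comp_apply, AlgHom.toLinearMap_apply,
    StarPoly.eval_eq_aeval hb, aeval_eq_sum_range, map_sum]
  simp_rw [map_smul, smul_eq_mul]

theorem convergesInStarDistribution_of_moments {A : Type*} [Ring A] [StarRing A] [Algebra ℂ A]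
    [StarModule ℂ A] [StarModule ℂ B] (S : TracialState A) (S' : TracialState B) {m : ℕ → A}
    {m' : B} (hm : ∀ n, IsSelfAdjoint (m n)) (hm' : IsSelfAdjoint m')
    (h : ∀ k, Tendsto (fun n => S.Φ (m n ^ k)) atTop (𝓝 (S'.Φ (m' ^ k)))) :
    ConvergesInStarDistribution S m S' m' := by
  intro P
  rw [S'.starDistribution_eq_sum hm']
  simp_rw [S.starDistribution_eq_sum (hm _)]
  exact tendsto_finsetSum _ fun k _ => (h k).const_mul _

theorem isSelfAdjoint_ofReal_smul [StarModule ℂ B] (r : ℝ) {b : B} (hb : IsSelfAdjoint b) :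
    IsSelfAdjoint ((r : ℂ) • b) := by
  rw [IsSelfAdjoint, star_smul, hb.star_eq, RCLike.star_def, Complex.conj_ofReal]

end StarProbability

namespace Fock

theorem state_gaussElt_pow (k : ℕ) : state.Φ (gaussElt ^ k) = (gauss ^ k) (e vac) vac := by
  rw [state_apply, map_pow]
  rfl

theorem state_semiElt_pow (k : ℕ) : state.Φ (semiElt ^ k) = (semi ^ k) (e vac) vac := by
  rw [state_apply, map_pow]
  rfl

theorem isStandardGaussian : state.IsStandardGaussian gaussElt := by
  refine ⟨isSelfAdjoint_gaussElt, fun k => ?_⟩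
  induction k using Nat.twoStepInduction with
  | zero => simpa using state.map_one
  | one =>
    rw [state_gaussElt_pow, pow_one, gauss_apply_e_vac]
    simp [ProbabilityTheory.integral_id_gaussianReal]
  | more k h _ =>
    rw [state_gaussElt_pow, gauss_pow_apply_vac, ← state_gaussElt_pow, h,
      integral_pow_gaussianReal]
    push_cast
    rfl

theorem isSemicircular : state.IsSemicircular semiElt := by
  refine ⟨isSelfAdjoint_semiElt, eq_semicircleMoment (by simpa using state.map_one) fun k => ?_⟩
  simp_rw [state_semiElt_pow]
  -- Without the Gaussian part, the Schwinger-Dyson equation is the recursion that characterizes the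
  -- semicircular moments.
  have := semi_mul_pow_apply_vac 0 1 k 0
  simpa [pow_succ'] using this

theorem starFree : state.StarFree fun (i : Fin 2) (_ : Unit) => ![gaussElt, semiElt] i := by
  refine (state.starFree_iff fun i => ?_).2 isFree_state
  fin_cases i
  · exact isSelfAdjoint_gaussElt
  · exact isSelfAdjoint_semiElt

/-- The mixed moments of `α d + β s` and `α d`. -/
def mixedMoment (α β : ℂ) (k j : ℕ) : ℂ :=
  state.Φ ((α • gaussElt + β • semiElt) ^ k * (α • gaussElt) ^ j)

theorem mixedMoment_zero_zero (α β : ℂ) : mixedMoment α β 0 0 = 1 := by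
  rw [mixedMoment, pow_zero, pow_zero, mul_one, state.map_one]

theorem mixedMoment_zero (α β : ℂ) (j : ℕ) :
    mixedMoment α β 0 j = α ^ j * (gauss ^ j) (e vac) vac := by
  rw [mixedMoment, pow_zero, one_mul, _root_.smul_pow, map_smul, smul_eq_mul, state_gaussElt_pow]

theorem mixedMoment_zero_one (α β : ℂ) : mixedMoment α β 0 1 = 0 := by
  rw [mixedMoment_zero, pow_one, pow_one, gauss_apply_e_vac, mul_zero]

theorem mixedMoment_zero_add_two (α β : ℂ) (j : ℕ) :
    mixedMoment α β 0 (j + 2) = (j + 1) * α ^ 2 * mixedMoment α β 0 j := by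
  rw [mixedMoment_zero, mixedMoment_zero, gauss_pow_apply_vac]
  ring

theorem mixedMoment_eq (α β : ℂ) (k j : ℕ) : mixedMoment α β k j =
    α ^ j * ((α • gauss + β • semi) ^ k * gauss ^ j) (e vac) vac := by
  rw [mixedMoment, _root_.smul_pow, mul_smul_comm, map_smul, smul_eq_mul, state_apply, map_mul,
    map_pow, map_pow, map_add, map_smul, map_smul]
  rfl

/-- Split the first factor: its Gaussian part is moved to the end by traciality, and its
semicircular part is handled by the Schwinger-Dyson equation, which supplies the second factor β. -/
theorem mixedMoment_succ (α β : ℂ) (k j : ℕ) :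
    mixedMoment α β (k + 1) j = mixedMoment α β k (j + 1) + β ^ 2 * ∑ m ∈ Finset.range k,
      mixedMoment α β m 0 * mixedMoment α β (k - (m + 1)) j := by
  have h₁ : mixedMoment α β k (j + 1) = state.Φ ((α • gaussElt) *
      ((α • gaussElt + β • semiElt) ^ k * (α • gaussElt) ^ j)) := by
    rw [state.tracial, mixedMoment, pow_succ, mul_assoc]
  have h₂ : state.Φ (semiElt * ((α • gaussElt + β • semiElt) ^ k * (α • gaussElt) ^ j)) =
      α ^ j * (semi * ((α • gauss + β • semi) ^ k * gauss ^ j)) (e vac) vac := by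
    rw [_root_.smul_pow, mul_smul_comm, mul_smul_comm, map_smul, smul_eq_mul, state_apply, map_mul,
      map_mul, map_pow, map_pow, map_add, map_smul, map_smul]
    rfl
  rw [h₁, mixedMoment, pow_succ', mul_assoc, add_mul, map_add, smul_mul_assoc β, map_smul, h₂,
    semi_mul_pow_apply_vac, smul_eq_mul]
  simp_rw [mixedMoment_eq, pow_zero, mul_one, one_mul, Finset.mul_sum]
  congr 1
  refine Finset.sum_congr rfl fun m _ => ?_
  ring

/-- Joint moments of a free pair of a Gaussian and a semicircular element. -/
theorem moment_eq_mixedMoment {B : Type*} [Ring B] [StarRing B] [Algebra ℂ B]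
    {S : TracialState B} {d s : B} (hd : S.IsStandardGaussian d) (hs : S.IsSemicircular s)
    (hfree : S.StarFree fun (i : Fin 2) (_ : Unit) => ![d, s] i) (α β : ℂ) (k : ℕ) :
    S.Φ ((α • d + β • s) ^ k) = mixedMoment α β k 0 := by
  have hfree' : IsFree S.Φ ![d, s] := (S.starFree_iff fun i => by
    fin_cases i
    · exact hd.1
    · exact hs.1).1 hfree
  have h := hfree'.map_lift_eq isFree_state S.map_one state.map_one (fun i k => by
    fin_cases i
    · exact (hd.2 k).trans (isStandardGaussian.2 k).symm
    · exact (hs.2 k).trans (isSemicircular.2 k).symm)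
    ((α • FreeAlgebra.ι ℂ 0 + β • FreeAlgebra.ι ℂ 1) ^ k)
  rw [mixedMoment, pow_zero, mul_one]
  simpa using h

end Fock

/-- Convergence of the normalized sums to a free pair. -/
theorem TrafficIID.convergesInStarDistribution {A : Type*} [Ring A] [StarRing A] [Algebra ℂ A]
    [StarModule ℂ A] {S : TrafficSpace A} {a : ℕ → A} (h : TrafficIID S a)
    (hsa : ∀ n, IsSelfAdjoint (a n)) (hmean : ∀ n, S.Φ (a n) = 0) {p : ℝ} (hp0 : 0 ≤ p)
    (hp1 : p ≤ 1) (hloop : (S.τ₀ TestGraph.doubleLoop fun _ => a 0) = (p : ℂ))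
    (harrow : (S.τ₀ TestGraph.doubleArrow fun _ => a 0) = ((1 - p : ℝ) : ℂ))
    {B : Type*} [Ring B] [StarRing B] [Algebra ℂ B] [StarModule ℂ B]
    (S' : TracialState B) {d s : B} (hd : S'.IsStandardGaussian d) (hs : S'.IsSemicircular s)
    (hfree : S'.StarFree fun (i : Fin 2) (_ : Unit) => ![d, s] i) :
    ConvergesInStarDistribution S.toTracialState
      (fun n => ((1 / Real.sqrt n : ℝ) : ℂ) • ∑ i ∈ Finset.range n, a i)
      S' (((Real.sqrt p : ℝ) : ℂ) • d + ((Real.sqrt (1 - p) : ℝ) : ℂ) • s) := by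
  refine convergesInStarDistribution_of_moments _ _
    (fun n => isSelfAdjoint_ofReal_smul _ (isSelfAdjoint_sum _ fun i _ => hsa i))
    ((isSelfAdjoint_ofReal_smul _ hd.1).add (isSelfAdjoint_ofReal_smul _ hs.1)) fun k => ?_
  have hα : ((Real.sqrt p : ℝ) : ℂ) ^ 2 = p := by
    rw [← Complex.ofReal_pow, Real.sq_sqrt hp0]
  have hβ : ((Real.sqrt (1 - p) : ℝ) : ℂ) ^ 2 = ((1 - p : ℝ) : ℂ) := by
    rw [← Complex.ofReal_pow, Real.sq_sqrt (sub_nonneg.2 hp1)]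
  rw [Fock.moment_eq_mixedMoment hd hs hfree]
  -- With α² = p and β² = 1 - p, the mixed moments of the Fock pair satisfy the limiting recursion,
  -- and the case j = 0 is the claim.
  refine (h.tendsto_moment hmean (Fock.mixedMoment_zero_zero _ _) (Fock.mixedMoment_zero_one _ _)
    (fun j => ?_) (fun k j => ?_) k 0).congr fun n => ?_
  · rw [Fock.mixedMoment_zero_add_two, hα, hloop]
  · rw [Fock.mixedMoment_succ, hβ, harrow]
  · rw [moment, pow_zero, mul_one, mean]

end Traffic

end

theorem mainTheorem2 {A : Type*} [Ring A] [StarRing A] [Algebra ℂ A] [StarModule ℂ A]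
    (S : TrafficSpace A) (a : ℕ → A)
    (hsa : ∀ n, IsSelfAdjoint (a n))
    (hid : ∀ n n', S.EqualInLaw (fun _ : Unit => a n) (fun _ : Unit => a n'))
    (hfree : S.TrafficFree (fun n : ℕ => n) a)
    (hmean : ∀ n, S.Φ (a n) = 0)
    (hvar : ∀ n, S.Φ (a n ^ 2) = 1) :
    ∃ p : ℝ, 0 ≤ p ∧ p ≤ 1 ∧
      (∀ n, S.τ₀ TestGraph.doubleLoop (fun _ => a n) = (p : ℂ)) ∧
      (∀ n, S.τ₀ TestGraph.doubleArrow (fun _ => a n) = ((1 - p : ℝ) : ℂ)) ∧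
      (∃ (B : Type) (_ : Ring B) (_ : StarRing B) (_ : Algebra ℂ B) (_ : StarModule ℂ B)
        (S' : TracialState B) (d s : B),
        S'.IsStandardGaussian d ∧ S'.IsSemicircular s ∧
        S'.StarFree (fun (i : Fin 2) (_ : Unit) => ![d, s] i) ∧
        ConvergesInStarDistribution S.toTracialState
          (fun n => ((1 / Real.sqrt n : ℝ) : ℂ) • ∑ i ∈ Finset.range n, a i)
          S' (((Real.sqrt p : ℝ) : ℂ) • d + ((Real.sqrt (1 - p) : ℝ) : ℂ) • s)) ∧
      (∀ (B : Type*) [Ring B] [StarRing B] [Algebra ℂ B] [StarModule ℂ B]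
        (S' : TracialState B) (d s : B),
        S'.IsStandardGaussian d → S'.IsSemicircular s →
        S'.StarFree (fun (i : Fin 2) (_ : Unit) => ![d, s] i) →
        ConvergesInStarDistribution S.toTracialState
          (fun n => ((1 / Real.sqrt n : ℝ) : ℂ) • ∑ i ∈ Finset.range n, a i)
          S' (((Real.sqrt p : ℝ) : ℂ) • d + ((Real.sqrt (1 - p) : ℝ) : ℂ) • s)) := by
  have h : TrafficIID S a := ⟨hid, hfree⟩
  obtain ⟨p, hp0, hp1, hloop, harrow⟩ := h.exists_param (hsa 0) (hvar 0)
  refine ⟨p, hp0, hp1, fun n => (h.τ₀_law _ n).trans hloop, fun n => (h.τ₀_law _ n).trans harrow,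
    ⟨Fock.Alg, inferInstance, inferInstance, inferInstance, inferInstance, Fock.state,
      Fock.gaussElt, Fock.semiElt, Fock.isStandardGaussian, Fock.isSemicircular, Fock.starFree,
      ?_⟩, ?_⟩
  · exact h.convergesInStarDistribution hsa hmean hp0 hp1 hloop harrow Fock.state
      Fock.isStandardGaussian Fock.isSemicircular Fock.starFree
  · intro B _ _ _ _ S' d s hd hs hfree'
    exact h.convergesInStarDistribution hsa hmean hp0 hp1 hloop harrow S' hd hs hfree'
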